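/- **Setting.** Let $(\Omega,\mathcal F,(\mathcal F_t)_{t\ge 0},P)$ be a filtered probability space carrying claim epochs $0=T_0<T_1<T_2<\cdots\to\infty$ and nonnegative claim sizes $Y_1,Y_2,\dots$, where the interarrival times $T_{i+1}-T_i$ are exponential with mean $1/\lambda$ $(\lambda>0)$, the $Y_i$ have law $Q$, and all these variables are independent. Put $N(t)=\#\{i\ge 1: T_i\le t\}$; assume that $N(t)$ and $\sum_{i\le N(t)}Y_i$ are $\mathcal F_t$-adapted and that, for $s\le t$, their increments over $(s,t]$ are jointly independent of $\mathcal F_s$. Let $\delta>0$, $u_0>0$, and let $g$ be Lipschitz continuous on $[0,\infty)$ with $g(x)>u_0$ for all $x\ge 0$. A restricted dividend policy $D\in\Pi_R$ is $D(t)=\int_0^t u(s)\,ds$ with $u$ progressively measurable and $0\le u\le u_0$. Its surplus process $X$ from the initial value $x$ is adapted and satisfies, almost surely, up to and including the ruin time $\tau=\inf\{t\ge 0: X(t)<0\}$ (with $X(\tau)<0$ if $\tau<\infty$), $$X(t)=x+\int_0^t g(X(s))\,ds-\sum_{i=1}^{N(t)}Y_i-\int_0^t u(s)\,ds .$$ Put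 $J(x,D)=E\int_0^\tau e^{-\delta t}u(t)\,dt$ and $V_R(x)=\sup_{D\in\Pi_R}J(x,D)$. **Theorem.** The function $V_R$ has a right derivative at every $x\ge 0$, and it is differentiable at every $x>0$ with $Q(\{x\})=0$. Write $V_R'(x)$ for the derivative of $V_R$ at $x$, and for its right derivative at $x=0$ and at points $x>0$ where $V_R$ is not differentiable. Then for every $x\ge 0$ there is a policy $D^*_R\in\Pi_R$ with rate $u^*$ and surplus process $X^*$ started at $x$ such that almost surely, for all $t<\tau$, $$u^*(t)=\begin{cases}0, & V_R'(X^*(t))>1,\\ u_0, & V_R'(X^*(t))\le 1,\end{cases}$$ and every such policy is optimal for the restricted problem: $J(x,D^*_R)=V_R(x)$ and $J(x,D)\le J(x,D^*_R)$ for all $D\in\Pi_R$. -/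

import Mathlib

open MeasureTheory ProbabilityTheory Set Filter
open scoped NNReal ENNReal

noncomputable section

namespace RiskModel

variable {Ω : Type*} [MeasurableSpace Ω]

/-- The number `N(t)` of claims up to time `t`. The claim epochs are `T 1 < T 2 < ...`
(and `T 0 = 0` is not a claim epoch). -/
def claimCount (T : ℕ → Ω → ℝ) (t : ℝ≥0) (ω : Ω) : ℕ :=
  Set.ncard {i : ℕ | T (i + 1) ω ≤ t}

/-- The aggregate claims up to time `t`. The claim paid at the epoch `T (i + 1)` is `Y i`. -/
def aggregateClaims (T Y : ℕ → Ω → ℝ) (t : ℝ≥0) (ω : Ω) : ℝ :=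
  ∑ i ∈ Finset.range (claimCount T t ω), Y i ω

/-- `T` and `Y` are the epochs and the sizes of the claims of a compound Poisson process with
intensity `lam` and claim size law `Q` on the filtered probability space `(Ω, 𝓕, P)`: the
interarrival times are exponential with mean `1 / lam`, the claims are nonnegative with law `Q`,
all these variables are independent, the counting process and the aggregate claims are adapted
to `𝓕`, and their increments after a time `s` are independent of `𝓕 s`. -/
structure IsCompoundPoisson (P : Measure Ω) (𝓕 : Filtration ℝ≥0 (inferInstance : MeasurableSpace Ω))
    (lam : ℝ) (Q : Measure ℝ) (T Y : ℕ → Ω → ℝ) : Prop where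
  epoch_zero : ∀ ω, T 0 ω = 0
  epoch_strictMono : ∀ ω, StrictMono fun i => T i ω
  epoch_tendsto : ∀ ω, Tendsto (fun i => T i ω) atTop atTop
  measurable_epoch : ∀ i, Measurable (T i)
  measurable_claim : ∀ i, Measurable (Y i)
  claim_nonneg : ∀ i ω, 0 ≤ Y i ω
  law_interarrival : ∀ i, P.map (fun ω => T (i + 1) ω - T i ω) = expMeasure lam
  law_claim : ∀ i, P.map (Y i) = Q
  independent : iIndepFun (Sum.elim (fun (i : ℕ) ω => T (i + 1) ω - T i ω) Y) P
  adapted_count : Adapted 𝓕 (claimCount T)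
  adapted_claims : Adapted 𝓕 (aggregateClaims T Y)
  indep_increments : ∀ s t : ℝ≥0, s ≤ t →
    Indep (𝓕 s)
      (MeasurableSpace.comap
        (fun ω => ((claimCount T t ω : ℝ) - claimCount T s ω,
          aggregateClaims T Y t ω - aggregateClaims T Y s ω)) inferInstance) P

/-- A restricted dividend rate: a progressively measurable process with values in `[0, u₀]`.
The aggregate dividends are `D(t) = ∫₀ᵗ u(s) ds`. -/
structure IsDividendRate (𝓕 : Filtration ℝ≥0 (inferInstance : MeasurableSpace Ω)) (u₀ : ℝ)
    (u : ℝ≥0 → Ω → ℝ) : Prop where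
  progressive : IsProgressive 𝓕 u
  mem_Icc : ∀ t ω, u t ω ∈ Icc 0 u₀

/-- The ruin time `inf {t ≥ 0 | X(t) < 0}`, which is `∞` if the surplus never becomes negative. -/
def ruinTime (X : ℝ≥0 → Ω → ℝ) (ω : Ω) : ℝ≥0∞ :=
  sInf ((fun t : ℝ≥0 => (t : ℝ≥0∞)) '' {t | X t ω < 0})

/-- `X` is the surplus with initial value `x` under the dividend rate `u`, up to and including
the time of ruin:
`X(t) = x + ∫₀ᵗ g(X(s)) ds - ∑_{i ≤ N(t)} Y_i - ∫₀ᵗ u(s) ds`.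
At a finite ruin time this surplus is negative, so that ruin is caused by the equation. What
happens after ruin is irrelevant, and `g` need not make sense on the negative half-line. -/
structure IsSurplus (P : Measure Ω) (𝓕 : Filtration ℝ≥0 (inferInstance : MeasurableSpace Ω))
    (g : ℝ → ℝ) (T Y : ℕ → Ω → ℝ) (x : ℝ) (u X : ℝ≥0 → Ω → ℝ) : Prop where
  adapted : Adapted 𝓕 X
  equation : ∀ᵐ ω ∂P, ∀ t : ℝ≥0, (t : ℝ≥0∞) ≤ ruinTime X ω →
    IntervalIntegrable (fun s : ℝ => g (X s.toNNReal ω)) volume 0 t ∧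
    X t ω = x + (∫ s in (0 : ℝ)..t, g (X s.toNNReal ω)) - aggregateClaims T Y t ω
      - ∫ s in (0 : ℝ)..t, u s.toNNReal ω
  neg_at_ruin : ∀ᵐ ω ∂P, ∀ t : ℝ≥0, ruinTime X ω = t → X t ω < 0

/-- `u` is an admissible restricted dividend rate and `X` is its surplus, started at `x`. -/
def IsAdmissible (P : Measure Ω) (𝓕 : Filtration ℝ≥0 (inferInstance : MeasurableSpace Ω))
    (g : ℝ → ℝ) (T Y : ℕ → Ω → ℝ) (u₀ x : ℝ) (u X : ℝ≥0 → Ω → ℝ) : Prop :=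
  IsDividendRate 𝓕 u₀ u ∧ IsSurplus P 𝓕 g T Y x u X

/-- The expected present value `E ∫₀^τ e^{-δ t} u(t) dt` of the dividends paid up to ruin. -/
def expectedPresentValue (P : Measure Ω) (δ : ℝ) (u X : ℝ≥0 → Ω → ℝ) : ℝ :=
  ∫ ω, (∫ t in {t : ℝ | 0 ≤ t ∧ ENNReal.ofReal t < ruinTime X ω},
    Real.exp (-δ * t) * u t.toNNReal ω) ∂P

/-- The value function `V_R(x)` of the restricted problem: the supremum of the expected present
values over all admissible restricted dividend rates. -/
def restrictedValue (P : Measure Ω) (𝓕 : Filtration ℝ≥0 (inferInstance : MeasurableSpace Ω))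
    (g : ℝ → ℝ) (T Y : ℕ → Ω → ℝ) (δ u₀ x : ℝ) : ℝ :=
  sSup {j | ∃ u X : ℝ≥0 → Ω → ℝ, IsAdmissible P 𝓕 g T Y u₀ x u X ∧
    j = expectedPresentValue P δ u X}

/-- The right derivative of a function, which is its derivative wherever that exists. -/
def rightDeriv (V : ℝ → ℝ) (x : ℝ) : ℝ :=
  derivWithin V (Ici x) x

/-- Up to ruin, `u` is given by the feedback rule: pay nothing while `V'(X(t)) > 1`, and pay at
the maximal rate `u₀` while `V'(X(t)) ≤ 1`. -/
def FollowsFeedback (P : Measure Ω) (u₀ : ℝ) (V : ℝ → ℝ) (u X : ℝ≥0 → Ω → ℝ) : Prop :=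
  ∀ᵐ ω ∂P, ∀ t : ℝ≥0, (t : ℝ≥0∞) < ruinTime X ω →
    (1 < rightDeriv V (X t ω) → u t ω = 0) ∧ (rightDeriv V (X t ω) ≤ 1 → u t ω = u₀)

end RiskModel

end

noncomputable section

namespace RiskModel

open scoped Topology

/-! ### The Hamilton-Jacobi-Bellman equation -/

/-! The Hamilton-Jacobi-Bellman equation asks that the maximum of (g - p)W' + p over 0 ≤ p ≤ u₀
equal R = (λ + δ)W - λ∫W(· - y)dQ, with W = 0 on the negative half-line. The expression is affine in
p and g > u₀, so this amounts to W' = min(R/g, (R - u₀)/(g - u₀)), where p = 0 attains the maximum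
if W' > 1 and p = u₀ if W' ≤ 1. The proof constructs a bounded solution W with right derivative w,
and shows that W dominates every policy and is attained by every policy which follows the feedback
rule. Hence the value function is W on [0, ∞), and its regularity is read off from W.

Existence (`exists_isHJBSolution`): after splitting off (λ + δ)W/(g - u₀), the remaining source is
increasing in W. With an integrating factor, and integration from infinity, the equation becomes W =
A(W) with a monotone operator A that preserves the bound u₀/δ. Iterating from 0 and monotone
convergence give a fixed point; no contraction is needed. The only possible discontinuity of W is at
0, so the claim average is right-continuous, and continuous at z when Q{z} = 0; this is where the
differentiability statements come from.

Verification (`IsAdmissible.expectedPresentValue_le`): between claims e^(-δt)W(X(t)) is absolutely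
continuous, and the equation bounds its increment, with equality under the feedback rule
(`IsHJBSolution.interval`). Summing over all claims leaves sums of W(X(T-)) and W(X(T-) - Y) over
the epochs. The compensation formula `IsCompoundPoisson.tsum_lintegral_claims` turns their
expectations into time integrals of λW and λ∫W(· - y)dQ, which cancel and leave the present value
against W(x). All terms are nonnegative, so the argument runs in `ℝ≥0∞` without martingales;
finiteness enters only in the final cancellation.

Existence of the policy (`IsCompoundPoisson.exists_stationary`): the feedback velocity is
discontinuous but positive, so the autonomous equation is solved by inverting the travel time
∫dy/velocity, and the flow is interrupted by downward jumps at the claims. -/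

/-- The average of `W` after a claim at the surplus level `z`. -/
def claimMean (Q : Measure ℝ) (W : ℝ → ℝ) (z : ℝ) : ℝ := ∫ y, W (z - y) ∂Q

/-- `W` is a bounded solution of the Hamilton-Jacobi-Bellman equation of the restricted dividend
problem, extended by zero to the negative half-line, and `w` is its right derivative. -/
structure IsHJBSolution (g : ℝ → ℝ) (lam δ u₀ : ℝ) (Q : Measure ℝ) (W w : ℝ → ℝ) : Prop where
  measurable : Measurable W
  eq_zero_of_neg : ∀ z < 0, W z = 0
  nonneg : ∀ z, 0 ≤ W z
  le_bound : ∀ z, W z ≤ u₀ / δ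
  lipschitz : ∀ R, 0 ≤ R → ∃ L : ℝ≥0, LipschitzOnWith L W (Icc 0 R)
  hasDerivWithinAt : ∀ z, 0 ≤ z → HasDerivWithinAt W (w z) (Ici z) z
  hasDerivAt : ∀ z, 0 < z → Q {z} = 0 → HasDerivAt W (w z) z
  equation : ∀ z, 0 ≤ z → w z = min (((lam + δ) * W z - lam * claimMean Q W z) / g z)
    (((lam + δ) * W z - lam * claimMean Q W z - u₀) / (g z - u₀))

/-! ### Monotone iteration for the integrated Hamilton-Jacobi-Bellman equation -/

section FixedPoint

variable (g : ℝ → ℝ) (lam δ u₀ : ℝ) (Q : Measure ℝ)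

/-- The exponent of the integrating factor of the equation under maximal dividends. -/
def hjbExponent (z : ℝ) : ℝ := ∫ t in (0 : ℝ)..z, (lam + δ) / (g t - u₀)

/-- The inhomogeneity of the Hamilton-Jacobi-Bellman equation, solved for the derivative. -/
def hjbSource (f : ℝ → ℝ≥0∞) (y : ℝ) : ℝ≥0∞ :=
  max (ENNReal.ofReal ((lam + δ) * (1 / (g y - u₀) - 1 / g y)) * f y
      + ENNReal.ofReal (lam / g y) * ∫⁻ q, f (y - q) ∂Q)
    (ENNReal.ofReal (1 / (g y - u₀)) * (ENNReal.ofReal lam * ∫⁻ q, f (y - q) ∂Q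
      + ENNReal.ofReal u₀))

/-- The integral operator whose fixed points solve the Hamilton-Jacobi-Bellman equation. -/
def hjbOperator (f : ℝ → ℝ≥0∞) (z : ℝ) : ℝ≥0∞ :=
  if z < 0 then 0 else ENNReal.ofReal (Real.exp (hjbExponent g lam δ u₀ z)) *
    ∫⁻ y in Ioi z, ENNReal.ofReal (Real.exp (-hjbExponent g lam δ u₀ y)) *
      hjbSource g lam δ u₀ Q f y

/-- The iterates of the integral operator, started at zero. -/
def hjbIterate (n : ℕ) : ℝ → ℝ≥0∞ := (hjbOperator g lam δ u₀ Q)^[n] 0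

/-- The smallest nonnegative fixed point of the integral operator. -/
def hjbLimit (z : ℝ) : ℝ≥0∞ := ⨆ n, hjbIterate g lam δ u₀ Q n z

variable {g lam δ u₀ Q}

lemma hjbSource_mono {f f' : ℝ → ℝ≥0∞} (h : f ≤ f') :
    hjbSource g lam δ u₀ Q f ≤ hjbSource g lam δ u₀ Q f' := by
  intro y
  have h1 : ∫⁻ q, f (y - q) ∂Q ≤ ∫⁻ q, f' (y - q) ∂Q := lintegral_mono fun q => h _
  unfold hjbSource
  gcongr
  exact h y

lemma hjbOperator_mono {f f' : ℝ → ℝ≥0∞} (h : f ≤ f') :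
    hjbOperator g lam δ u₀ Q f ≤ hjbOperator g lam δ u₀ Q f' := by
  intro z
  unfold hjbOperator
  split_ifs
  · exact le_rfl
  · gcongr with y
    exact hjbSource_mono h y

lemma hjbIterate_mono : Monotone (hjbIterate g lam δ u₀ Q) := by
  refine monotone_nat_of_le_succ fun n => ?_
  induction n with
  | zero => intro z; simp [hjbIterate]
  | succ n ih =>
    simp only [hjbIterate, Function.iterate_succ_apply'] at ih ⊢
    exact hjbOperator_mono ih

lemma measurable_claimMean_lintegral [IsProbabilityMeasure Q] {f : ℝ → ℝ≥0∞} (hf : Measurable f) :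
    Measurable fun y => ∫⁻ q, f (y - q) ∂Q :=
  Measurable.lintegral_prod_right' (f := fun p : ℝ × ℝ => f (p.1 - p.2))
    (hf.comp (measurable_fst.sub measurable_snd))

lemma measurable_hjbSource [IsProbabilityMeasure Q] (hg : Continuous g) {f : ℝ → ℝ≥0∞}
    (hf : Measurable f) : Measurable (hjbSource g lam δ u₀ Q f) := by
  have := measurable_claimMean_lintegral (Q := Q) hf
  have := hg.measurable
  unfold hjbSource
  fun_prop

lemma hjbDensity_continuous (hg : Continuous g) (hgu : ∀ x, u₀ < g x) :
    Continuous fun t => (lam + δ) / (g t - u₀) :=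
  continuous_const.div (hg.sub continuous_const) fun x => (sub_pos.2 (hgu x)).ne'

lemma hjbExponent_hasDerivAt (hg : Continuous g) (hgu : ∀ x, u₀ < g x) (z : ℝ) :
    HasDerivAt (hjbExponent g lam δ u₀) ((lam + δ) / (g z - u₀)) z :=
  (hjbDensity_continuous hg hgu).integral_hasStrictDerivAt 0 z |>.hasDerivAt

lemma hjbExponent_continuous (hg : Continuous g) (hgu : ∀ x, u₀ < g x) :
    Continuous (hjbExponent g lam δ u₀) :=
  continuous_iff_continuousAt.2 fun z => (hjbExponent_hasDerivAt hg hgu z).continuousAt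

/-- The tail integral is antitone in its lower end, so no measurability of `f` is needed. -/
lemma measurable_hjbOperator (hg : Continuous g) (hgu : ∀ x, u₀ < g x)
    (f : ℝ → ℝ≥0∞) :
    Measurable (hjbOperator g lam δ u₀ Q f) := by
  refine Measurable.ite measurableSet_Iio measurable_const ?_
  refine Measurable.mul ?_ (Antitone.measurable ?_)
  · have := (hjbExponent_continuous (lam := lam) (δ := δ) hg hgu).measurable
    fun_prop
  · intro a b hab
    exact lintegral_mono_set (Ioi_subset_Ioi hab)

lemma measurable_hjbIterate (hg : Continuous g) (hgu : ∀ x, u₀ < g x) (n : ℕ) :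
    Measurable (hjbIterate g lam δ u₀ Q n) := by
  cases n with
  | zero => exact measurable_const
  | succ n =>
    simp only [hjbIterate, Function.iterate_succ_apply']
    exact measurable_hjbOperator hg hgu _

lemma measurable_hjbLimit (hg : Continuous g) (hgu : ∀ x, u₀ < g x) :
    Measurable (hjbLimit g lam δ u₀ Q) :=
  Measurable.iSup fun n => measurable_hjbIterate hg hgu n

/-- The integrand is the derivative of -exp(-G), so the integral is exp(-G(z)) minus the limit of
exp(-G) at infinity. That limit may be positive for a merely continuous `g`, hence an inequality. -/
lemma lintegral_hjbExponent_le (hg : Continuous g) (hgu : ∀ x, u₀ < g x) (hc : 0 < lam + δ)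
    (z : ℝ) :
    ENNReal.ofReal (Real.exp (hjbExponent g lam δ u₀ z)) *
      ∫⁻ y in Ioi z, ENNReal.ofReal (Real.exp (-hjbExponent g lam δ u₀ y)) *
        ENNReal.ofReal ((lam + δ) / (g y - u₀)) ≤ 1 := by
  set G := hjbExponent g lam δ u₀ with hG
  have hd : ∀ y, HasDerivAt (fun y => -Real.exp (-G y))
      (Real.exp (-G y) * ((lam + δ) / (g y - u₀))) y := fun y => by
    exact ((hjbExponent_hasDerivAt (lam := lam) (δ := δ) hg hgu y).fun_neg.exp).fun_neg.congr_deriv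
      (by ring)
  have hpos : ∀ y, 0 ≤ Real.exp (-G y) * ((lam + δ) / (g y - u₀)) := fun y =>
    mul_nonneg (Real.exp_pos _).le (div_nonneg hc.le (sub_pos.2 (hgu y)).le)
  have hmono : Monotone fun y => -Real.exp (-G y) :=
    monotone_of_deriv_nonneg (fun y => (hd y).differentiableAt) fun y => by
      rw [(hd y).deriv]; exact hpos y
  have hlim := tendsto_atTop_ciSup hmono ⟨0, by
    rintro _ ⟨y, rfl⟩; exact neg_nonpos.2 (Real.exp_pos _).le⟩
  set l := ⨆ y, -Real.exp (-G y)
  have hl : l ≤ 0 := ciSup_le fun y => neg_nonpos.2 (Real.exp_pos _).le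
  have hint := integrableOn_Ioi_deriv_of_nonneg' (a := z) (fun y _ => hd y)
    (fun y _ => hpos y) hlim
  have hval := integral_Ioi_of_hasDerivAt_of_tendsto' (a := z) (fun y _ => hd y) hint hlim
  simp_rw [← ENNReal.ofReal_mul (Real.exp_pos _).le]
  rw [← ofReal_integral_eq_lintegral_ofReal hint (Eventually.of_forall hpos), hval,
    ← ENNReal.ofReal_mul (Real.exp_pos _).le, ← ENNReal.ofReal_one]
  refine ENNReal.ofReal_le_ofReal ?_
  have : Real.exp (G z) * Real.exp (-G z) = 1 := by rw [← Real.exp_add]; simp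
  nlinarith [Real.exp_pos (G z), mul_nonneg (Real.exp_pos (G z)).le (neg_nonneg.2 hl)]

/-- The constant B = u₀/δ is the value of paying u₀ forever. Since u₀ = δB, inserting B makes the
second branch exactly (λ + δ)B/(g - u₀), while the first falls short of this by δB/g. -/
lemma hjbSource_le [IsProbabilityMeasure Q] (hgu : ∀ x, u₀ < g x) (hlam : 0 < lam)
    (hδ : 0 < δ) (hu₀ : 0 < u₀) {f : ℝ → ℝ≥0∞} (hf : ∀ z, f z ≤ ENNReal.ofReal (u₀ / δ)) (y : ℝ) :
    hjbSource g lam δ u₀ Q f y ≤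
      ENNReal.ofReal ((lam + δ) / (g y - u₀)) * ENNReal.ofReal (u₀ / δ) := by
  have hg0 : 0 < g y - u₀ := sub_pos.2 (hgu y)
  have hgp : 0 < g y := hu₀.trans (hgu y)
  have hB : 0 ≤ u₀ / δ := by positivity
  have h1 : ∫⁻ q, f (y - q) ∂Q ≤ ENNReal.ofReal (u₀ / δ) :=
    (lintegral_mono fun q => hf _).trans (by simp)
  have hm : 0 ≤ 1 / (g y - u₀) - 1 / g y :=
    sub_nonneg.2 (one_div_le_one_div_of_le hg0 (by linarith))
  refine (max_le_max (add_le_add (mul_le_mul_right (hf y) _) (mul_le_mul_right h1 _))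
    (mul_le_mul_right (add_le_add (mul_le_mul_right h1 _) le_rfl) _)).trans ?_
  refine max_le ?_ ?_
  · rw [← ENNReal.ofReal_mul (by positivity), ← ENNReal.ofReal_mul (by positivity),
      ← ENNReal.ofReal_mul (by positivity), ← ENNReal.ofReal_add (by positivity) (by positivity)]
    refine ENNReal.ofReal_le_ofReal ?_
    rw [← add_mul]
    refine mul_le_mul_of_nonneg_right ?_ hB
    have : (lam + δ) / (g y - u₀) - ((lam + δ) * (1 / (g y - u₀) - 1 / g y) + lam / g y)
        = δ / g y := by field_simp; ring
    have : 0 ≤ δ / g y := by positivity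
    linarith
  · rw [← ENNReal.ofReal_mul (by positivity), ← ENNReal.ofReal_mul (by positivity),
      ← ENNReal.ofReal_add (by positivity) (by positivity), ← ENNReal.ofReal_mul (by positivity)]
    refine ENNReal.ofReal_le_ofReal (le_of_eq ?_)
    field_simp

lemma hjbOperator_le [IsProbabilityMeasure Q] (hg : Continuous g) (hgu : ∀ x, u₀ < g x)
    (hlam : 0 < lam) (hδ : 0 < δ) (hu₀ : 0 < u₀) {f : ℝ → ℝ≥0∞}
    (hf : ∀ z, f z ≤ ENNReal.ofReal (u₀ / δ)) (z : ℝ) :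
    hjbOperator g lam δ u₀ Q f z ≤ ENNReal.ofReal (u₀ / δ) := by
  unfold hjbOperator
  split_ifs
  · exact zero_le
  calc _ ≤ ENNReal.ofReal (Real.exp (hjbExponent g lam δ u₀ z)) *
        ∫⁻ y in Ioi z, (ENNReal.ofReal (Real.exp (-hjbExponent g lam δ u₀ y)) *
          ENNReal.ofReal ((lam + δ) / (g y - u₀))) * ENNReal.ofReal (u₀ / δ) := by
        refine mul_le_mul_right (lintegral_mono fun y => ?_) _
        rw [mul_assoc]
        exact mul_le_mul_right (hjbSource_le hgu hlam hδ hu₀ hf y) _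
    _ ≤ 1 * ENNReal.ofReal (u₀ / δ) := by
        rw [lintegral_mul_const' _ _ ENNReal.ofReal_ne_top, ← mul_assoc]
        gcongr
        exact lintegral_hjbExponent_le hg hgu (by positivity) z
    _ = _ := one_mul _

lemma hjbIterate_le [IsProbabilityMeasure Q] (hg : Continuous g) (hgu : ∀ x, u₀ < g x)
    (hlam : 0 < lam) (hδ : 0 < δ) (hu₀ : 0 < u₀) (n : ℕ) :
    ∀ z, hjbIterate g lam δ u₀ Q n z ≤ ENNReal.ofReal (u₀ / δ) := by
  induction n with
  | zero => simp [hjbIterate]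
  | succ n ih =>
    simp only [hjbIterate, Function.iterate_succ_apply'] at ih ⊢
    exact hjbOperator_le hg hgu hlam hδ hu₀ ih

lemma hjbLimit_le [IsProbabilityMeasure Q] (hg : Continuous g) (hgu : ∀ x, u₀ < g x)
    (hlam : 0 < lam) (hδ : 0 < δ) (hu₀ : 0 < u₀) (z : ℝ) :
    hjbLimit g lam δ u₀ Q z ≤ ENNReal.ofReal (u₀ / δ) :=
  iSup_le fun n => hjbIterate_le hg hgu hlam hδ hu₀ n z

lemma tendsto_hjbIterate (z : ℝ) :
    Tendsto (fun n => hjbIterate g lam δ u₀ Q n z) atTop (𝓝 (hjbLimit g lam δ u₀ Q z)) :=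
  tendsto_atTop_iSup fun _ _ h => hjbIterate_mono h z

lemma tendsto_hjbSource (hg : Continuous g) (hgu : ∀ x, u₀ < g x) (y : ℝ) :
    Tendsto (fun n => hjbSource g lam δ u₀ Q (hjbIterate g lam δ u₀ Q n) y) atTop
      (𝓝 (hjbSource g lam δ u₀ Q (hjbLimit g lam δ u₀ Q) y)) := by
  have h1 : Tendsto (fun n => ∫⁻ q, hjbIterate g lam δ u₀ Q n (y - q) ∂Q) atTop
      (𝓝 (∫⁻ q, hjbLimit g lam δ u₀ Q (y - q) ∂Q)) := by
    refine lintegral_tendsto_of_tendsto_of_monotone (fun n => ?_) ?_ ?_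
    · exact ((measurable_hjbIterate hg hgu n).comp (measurable_const.sub measurable_id)).aemeasurable
    · exact Eventually.of_forall fun q m n h => hjbIterate_mono h _
    · exact Eventually.of_forall fun q => tendsto_hjbIterate _
  refine Tendsto.max (Tendsto.add ?_ ?_) ?_
  · exact ENNReal.Tendsto.const_mul (tendsto_hjbIterate y) (Or.inr ENNReal.ofReal_ne_top)
  · exact ENNReal.Tendsto.const_mul h1 (Or.inr ENNReal.ofReal_ne_top)
  · exact ENNReal.Tendsto.const_mul ((ENNReal.Tendsto.const_mul h1
      (Or.inr ENNReal.ofReal_ne_top)).add tendsto_const_nhds) (Or.inr ENNReal.ofReal_ne_top)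

/-- By monotone convergence the operator commutes with the increasing limit, and the shifted
iterates have the same limit. -/
lemma hjbOperator_hjbLimit [IsProbabilityMeasure Q] (hg : Continuous g) (hgu : ∀ x, u₀ < g x) :
    hjbOperator g lam δ u₀ Q (hjbLimit g lam δ u₀ Q) = hjbLimit g lam δ u₀ Q := by
  funext z
  refine tendsto_nhds_unique ?_ ((tendsto_hjbIterate z).comp (tendsto_add_atTop_nat 1))
  have : ((fun n => hjbIterate g lam δ u₀ Q n z) ∘ fun a => a + 1) =
      fun n => hjbOperator g lam δ u₀ Q (hjbIterate g lam δ u₀ Q n) z := by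
    funext n; simp [hjbIterate, Function.iterate_succ_apply']
  rw [this]
  unfold hjbOperator
  split_ifs
  · exact tendsto_const_nhds
  refine ENNReal.Tendsto.const_mul ?_ (Or.inr ENNReal.ofReal_ne_top)
  have hG := (hjbExponent_continuous (lam := lam) (δ := δ) hg hgu).measurable
  refine lintegral_tendsto_of_tendsto_of_monotone (fun n => ?_) ?_ ?_
  · have := measurable_hjbSource (lam := lam) (δ := δ) (u₀ := u₀) (Q := Q) hg
      (measurable_hjbIterate (lam := lam) (δ := δ) (Q := Q) hg hgu n)
    fun_prop
  · exact Eventually.of_forall fun y m n h =>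
      mul_le_mul_right (hjbSource_mono (hjbIterate_mono h) y) _
  · exact Eventually.of_forall fun y => ENNReal.Tendsto.const_mul
      (tendsto_hjbSource hg hgu y) (Or.inr ENNReal.ofReal_ne_top)

end FixedPoint

/-! ### Regularity of the fixed point and the differential form of the equation -/

section Solution

variable {g : ℝ → ℝ} {lam δ u₀ : ℝ} {Q : Measure ℝ}

variable (g lam δ u₀ Q) in
/-- The right-hand side of the Hamilton-Jacobi-Bellman equation solved for the derivative. -/
def hjbSlope (W : ℝ → ℝ) (z : ℝ) : ℝ :=
  min (((lam + δ) * W z - lam * claimMean Q W z) / g z)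
    (((lam + δ) * W z - lam * claimMean Q W z - u₀) / (g z - u₀))

/-- Subtracting the same linear term from both branches turns the minimum into a maximum whose
coefficients of `W` and of its claim average are nonnegative for positive λ and δ. This is the form
behind the monotone operator. -/
lemma hjbSlope_eq (hgu : ∀ x, u₀ < g x) (hu₀ : 0 < u₀) (W : ℝ → ℝ) (z : ℝ) :
    hjbSlope g lam δ u₀ Q W z = (lam + δ) / (g z - u₀) * W z -
      max ((lam + δ) * (1 / (g z - u₀) - 1 / g z) * W z + lam / g z * claimMean Q W z)
        (1 / (g z - u₀) * (lam * claimMean Q W z + u₀)) := by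
  have hg0 : g z - u₀ ≠ 0 := (sub_pos.2 (hgu z)).ne'
  have hgp : g z ≠ 0 := (hu₀.trans (hgu z)).ne'
  rw [← min_sub_sub_left, hjbSlope]
  congr 1 <;> field_simp <;> ring

lemma integrable_claim_shift [IsProbabilityMeasure Q] {W : ℝ → ℝ} {B : ℝ} (hW : Measurable W)
    (h0 : ∀ z, 0 ≤ W z) (hB : ∀ z, W z ≤ B) (z : ℝ) : Integrable (fun y => W (z - y)) Q :=
  Integrable.of_bound (hW.comp (measurable_const.sub measurable_id)).aestronglyMeasurable B
    (Eventually.of_forall fun y => by rw [Real.norm_of_nonneg (h0 _)]; exact hB _)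

lemma claimMean_nonneg {W : ℝ → ℝ} (h0 : ∀ z, 0 ≤ W z) (z : ℝ) : 0 ≤ claimMean Q W z :=
  integral_nonneg fun _ => h0 _

lemma claimMean_le [IsProbabilityMeasure Q] {W : ℝ → ℝ} {B : ℝ} (hW : Measurable W)
    (h0 : ∀ z, 0 ≤ W z) (hB : ∀ z, W z ≤ B) (z : ℝ) : claimMean Q W z ≤ B := by
  simpa [claimMean] using integral_mono (integrable_claim_shift (Q := Q) hW h0 hB z) (integrable_const B)
    fun y => hB _

lemma measurable_claimMean [IsProbabilityMeasure Q] {W : ℝ → ℝ} (hW : Measurable W) :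
    Measurable (claimMean Q W) :=
  (StronglyMeasurable.integral_prod_right' (f := fun p : ℝ × ℝ => W (p.1 - p.2))
    (hW.comp (measurable_fst.sub measurable_snd)).stronglyMeasurable).measurable

/-- `W` can jump only at 0 and is right-continuous there; translation by a claim preserves approach
from the right, and dominated convergence applies. -/
lemma claimMean_continuousWithinAt [IsProbabilityMeasure Q] {W : ℝ → ℝ} {B : ℝ}
    (hW : Measurable W) (h0 : ∀ z, 0 ≤ W z) (hB : ∀ z, W z ≤ B) (hneg : ∀ z < 0, W z = 0)
    (hc : ContinuousOn W (Ici 0)) (z : ℝ) : ContinuousWithinAt (claimMean Q W) (Ici z) z := by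
  refine continuousWithinAt_of_dominated (bound := fun _ => B) ?_ ?_ (integrable_const B) ?_
  · exact Eventually.of_forall fun x => (integrable_claim_shift hW h0 hB x).aestronglyMeasurable
  · refine Eventually.of_forall fun x => Eventually.of_forall fun y => ?_
    rw [Real.norm_of_nonneg (h0 _)]; exact hB _
  · refine Eventually.of_forall fun y => ?_
    have hcw : ContinuousWithinAt W (Ici (z - y)) (z - y) := by
      rcases lt_or_ge (z - y) 0 with h | h
      · have : W =ᶠ[𝓝 (z - y)] fun _ => 0 := by
          filter_upwards [Iio_mem_nhds h] with x hx using hneg x hx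
        exact (continuousAt_const.congr this.symm).continuousWithinAt
      · exact (hc _ h).mono (Ici_subset_Ici.2 h)
    refine ContinuousWithinAt.comp (t := Ici (z - y)) hcw
      (continuous_id.sub continuous_const).continuousWithinAt fun x hx => ?_
    simpa using hx

/-- Only a claim of size exactly `z` puts the argument at the jump of `W`, and such claims are
`Q`-null. -/
lemma claimMean_continuousAt [IsProbabilityMeasure Q] {W : ℝ → ℝ} {B : ℝ}
    (hW : Measurable W) (h0 : ∀ z, 0 ≤ W z) (hB : ∀ z, W z ≤ B) (hneg : ∀ z < 0, W z = 0)
    (hc : ContinuousOn W (Ici 0)) {z : ℝ} (hQ : Q {z} = 0) : ContinuousAt (claimMean Q W) z := by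
  refine continuousAt_of_dominated (bound := fun _ => B) ?_ ?_ (integrable_const B) ?_
  · exact Eventually.of_forall fun x => (integrable_claim_shift hW h0 hB x).aestronglyMeasurable
  · refine Eventually.of_forall fun x => Eventually.of_forall fun y => ?_
    rw [Real.norm_of_nonneg (h0 _)]; exact hB _
  · have : ∀ᵐ y ∂Q, y ≠ z := by
      rw [ae_iff]; simpa using hQ
    filter_upwards [this] with y hy
    refine ContinuousAt.comp (g := W) (f := fun x => x - y) ?_ (by fun_prop)
    rcases lt_or_gt_of_ne (sub_ne_zero.2 hy.symm) with h | h
    · have : W =ᶠ[𝓝 (z - y)] fun _ => 0 := by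
        filter_upwards [Iio_mem_nhds h] with x hx using hneg x hx
      exact continuousAt_const.congr this.symm
    · exact hc.continuousAt (Ici_mem_nhds h)

/-- The Hamilton-Jacobi-Bellman equation of the restricted problem has a bounded solution. -/
theorem exists_isHJBSolution [IsProbabilityMeasure Q] (hg : Continuous g) (hgu : ∀ x, u₀ < g x)
    (hlam : 0 < lam) (hδ : 0 < δ) (hu₀ : 0 < u₀) :
    ∃ W w : ℝ → ℝ, IsHJBSolution g lam δ u₀ Q W w := by
  set F := hjbLimit g lam δ u₀ Q with hF
  set G := hjbExponent g lam δ u₀ with hG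
  set B := u₀ / δ with hB
  have hB0 : 0 ≤ B := by positivity
  have hFle : ∀ z, F z ≤ ENNReal.ofReal B := hjbLimit_le hg hgu hlam hδ hu₀
  have hFtop : ∀ z, F z ≠ ⊤ := fun z => ((hFle z).trans_lt ENNReal.ofReal_lt_top).ne
  set W : ℝ → ℝ := fun z => (F z).toReal with hWdef
  have hofW : ∀ z, ENNReal.ofReal (W z) = F z := fun z => ENNReal.ofReal_toReal (hFtop z)
  have hWm : Measurable W := (measurable_hjbLimit hg hgu).ennreal_toReal
  have hW0 : ∀ z, 0 ≤ W z := fun z => ENNReal.toReal_nonneg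
  have hWB : ∀ z, W z ≤ B := fun z => ENNReal.toReal_le_of_le_ofReal hB0 (hFle z)
  have hfix : hjbOperator g lam δ u₀ Q F = F := hjbOperator_hjbLimit hg hgu
  have hneg : ∀ z < 0, W z = 0 := fun z hz => by
    simp only [hWdef]; rw [← hfix]; simp [hjbOperator, hz]
  set M := claimMean Q W with hM
  have hM0 : ∀ z, 0 ≤ M z := claimMean_nonneg hW0
  have hMB : ∀ z, M z ≤ B := claimMean_le hWm hW0 hWB
  have hMm : Measurable M := measurable_claimMean hWm
  have hofM : ∀ z, ∫⁻ q, F (z - q) ∂Q = ENNReal.ofReal (M z) := fun z => by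
    rw [hM, claimMean, ofReal_integral_eq_lintegral_ofReal (integrable_claim_shift hWm hW0 hWB z)
      (Eventually.of_forall fun y => hW0 _)]
    simp_rw [hofW]
  set S : ℝ → ℝ := fun y => max ((lam + δ) * (1 / (g y - u₀) - 1 / g y) * W y + lam / g y * M y)
    (1 / (g y - u₀) * (lam * M y + u₀)) with hS
  have hg0 : ∀ z, 0 < g z - u₀ := fun z => sub_pos.2 (hgu z)
  have hgp : ∀ z, 0 < g z := fun z => hu₀.trans (hgu z)
  have hS0 : ∀ y, 0 ≤ S y := fun y => le_max_of_le_right (by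
    have := hM0 y; have := hg0 y; positivity)
  have hofS : ∀ y, hjbSource g lam δ u₀ Q F y = ENNReal.ofReal (S y) := fun y => by
    have := hM0 y
    have := hW0 y
    have := hg0 y
    have := hgp y
    have hm : 0 ≤ 1 / (g y - u₀) - 1 / g y :=
      sub_nonneg.2 (one_div_le_one_div_of_le (hg0 y) (by linarith))
    rw [hjbSource, hofM, ← hofW, ← ENNReal.ofReal_mul (by positivity),
      ← ENNReal.ofReal_mul (by positivity), ← ENNReal.ofReal_mul (by positivity),
      ← ENNReal.ofReal_add (by positivity) (by positivity),
      ← ENNReal.ofReal_add (by positivity) (by positivity),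
      ← ENNReal.ofReal_mul (by positivity), hS]
    exact (ENNReal.ofReal_max _ _).symm
  have hSle : ∀ y, S y ≤ (lam + δ) / (g y - u₀) * B := fun y => by
    have h1 := hjbSource_le (Q := Q) hgu hlam hδ hu₀ hFle y
    have := hg0 y
    rw [hofS, ← ENNReal.ofReal_mul (by positivity)] at h1
    exact (ENNReal.ofReal_le_ofReal_iff (by positivity)).1 h1
  have hGc : Continuous G := hjbExponent_continuous hg hgu
  set k : ℝ → ℝ := fun y => Real.exp (-G y) * S y with hk
  have hk0 : ∀ y, 0 ≤ k y := fun y => mul_nonneg (Real.exp_pos _).le (hS0 y)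
  have hkm : Measurable k := by
    have := hGc.measurable
    have := hg.measurable
    fun_prop
  have hWint : ∀ z, 0 ≤ z → F z = ENNReal.ofReal (Real.exp (G z)) *
      ∫⁻ y in Ioi z, ENNReal.ofReal (k y) := fun z hz => by
    conv_lhs => rw [← hfix]
    rw [hjbOperator, if_neg (not_lt.2 hz)]
    simp_rw [hofS, hk, ENNReal.ofReal_mul (Real.exp_pos _).le]
    rfl
  -- Integrability is read back from the fixed point equation: an infinite tail integral, multiplied
  -- by a positive exponential, would make `F z` infinite.
  have hkint : ∀ z, 0 ≤ z → IntegrableOn k (Ioi z) := fun z hz => by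
    refine ⟨hkm.aestronglyMeasurable, ?_⟩
    rw [hasFiniteIntegral_iff_ofReal (Eventually.of_forall hk0)]
    by_contra hcon
    have h1 := hWint z hz
    rw [not_lt_top_iff.1 hcon, ENNReal.mul_top] at h1
    · exact hFtop z h1
    · simp [Real.exp_pos]
  -- The primitive is needed on intervals that may reach below 0, where the fixed point equation
  -- gives nothing; the bound on `S` supplies a continuous majorant.
  have hki : ∀ a b, IntervalIntegrable k volume a b := fun a b => by
    have hcont : Continuous fun y => Real.exp (-G y) * ((lam + δ) / (g y - u₀) * B) :=
      (Real.continuous_exp.comp hGc.neg).mul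
        ((hjbDensity_continuous hg hgu).mul continuous_const)
    refine (hcont.intervalIntegrable a b).mono_fun hkm.aestronglyMeasurable
      (Eventually.of_forall fun y => ?_)
    change ‖k y‖ ≤ _
    rw [Real.norm_of_nonneg (hk0 y)]
    exact (mul_le_mul_of_nonneg_left (hSle y) (Real.exp_pos _).le).trans (le_abs_self _)
  set I₀ := ∫ y in Ioi (0 : ℝ), k y
  -- The tail integral is rewritten with a variable upper end, so that the one-sided and two-sided
  -- fundamental theorems apply to it.
  have hWeq : ∀ z, 0 ≤ z → W z = Real.exp (G z) * (I₀ - ∫ y in (0 : ℝ)..z, k y) := fun z hz => by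
    have h1 := intervalIntegral.integral_Ioi_sub_Ioi (hkint 0 le_rfl) hz
    rw [← h1, hWdef]
    simp only
    rw [hWint z hz, ← ofReal_integral_eq_lintegral_ofReal (hkint z hz) (Eventually.of_forall hk0),
      ENNReal.toReal_mul, ENNReal.toReal_ofReal (Real.exp_pos _).le,
      ENNReal.toReal_ofReal (integral_nonneg hk0)]
    ring
  have hWc : ContinuousOn W (Ici 0) := by
    refine ContinuousOn.congr (f := fun z => Real.exp (G z) * (I₀ - ∫ y in (0 : ℝ)..z, k y))
      (Continuous.continuousOn ?_) hWeq
    exact (Real.continuous_exp.comp hGc).mul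
      (continuous_const.sub (intervalIntegral.continuous_primitive hki 0))
  have hslope : ∀ z, hjbSlope g lam δ u₀ Q W z = (lam + δ) / (g z - u₀) * W z - S z :=
    fun z => hjbSlope_eq hgu hu₀ W z
  have hval : ∀ z, 0 ≤ z → Real.exp (G z) * ((lam + δ) / (g z - u₀)) *
      (I₀ - ∫ y in (0 : ℝ)..z, k y) + Real.exp (G z) * (-k z) = hjbSlope g lam δ u₀ Q W z := by
    intro z hz
    have : Real.exp (G z) * Real.exp (-G z) = 1 := by rw [← Real.exp_add]; simp
    rw [hslope, hWeq z hz, hk]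
    linear_combination (-S z) * this
  have hright : ∀ z, 0 ≤ z → HasDerivWithinAt W (hjbSlope g lam δ u₀ Q W z) (Ici z) z := by
    intro z hz
    have hMc := claimMean_continuousWithinAt (Q := Q) hWm hW0 hWB hneg hWc z
    have hWcz : ContinuousWithinAt W (Ici z) z := (hWc z hz).mono (Ici_subset_Ici.2 hz)
    have hkc : ContinuousWithinAt k (Ici z) z := by
      have h1 : ContinuousWithinAt g (Ici z) z := hg.continuousWithinAt
      have h2 : ContinuousWithinAt G (Ici z) z := hGc.continuousWithinAt
      have h3 := (hg0 z).ne'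
      have h4 := (hgp z).ne'
      refine ((h2.neg).rexp).mul (ContinuousWithinAt.sup ?_ ?_)
      · exact ((continuousWithinAt_const.mul ((continuousWithinAt_const.div
          (h1.sub continuousWithinAt_const) h3).sub (continuousWithinAt_const.div h1 h4))).mul
          hWcz).add ((continuousWithinAt_const.div h1 h4).mul hMc)
      · exact (continuousWithinAt_const.div (h1.sub continuousWithinAt_const) h3).mul
          ((continuousWithinAt_const.mul hMc).add continuousWithinAt_const)
    have hd := (intervalIntegral.integral_hasDerivWithinAt_right (hki 0 z) (s := Ici z) (t := Ioi z)
      (hkm.stronglyMeasurable.stronglyMeasurableAtFilter) (hkc.mono Ioi_subset_Ici_self))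
    have hd2 := ((hjbExponent_hasDerivAt (lam := lam) (δ := δ) hg hgu z).exp.hasDerivWithinAt
      (s := Ici z)).mul (hd.const_sub I₀)
    rw [← hval z hz]
    exact hd2.congr (fun x hx => hWeq x (hz.trans hx)) (hWeq z hz)
  have hderiv : ∀ z, 0 < z → Q {z} = 0 → HasDerivAt W (hjbSlope g lam δ u₀ Q W z) z := by
    intro z hz hQ
    have hMc := claimMean_continuousAt (Q := Q) hWm hW0 hWB hneg hWc hQ
    have hWcz : ContinuousAt W z := hWc.continuousAt (Ici_mem_nhds hz)
    have hkc : ContinuousAt k z := by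
      have h1 : ContinuousAt g z := hg.continuousAt
      have h2 : ContinuousAt G z := hGc.continuousAt
      have h3 := (hg0 z).ne'
      have h4 := (hgp z).ne'
      refine ((h2.neg).rexp).mul (ContinuousAt.sup ?_ ?_)
      · exact ((continuousAt_const.mul ((continuousAt_const.div
          (h1.sub continuousAt_const) h3).sub (continuousAt_const.div h1 h4))).mul
          hWcz).add ((continuousAt_const.div h1 h4).mul hMc)
      · exact (continuousAt_const.div (h1.sub continuousAt_const) h3).mul
          ((continuousAt_const.mul hMc).add continuousAt_const)
    have hd := (intervalIntegral.integral_hasDerivAt_right (hki 0 z)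
      (hkm.stronglyMeasurable.stronglyMeasurableAtFilter) hkc)
    have hd2 := (hjbExponent_hasDerivAt (lam := lam) (δ := δ) hg hgu z).exp.mul (hd.const_sub I₀)
    rw [← hval z hz.le]
    refine hd2.congr_of_eventuallyEq ?_
    filter_upwards [Ioi_mem_nhds hz] with x hx using hWeq x (le_of_lt hx)
  refine ⟨W, hjbSlope g lam δ u₀ Q W, hWm, hneg, hW0, hWB, fun R hR => ?_, hright, hderiv,
    fun z _ => rfl⟩
  -- The values 1 and 0 make the density 1/(g - u₀), so `D` bounds this reciprocal on the compact
  -- interval.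
  have hcd := hjbDensity_continuous (lam := 1) (δ := 0) hg hgu
  obtain ⟨D, hD⟩ := (isCompact_Icc (a := (0 : ℝ)) (b := R)).exists_bound_of_continuousOn
    hcd.continuousOn
  -- The slope is a difference of two numbers in [0, (λ + δ)B/(g - u₀)].
  have hbound : ∀ z ∈ Icc 0 R, ‖hjbSlope g lam δ u₀ Q W z‖ ≤ (lam + δ) * D * B := by
    intro z hz
    have hDz := hD z hz
    have h3 := hg0 z
    rw [Real.norm_of_nonneg (by positivity)] at hDz
    have hDz' : (lam + δ) / (g z - u₀) ≤ (lam + δ) * D := by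
      rw [div_eq_mul_one_div]
      exact mul_le_mul_of_nonneg_left (by simpa using hDz) (by positivity)
    have h5 : (lam + δ) / (g z - u₀) * B ≤ (lam + δ) * D * B :=
      mul_le_mul_of_nonneg_right hDz' hB0
    have h6 : (lam + δ) / (g z - u₀) * W z ≤ (lam + δ) / (g z - u₀) * B :=
      mul_le_mul_of_nonneg_left (hWB z) (by positivity)
    have h7 : 0 ≤ (lam + δ) / (g z - u₀) * W z := mul_nonneg (by positivity) (hW0 z)
    rw [hslope, Real.norm_eq_abs, abs_le]
    constructor <;> linarith [hSle z, hS0 z]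
  refine ⟨Real.toNNReal ((lam + δ) * D * B), ?_⟩
  have hnn : 0 ≤ (lam + δ) * D * B := (norm_nonneg _).trans (hbound 0 ⟨le_rfl, hR⟩)
  have key : ∀ a ∈ Icc (0 : ℝ) R, ∀ b ∈ Icc (0 : ℝ) R, a ≤ b →
      ‖W b - W a‖ ≤ (lam + δ) * D * B * (b - a) := by
    intro a ha b hb hab
    refine norm_image_sub_le_of_norm_deriv_right_le_segment (f' := hjbSlope g lam δ u₀ Q W)
      (hWc.mono fun x hx => ha.1.trans hx.1) (fun x hx => hright x (ha.1.trans hx.1))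
      (fun x hx => hbound x ⟨ha.1.trans hx.1, hx.2.le.trans hb.2⟩) b ⟨hab, le_rfl⟩
  refine LipschitzOnWith.of_dist_le_mul fun a ha b hb => ?_
  rw [Real.coe_toNNReal _ hnn, Real.dist_eq, Real.dist_eq]
  rcases le_total a b with h | h
  · rw [abs_sub_comm, abs_sub_comm a, abs_of_nonneg (sub_nonneg.2 h)]
    exact key a ha b hb h
  · rw [abs_of_nonneg (sub_nonneg.2 h)]
    exact key b hb a ha h

end Solution

/-! ### Counting claims -/

section Counting

variable {Ω : Type*} [MeasurableSpace Ω] {P : Measure Ω}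
  {𝓕 : Filtration ℝ≥0 (inferInstance : MeasurableSpace Ω)} {lam : ℝ} {Q : Measure ℝ}
  {T Y : ℕ → Ω → ℝ}

/-- As the epochs increase to infinity, the indices counted form an initial segment of ℕ, whose
length is its cardinality. Claim `i` sits at the epoch `T (i + 1)`, hence the strict inequality on
the right. -/
lemma IsCompoundPoisson.epoch_le_iff (h : IsCompoundPoisson P 𝓕 lam Q T Y) (i : ℕ) (t : ℝ≥0)
    (ω : Ω) : T (i + 1) ω ≤ t ↔ i < claimCount T t ω := by
  classical
  have hex : ∃ n, (t : ℝ) < T (n + 1) ω :=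
    (((h.epoch_tendsto ω).comp (tendsto_add_atTop_nat 1)).eventually_gt_atTop (t : ℝ)).exists
  have hset : {i : ℕ | T (i + 1) ω ≤ t} = Iio (Nat.find hex) := by
    ext j
    simp only [mem_ofPred_eq, mem_Iio]
    constructor
    · intro hj
      by_contra hcon
      have := (h.epoch_strictMono ω).monotone (Nat.succ_le_succ (not_lt.1 hcon))
      exact absurd (Nat.find_spec hex) (not_lt.2 (this.trans hj))
    · intro hj
      exact not_lt.1 (Nat.find_min hex hj)
  have : claimCount T t ω = Nat.find hex := by
    rw [claimCount, hset, ← Finset.coe_range, Set.ncard_coe_finset, Finset.card_range]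
  rw [this]
  exact (Set.ext_iff.1 hset i)

lemma IsCompoundPoisson.lt_epoch_iff (h : IsCompoundPoisson P 𝓕 lam Q T Y) (i : ℕ) (t : ℝ≥0)
    (ω : Ω) : (t : ℝ) < T (i + 1) ω ↔ claimCount T t ω ≤ i := by
  rw [← not_le, h.epoch_le_iff, not_lt]

lemma IsCompoundPoisson.epoch_nonneg (h : IsCompoundPoisson P 𝓕 lam Q T Y) (i : ℕ) (ω : Ω) :
    0 ≤ T i ω := by
  rw [← h.epoch_zero ω]; exact (h.epoch_strictMono ω).monotone (Nat.zero_le i)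

lemma IsCompoundPoisson.claimCount_eq (h : IsCompoundPoisson P 𝓕 lam Q T Y) {i : ℕ} {t : ℝ≥0}
    {ω : Ω} (h1 : T i ω ≤ t) (h2 : (t : ℝ) < T (i + 1) ω) : claimCount T t ω = i := by
  refine le_antisymm ((h.lt_epoch_iff i t ω).1 h2) ?_
  cases i with
  | zero => exact Nat.zero_le _
  | succ i => exact (h.epoch_le_iff i t ω).1 h1

lemma IsCompoundPoisson.epoch_claimCount_le (h : IsCompoundPoisson P 𝓕 lam Q T Y) (t : ℝ≥0)
    (ω : Ω) : T (claimCount T t ω) ω ≤ t := by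
  rcases hn : claimCount T t ω with _ | n
  · rw [h.epoch_zero]; exact t.2
  · exact (h.epoch_le_iff n t ω).2 (by omega)

lemma IsCompoundPoisson.lt_epoch_claimCount (h : IsCompoundPoisson P 𝓕 lam Q T Y) (t : ℝ≥0)
    (ω : Ω) : (t : ℝ) < T (claimCount T t ω + 1) ω :=
  (h.lt_epoch_iff _ t ω).2 le_rfl

lemma IsCompoundPoisson.claimCount_mono (h : IsCompoundPoisson P 𝓕 lam Q T Y) (ω : Ω) :
    Monotone fun t => claimCount T t ω := fun s t hst =>
  (h.lt_epoch_iff _ s ω).1 ((NNReal.coe_le_coe.2 hst).trans_lt (h.lt_epoch_claimCount t ω))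

lemma IsCompoundPoisson.claimCount_zero (h : IsCompoundPoisson P 𝓕 lam Q T Y) (ω : Ω) :
    claimCount T 0 ω = 0 :=
  h.claimCount_eq (h.epoch_zero ω).le
    (by rw [NNReal.coe_zero, ← h.epoch_zero ω]; exact h.epoch_strictMono ω (Nat.lt_succ_self 0))

lemma IsCompoundPoisson.aggregateClaims_eq (h : IsCompoundPoisson P 𝓕 lam Q T Y) {i : ℕ}
    {t : ℝ≥0} {ω : Ω} (h1 : T i ω ≤ t) (h2 : (t : ℝ) < T (i + 1) ω) :
    aggregateClaims T Y t ω = ∑ j ∈ Finset.range i, Y j ω := by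
  rw [aggregateClaims, h.claimCount_eq h1 h2]

lemma IsCompoundPoisson.claimCount_eventually_eq (h : IsCompoundPoisson P 𝓕 lam Q T Y) (t : ℝ≥0)
    (ω : Ω) : ∀ᶠ s in 𝓝[≥] t, claimCount T s ω = claimCount T t ω := by
  have h1 : ∀ᶠ s : ℝ≥0 in 𝓝 t, (s : ℝ) < T (claimCount T t ω + 1) ω :=
    (NNReal.continuous_coe.tendsto t).eventually (gt_mem_nhds (h.lt_epoch_claimCount t ω))
  filter_upwards [h1.filter_mono nhdsWithin_le_nhds, self_mem_nhdsWithin] with s hs hts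
  exact h.claimCount_eq ((h.epoch_claimCount_le t ω).trans (NNReal.coe_le_coe.2 hts)) hs

lemma IsCompoundPoisson.aggregateClaims_rightContinuous (h : IsCompoundPoisson P 𝓕 lam Q T Y)
    (ω : Ω) (t : ℝ≥0) : ContinuousWithinAt (fun s => aggregateClaims T Y s ω) (Ici t) t := by
  refine ContinuousWithinAt.congr_of_eventuallyEq (f := fun _ => aggregateClaims T Y t ω)
    continuousWithinAt_const ?_ rfl
  filter_upwards [h.claimCount_eventually_eq t ω] with s hs
  rw [aggregateClaims, aggregateClaims, hs]

end Counting

/-! ### Progressive and predictable processes -/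

section Processes

variable {Ω : Type*} {m : MeasurableSpace Ω} {𝓕 : Filtration ℝ≥0 m}

/-- Serves the discretization of a process in time: only countably many sampling times occur, all
known at time `i`. -/
lemma measurable_countable_sample {X : ℝ≥0 → Ω → ℝ} (hX : Adapted 𝓕 X) {i : ℝ≥0} (b : ℕ → ℝ≥0)
    (hb : ∀ k, b k ≤ i) {κ : ℝ≥0 → ℕ} (hκ : Measurable κ) :
    Measurable[Subtype.instMeasurableSpace.prod (𝓕 i)]
      fun p : Iic i × Ω => X (b (κ p.1)) p.2 := by
  have h1 : Measurable[(⊤ : MeasurableSpace ℕ).prod (𝓕 i)] fun q : ℕ × Ω => X (b q.1) q.2 :=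
    measurable_from_prod_countable_right fun k => (hX (b k)).mono (𝓕.mono (hb k)) le_rfl
  have h2 : Measurable[Subtype.instMeasurableSpace.prod (𝓕 i),
      (⊤ : MeasurableSpace ℕ).prod (𝓕 i)] fun p : Iic i × Ω => (κ p.1, p.2) :=
    Measurable.prodMk (hκ.comp (measurable_subtype_coe.comp measurable_fst)) measurable_snd
  exact h1.comp h2

/-- An adapted right-continuous process is progressively measurable. -/
lemma isProgressive_of_rightContinuous {X : ℝ≥0 → Ω → ℝ} (hX : Adapted 𝓕 X)
    (hc : ∀ ω t, ContinuousWithinAt (fun s => X s ω) (Ici t) t) : IsProgressive 𝓕 X := by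
  intro i
  -- The next grid point to the right of `s`, capped at `i` so that the sample stays measurable at
  -- time `i`.
  let a : ℕ → ℝ≥0 → ℝ≥0 := fun n s => min i ((⌊s * (n + 1)⌋₊ + 1 : ℕ) / (n + 1))
  have hlim : ∀ s ≤ i, Tendsto (fun n => a n s) atTop (𝓝[≥] s) := by
    intro s hs
    refine tendsto_nhdsWithin_iff.2 ⟨?_, Eventually.of_forall fun n => ?_⟩
    · have hlow : ∀ n, s ≤ a n s := fun n => le_min hs (by
        rw [le_div_iff₀ (by positivity)]
        exact_mod_cast (Nat.lt_floor_add_one (s * (n + 1))).le)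
      have hup : ∀ n, a n s ≤ s + 1 / ((n : ℝ≥0) + 1) := fun n => (min_le_right _ _).trans (by
        rw [div_le_iff₀ (by positivity), add_mul, one_div, inv_mul_cancel₀ (by positivity)]
        push_cast
        gcongr
        exact Nat.floor_le (zero_le))
      refine tendsto_of_tendsto_of_tendsto_of_le_of_le tendsto_const_nhds ?_ hlow hup
      simpa using (tendsto_const_nhds (x := s)).add
        (tendsto_one_div_add_atTop_nhds_zero_nat (𝕜 := ℝ≥0))
    · exact le_min hs (by
        rw [le_div_iff₀ (by positivity)]
        exact_mod_cast (Nat.lt_floor_add_one (s * (n + 1))).le)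
  refine @measurable_of_tendsto_metrizable _ _ (Subtype.instMeasurableSpace.prod (𝓕 i)) _ _ _ _
    (fun n (p : Iic i × Ω) => X (a n p.1) p.2) _ (fun n => ?_) ?_
  · exact measurable_countable_sample hX (fun k : ℕ => min i ((k + 1 : ℕ) / (n + 1)))
      (fun k => min_le_left _ _) (κ := fun s => ⌊s * (n + 1)⌋₊)
      (Nat.measurable_floor.comp (measurable_id.mul_const _))
  · rw [tendsto_pi_nhds]
    exact fun p => (hc p.2 p.1).tendsto.comp (hlim p.1 p.1.2)

/-- The left end of the interval of mesh `1 / (n + 1)` which contains `s`. -/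
def leftGrid (n : ℕ) (s : ℝ≥0) : ℝ≥0 := (⌈s * (n + 1)⌉₊ - 1 : ℕ) / (n + 1)

lemma leftGrid_lt (n : ℕ) {s : ℝ≥0} (hs : 0 < s) : leftGrid n s < s := by
  rw [leftGrid, div_lt_iff₀ (by positivity)]
  exact Nat.lt_ceil.1 (Nat.sub_lt (Nat.ceil_pos.2 (by positivity)) one_pos)

lemma tendsto_leftGrid (s : ℝ≥0) : Tendsto (fun n => leftGrid n s) atTop (𝓝 s) := by
  have hlow : ∀ n, s ≤ leftGrid n s + 1 / ((n : ℝ≥0) + 1) := fun n => by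
    rw [leftGrid, ← add_div, le_div_iff₀ (by positivity)]
    refine (Nat.le_ceil _).trans ?_
    exact_mod_cast (by omega : ⌈s * (n + 1)⌉₊ ≤ ⌈s * (n + 1)⌉₊ - 1 + 1)
  have hup : ∀ n, leftGrid n s ≤ s := fun n => by
    rcases eq_or_lt_of_le (zero_le (a := s)) with h | h
    · simp [leftGrid, ← h]
    · exact (leftGrid_lt n h).le
  have h0 := tendsto_one_div_add_atTop_nhds_zero_nat (𝕜 := ℝ≥0)
  refine tendsto_of_tendsto_of_tendsto_of_le_of_le (g := fun n : ℕ => s - 1 / ((n : ℝ≥0) + 1)) ?_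
    tendsto_const_nhds (fun n => tsub_le_iff_right.2 (hlow n)) hup
  simpa using (tendsto_const_nhds (x := s)).sub h0

/-- The predictable left limit of a process along the grids of mesh `1 / (n + 1)`. -/
def leftLimit (X : ℝ≥0 → Ω → ℝ) (p : ℝ≥0 × Ω) : ℝ :=
  limsup (fun n => X (leftGrid n p.1) p.2) atTop

/-- On each left-open grid cell the approximant is the value of `X` at the left end, so preimages
are unions of predictable rectangles. The limsup keeps measurability without asking that the limit
exist. -/
lemma measurable_leftLimit {X : ℝ≥0 → Ω → ℝ} (hX : Adapted 𝓕 X) :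
    Measurable[𝓕.predictable] (leftLimit X) := by
  refine Measurable.limsup fun n => ?_
  intro B hB
  have : (fun p : ℝ≥0 × Ω => X (leftGrid n p.1) p.2) ⁻¹' B =
      {⊥} ×ˢ (X 0 ⁻¹' B) ∪ ⋃ k : ℕ,
        Ioc ((k : ℝ≥0) / (n + 1)) ((k + 1 : ℕ) / (n + 1)) ×ˢ (X (k / (n + 1)) ⁻¹' B) := by
    have hn : (0 : ℝ≥0) < n + 1 := by positivity
    ext ⟨s, ω⟩
    simp only [mem_preimage, mem_union, mem_prod, mem_singleton_iff, mem_iUnion, mem_Ioc]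
    constructor
    · intro h
      rcases eq_or_lt_of_le (zero_le (a := s)) with h0 | h0
      · left
        subst h0
        simpa [leftGrid] using h
      · right
        have hc : 0 < ⌈s * (n + 1)⌉₊ := Nat.ceil_pos.2 (by positivity)
        refine ⟨⌈s * (n + 1)⌉₊ - 1, ⟨leftGrid_lt n h0, ?_⟩, h⟩
        rw [le_div_iff₀ hn, Nat.sub_add_cancel hc]
        exact Nat.le_ceil _
    · rintro (⟨h0, h⟩ | ⟨k, ⟨h1, h2⟩, h⟩)
      · have : s = 0 := h0
        subst this
        simpa [leftGrid] using h
      · have : ⌈s * (n + 1)⌉₊ = k + 1 := by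
          rw [Nat.ceil_eq_iff (by omega)]
          rw [div_lt_iff₀ hn] at h1
          rw [le_div_iff₀ hn] at h2
          exact ⟨by simpa using h1, h2⟩
        simpa [leftGrid, this] using h
  rw [this]
  refine MeasurableSet.union (measurableSet_predictable_singleton_bot_prod (hX 0 hB))
    (MeasurableSet.iUnion fun k => measurableSet_predictable_Ioc_prod _ _ (hX _ hB))

/-- A predictable set, sampled at a time before `t` known at `t`, is an event at `t`. -/
lemma measurable_predictable_sample {f : ℝ≥0 × Ω → ℝ} (hf : Measurable[𝓕.predictable] f)
    {t : ℝ≥0} {σ : Ω → ℝ≥0} (hσ : Measurable[𝓕 t] σ) (hσt : ∀ ω, σ ω ≤ t) :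
    Measurable[𝓕 t] fun ω => f (σ ω, ω) := by
  have h1 := hf.comp (measurable_inclusion_predictable (𝓕 := 𝓕) (i := t))
  have h2 : Measurable[𝓕 t, Subtype.instMeasurableSpace.prod (𝓕 t)]
      fun ω => ((⟨σ ω, hσt ω⟩ : Iic t), ω) :=
    Measurable.prodMk (Measurable.subtype_mk hσ) measurable_id
  exact h1.comp h2

lemma IsProgressive.measurable_sample {X : ℝ≥0 → Ω → ℝ} (hX : IsProgressive 𝓕 X)
    {t : ℝ≥0} {σ : Ω → ℝ≥0} (hσ : Measurable[𝓕 t] σ) (hσt : ∀ ω, σ ω ≤ t) :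
    Measurable[𝓕 t] fun ω => X (σ ω) ω := by
  have h2 : Measurable[𝓕 t, Subtype.instMeasurableSpace.prod (𝓕 t)]
      fun ω => ((⟨σ ω, hσt ω⟩ : Iic t), ω) :=
    Measurable.prodMk (Measurable.subtype_mk hσ) measurable_id
  exact (hX t).comp h2

/-- A progressively measurable process is jointly measurable. -/
lemma IsProgressive.measurable_uncurry {X : ℝ≥0 → Ω → ℝ} (hX : IsProgressive 𝓕 X) :
    Measurable fun p : ℝ≥0 × Ω => X p.1 p.2 := by
  have key : ∀ n : ℕ, Measurable fun p : ℝ≥0 × Ω => X (min p.1 n) p.2 := fun n => by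
    have h1 : Measurable fun p : Iic (n : ℝ≥0) × Ω => X p.1 p.2 :=
      (hX n).mono (sup_le_sup le_rfl (MeasurableSpace.comap_mono (𝓕.le n))) le_rfl
    have h2 : Measurable fun p : ℝ≥0 × Ω => ((⟨min p.1 n, mem_Iic.2 (min_le_right _ _)⟩ : Iic (n : ℝ≥0)), p.2) :=
      ((measurable_fst.min measurable_const).subtype_mk).prodMk measurable_snd
    exact h1.comp h2
  refine measurable_of_tendsto_metrizable key ?_
  rw [tendsto_pi_nhds]
  intro p
  refine tendsto_const_nhds.congr' ?_
  obtain ⟨N, hN⟩ := exists_nat_ge p.1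
  filter_upwards [eventually_ge_atTop N] with n hn
  rw [min_eq_left (hN.trans (by exact_mod_cast hn))]

end Processes

/-! ### The renewal measure of the claim epochs -/

/-- The Erlang density of the epoch of the `(n + 1)`-st claim. -/
def erlangDensity (lam : ℝ) (n : ℕ) (t : ℝ) : ℝ :=
  lam * ((lam * t) ^ n / n.factorial * Real.exp (-(lam * t)))

lemma lintegral_expMeasure (lam : ℝ) {f : ℝ → ℝ≥0∞} (hf : Measurable f) :
    ∫⁻ r, f r ∂(expMeasure lam) = ∫⁻ r in Ioi 0, ENNReal.ofReal (lam * Real.exp (-(lam * r))) * f r := by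
  have hm : Measurable (gammaPDF 1 lam) := (measurable_gammaPDFReal 1 lam).ennreal_ofReal
  rw [expMeasure, gammaMeasure, lintegral_withDensity_eq_lintegral_mul _ hm hf,
    ← lintegral_indicator measurableSet_Ioi]
  refine lintegral_congr_ae ?_
  have : ∀ᵐ r : ℝ, r ≠ 0 := by simp [ae_iff]
  filter_upwards [this] with r hr
  rcases lt_or_gt_of_ne hr with h | h
  · simp [gammaPDF_of_neg h, indicator, not_lt.2 h.le]
  · have : gammaPDF 1 lam r = ENNReal.ofReal (lam * Real.exp (-(lam * r))) :=
      exponentialPDF_of_nonneg h.le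
    simp [this, indicator, h]

lemma integral_exp_mul_erlangDensity (lam : ℝ) (n : ℕ) (t : ℝ) :
    lam * Real.exp (-(lam * t)) * ∫ s in (0 : ℝ)..t, lam * ((lam * s) ^ n / n.factorial)
      = erlangDensity lam (n + 1) t := by
  have : ∀ s : ℝ, lam * ((lam * s) ^ n / n.factorial) = (lam ^ (n + 1) / n.factorial) * s ^ n :=
    fun s => by rw [mul_pow]; ring
  simp_rw [this]
  rw [intervalIntegral.integral_const_mul, integral_pow, erlangDensity, Nat.factorial_succ]
  push_cast
  field_simp
  ring

lemma erlangDensity_nonneg {lam : ℝ} (hlam : 0 < lam) (n : ℕ) {t : ℝ} (ht : 0 ≤ t) :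
    0 ≤ erlangDensity lam n t := by unfold erlangDensity; positivity

lemma measurable_erlangDensity (lam : ℝ) (n : ℕ) : Measurable (erlangDensity lam n) := by
  unfold erlangDensity; fun_prop

/-- Substitute t = s + r and exchange the integrals: the two exponentials multiply to exp(-λt),
which no longer depends on s, and a monomial in s is left to integrate over (0, t). -/
lemma lintegral_erlangDensity_convolution {lam : ℝ} (hlam : 0 < lam) (n : ℕ) {f : ℝ → ℝ≥0∞}
    (hf : Measurable f) :
    ∫⁻ s in Ioi 0, ENNReal.ofReal (erlangDensity lam n s) *
      ∫⁻ r in Ioi 0, ENNReal.ofReal (lam * Real.exp (-(lam * r))) * f (s + r)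
    = ∫⁻ t in Ioi 0, ENNReal.ofReal (erlangDensity lam (n + 1) t) * f t := by
  have hE := measurable_erlangDensity lam n
  have hshift : ∀ s : ℝ, ∫⁻ r in Ioi 0, ENNReal.ofReal (lam * Real.exp (-(lam * r))) * f (s + r) =
      ∫⁻ t, (Ioi s).indicator
        (fun t => ENNReal.ofReal (lam * Real.exp (-(lam * (t - s)))) * f t) t := fun s => by
    rw [← lintegral_indicator measurableSet_Ioi, ← lintegral_sub_right_eq_self _ s]
    refine lintegral_congr fun t => ?_
    simp [indicator, sub_pos]
  simp_rw [hshift]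
  have hJ : Measurable fun p : ℝ × ℝ => (Ioi p.1).indicator
      (fun t => ENNReal.ofReal (lam * Real.exp (-(lam * (t - p.1)))) * f t) p.2 := by
    have : (fun p : ℝ × ℝ => (Ioi p.1).indicator
      (fun t => ENNReal.ofReal (lam * Real.exp (-(lam * (t - p.1)))) * f t) p.2) =
      {p : ℝ × ℝ | p.1 < p.2}.indicator
        (fun p => ENNReal.ofReal (lam * Real.exp (-(lam * (p.2 - p.1)))) * f p.2) := by
      funext p; simp [indicator]
    rw [this]
    refine Measurable.indicator ?_ (measurableSet_lt measurable_fst measurable_snd)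
    have : Measurable fun p : ℝ × ℝ => f p.2 := hf.comp measurable_snd
    fun_prop
  have h1 : ∀ s : ℝ, ENNReal.ofReal (erlangDensity lam n s) * ∫⁻ t, (Ioi s).indicator
        (fun t => ENNReal.ofReal (lam * Real.exp (-(lam * (t - s)))) * f t) t =
      ∫⁻ t, ENNReal.ofReal (erlangDensity lam n s) * (Ioi s).indicator
        (fun t => ENNReal.ofReal (lam * Real.exp (-(lam * (t - s)))) * f t) t := fun s =>
    (lintegral_const_mul' _ _ ENNReal.ofReal_ne_top).symm
  simp_rw [h1]
  rw [lintegral_lintegral_swap (by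
    refine Measurable.aemeasurable ?_
    exact (hE.comp measurable_fst).ennreal_ofReal.mul hJ), ← lintegral_indicator measurableSet_Ioi]
  refine lintegral_congr fun t => ?_
  rcases le_or_gt t 0 with ht | ht
  · rw [indicator_of_notMem (by simpa using ht)]
    rw [lintegral_eq_zero_iff' (by
      refine Measurable.aemeasurable ?_
      exact hE.ennreal_ofReal.mul (hJ.comp (measurable_id.prodMk measurable_const)))]
    refine (ae_restrict_iff' measurableSet_Ioi).2 (Eventually.of_forall fun s hs => ?_)
    simp [indicator, not_lt.2 (ht.trans (le_of_lt hs))]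
  · rw [indicator_of_mem (by simpa using ht)]
    have h2 : ∀ s, (Ioi (0 : ℝ)).indicator (fun s => ENNReal.ofReal (erlangDensity lam n s) *
        (Ioi s).indicator
          (fun t => ENNReal.ofReal (lam * Real.exp (-(lam * (t - s)))) * f t) t) s =
        (Ioo 0 t).indicator (fun s => ENNReal.ofReal (lam * ((lam * s) ^ n / n.factorial))) s *
          (ENNReal.ofReal (lam * Real.exp (-(lam * t))) * f t) := fun s => by
      by_cases h0 : 0 < s
      · by_cases hst : s < t
        · simp only [indicator, mem_Ioi, h0, hst, if_true, mem_Ioo, and_self]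
          rw [← mul_assoc, ← mul_assoc, ← ENNReal.ofReal_mul (erlangDensity_nonneg hlam n h0.le),
            ← ENNReal.ofReal_mul (by positivity)]
          congr 2
          have : Real.exp (-(lam * t)) = Real.exp (-(lam * (t - s))) * Real.exp (-(lam * s)) := by
            rw [← Real.exp_add]; ring_nf
          rw [erlangDensity, this]
          ring
        · simp [indicator, hst]
      · simp [indicator, h0]
    rw [← lintegral_indicator measurableSet_Ioi]
    simp_rw [h2]
    rw [lintegral_mul_const'' _ (by
      refine (Measurable.indicator ?_ measurableSet_Ioo).aemeasurable
      fun_prop), lintegral_indicator measurableSet_Ioo, ← mul_assoc]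
    congr 1
    rw [← integral_exp_mul_erlangDensity, intervalIntegral.integral_of_le ht.le,
      integral_Ioc_eq_integral_Ioo, ← ofReal_integral_eq_lintegral_ofReal, mul_comm,
      ← ENNReal.ofReal_mul (by positivity)]
    · exact (Continuous.integrableOn_Icc (by fun_prop)).mono_set Ioo_subset_Icc_self
    · refine (ae_restrict_iff' measurableSet_Ioo).2 (Eventually.of_forall fun s hs => ?_)
      have := hs.1
      simp only [Pi.zero_apply]
      positivity

section Renewal

variable {Ω : Type*} [MeasurableSpace Ω] {P : Measure Ω}
  {𝓕 : Filtration ℝ≥0 (inferInstance : MeasurableSpace Ω)} {lam : ℝ} {Q : Measure ℝ}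
  {T Y : ℕ → Ω → ℝ}

/-- Expresses an epoch through members of the joint independent family, which makes it independent
of any member not in the sum. -/
lemma IsCompoundPoisson.epoch_eq_sum (h : IsCompoundPoisson P 𝓕 lam Q T Y) (n : ℕ) :
    T n = ∑ j ∈ (Finset.range n).map ⟨Sum.inl, Sum.inl_injective⟩,
      Sum.elim (fun (i : ℕ) ω => T (i + 1) ω - T i ω) Y j := by
  funext ω
  rw [Finset.sum_map]
  simp only [Function.Embedding.coeFn_mk, Sum.elim_inl, Finset.sum_apply]
  rw [Finset.sum_range_sub (fun i => T i ω), h.epoch_zero, sub_zero]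

lemma IsCompoundPoisson.measurable_elim (h : IsCompoundPoisson P 𝓕 lam Q T Y) (j : ℕ ⊕ ℕ) :
    Measurable (Sum.elim (fun (i : ℕ) ω => T (i + 1) ω - T i ω) Y j) := by
  rcases j with j | j
  · exact (h.measurable_epoch (j + 1)).sub (h.measurable_epoch j)
  · exact h.measurable_claim j

lemma IsCompoundPoisson.indepFun_epoch_interarrival (h : IsCompoundPoisson P 𝓕 lam Q T Y) (n : ℕ) :
    IndepFun (T n) (fun ω => T (n + 1) ω - T n ω) P := by
  have := h.independent.indepFun_finsetSum_of_notMem h.measurable_elim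
    (s := (Finset.range n).map ⟨Sum.inl, Sum.inl_injective⟩) (i := Sum.inl n) (by simp)
  rwa [← h.epoch_eq_sum] at this

lemma IsCompoundPoisson.indepFun_epoch_claim (h : IsCompoundPoisson P 𝓕 lam Q T Y) (n k : ℕ) :
    IndepFun (T n) (Y k) P := by
  have := h.independent.indepFun_finsetSum_of_notMem h.measurable_elim
    (s := (Finset.range n).map ⟨Sum.inl, Sum.inl_injective⟩) (i := Sum.inr k) (by simp)
  rwa [← h.epoch_eq_sum] at this

variable [IsProbabilityMeasure P]

/-- Each epoch is the previous one plus an independent exponential time, so the law follows from the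
Erlang convolution by induction. -/
lemma IsCompoundPoisson.lintegral_epoch (h : IsCompoundPoisson P 𝓕 lam Q T Y) (hlam : 0 < lam)
    (n : ℕ) {f : ℝ → ℝ≥0∞} (hf : Measurable f) :
    ∫⁻ ω, f (T (n + 1) ω) ∂P = ∫⁻ t in Ioi 0, ENNReal.ofReal (erlangDensity lam n t) * f t := by
  have hmi : ∀ n, Measurable fun ω => T (n + 1) ω - T n ω := fun n =>
    (h.measurable_epoch (n + 1)).sub (h.measurable_epoch n)
  induction n generalizing f with
  | zero =>
    have h1 : ∀ ω, T (0 + 1) ω = T (0 + 1) ω - T 0 ω := fun ω => by rw [h.epoch_zero]; simp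
    calc ∫⁻ ω, f (T (0 + 1) ω) ∂P = ∫⁻ ω, f (T (0 + 1) ω - T 0 ω) ∂P := by
          refine lintegral_congr fun ω => ?_
          rw [← h1]
      _ = ∫⁻ r, f r ∂(expMeasure lam) := by
          rw [← h.law_interarrival 0, lintegral_map hf (hmi 0)]
      _ = _ := by
          rw [lintegral_expMeasure lam hf]
          simp [erlangDensity]
  | succ n ih =>
    have hind := (indepFun_iff_map_prod_eq_prod_map_map (h.measurable_epoch (n + 1)).aemeasurable
      (hmi (n + 1)).aemeasurable).1 (h.indepFun_epoch_interarrival (n + 1))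
    have hfa : Measurable fun p : ℝ × ℝ => f (p.1 + p.2) :=
      hf.comp (measurable_fst.add measurable_snd)
    have hin : Measurable fun s : ℝ => ∫⁻ r, f (s + r) ∂(expMeasure lam) := by
      have := isProbabilityMeasure_expMeasure hlam
      exact hfa.lintegral_prod_right'
    have := isProbabilityMeasure_expMeasure hlam
    calc ∫⁻ ω, f (T (n + 1 + 1) ω) ∂P
        = ∫⁻ ω, f (T (n + 1) ω + (T (n + 1 + 1) ω - T (n + 1) ω)) ∂P := by
          refine lintegral_congr fun ω => ?_
          rw [add_sub_cancel]
      _ = ∫⁻ p, f (p.1 + p.2) ∂(P.map fun ω => (T (n + 1) ω, T (n + 1 + 1) ω - T (n + 1) ω)) := by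
          rw [lintegral_map hfa ((h.measurable_epoch (n + 1)).prodMk (hmi (n + 1)))]
      _ = ∫⁻ ω, ∫⁻ r, f (T (n + 1) ω + r) ∂(expMeasure lam) ∂P := by
          rw [hind, h.law_interarrival, lintegral_prod _ hfa.aemeasurable,
            lintegral_map hin (h.measurable_epoch (n + 1))]
      _ = _ := by
          rw [ih hin, ← lintegral_erlangDensity_convolution hlam n hf]
          refine lintegral_congr fun s => ?_
          rw [lintegral_expMeasure lam (f := fun r => f (s + r))
            (hf.comp (measurable_const.add measurable_id))]

/-- The renewal measure of the claim epochs is `lam` times the Lebesgue measure. -/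
lemma IsCompoundPoisson.tsum_lintegral_epoch (h : IsCompoundPoisson P 𝓕 lam Q T Y) (hlam : 0 < lam)
    {f : ℝ → ℝ≥0∞} (hf : Measurable f) :
    ∑' n, ∫⁻ ω, f (T (n + 1) ω) ∂P = ENNReal.ofReal lam * ∫⁻ t in Ioi 0, f t := by
  simp_rw [h.lintegral_epoch hlam _ hf]
  rw [← lintegral_tsum (f := fun n t => ENNReal.ofReal (erlangDensity lam n t) * f t)
      fun n => ((measurable_erlangDensity lam n).ennreal_ofReal.mul hf).aemeasurable,
    ← lintegral_const_mul _ hf]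
  refine setLIntegral_congr_fun measurableSet_Ioi fun t ht => ?_
  have ht' : 0 ≤ t := le_of_lt ht
  rw [ENNReal.tsum_mul_right]
  congr 1
  -- The Erlang densities at `t` are λ times the Poisson weights with mean λt, which sum to 1.
  have hs : HasSum (fun n => erlangDensity lam n t) lam := by
    have h1 := ((NormedSpace.expSeries_div_hasSum_exp (lam * t)).mul_right
      (Real.exp (-(lam * t)))).mul_left lam
    rw [← Real.exp_eq_exp_ℝ, ← Real.exp_add, add_neg_cancel, Real.exp_zero, mul_one] at h1
    exact h1
  rw [← ENNReal.ofReal_tsum_of_nonneg (fun n => erlangDensity_nonneg hlam n ht') hs.summable,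
    hs.tsum_eq]

lemma IsCompoundPoisson.tsum_measure_epoch_claim (h : IsCompoundPoisson P 𝓕 lam Q T Y)
    (hlam : 0 < lam) (s t : ℝ≥0) {C : Set ℝ} (hC : MeasurableSet C) :
    ∑' n, P {ω | ((s : ℝ) < T (n + 1) ω ∧ T (n + 1) ω ≤ t) ∧ Y n ω ∈ C} =
      ENNReal.ofReal lam * (ENNReal.ofReal (t - s) * Q C) := by
  have h1 : ∀ n, P {ω | ((s : ℝ) < T (n + 1) ω ∧ T (n + 1) ω ≤ t) ∧ Y n ω ∈ C} =
      (∫⁻ ω, (Ioc (s : ℝ) t).indicator 1 (T (n + 1) ω) ∂P) * Q C := fun n => by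
    have h2 := (h.indepFun_epoch_claim (n + 1) n).measure_inter_preimage_eq_mul (Ioc (s : ℝ) t) C
      measurableSet_Ioc hC
    rw [← h.law_claim n, Measure.map_apply (h.measurable_claim n) hC,
      show {ω | ((s : ℝ) < T (n + 1) ω ∧ T (n + 1) ω ≤ t) ∧ Y n ω ∈ C} =
        T (n + 1) ⁻¹' Ioc (s : ℝ) t ∩ Y n ⁻¹' C from rfl, h2,
      ← lintegral_indicator_one (h.measurable_epoch (n + 1) measurableSet_Ioc)]
    rfl
  simp_rw [h1]
  rw [ENNReal.tsum_mul_right, h.tsum_lintegral_epoch hlam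
    (measurable_one.indicator measurableSet_Ioc), mul_assoc]
  congr 2
  rw [lintegral_indicator_one measurableSet_Ioc, Measure.restrict_apply measurableSet_Ioc,
    inter_eq_left.2 fun x hx => mem_Ioi.2 (lt_of_le_of_lt s.2 hx.1), Real.volume_Ioc]

end Renewal

/-! ### The compensation formula -/

section Compensation

variable {Ω : Type*} [MeasurableSpace Ω] {P : Measure Ω}
  {𝓕 : Filtration ℝ≥0 (inferInstance : MeasurableSpace Ω)} {lam : ℝ} {Q : Measure ℝ}
  {T Y : ℕ → Ω → ℝ}

/-- The `k`-th point of the uniform grid with `n + 1` steps from `s` to `t`. -/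
def grid (s t : ℝ≥0) (n k : ℕ) : ℝ≥0 := s + k * ((t - s) / (n + 1))

lemma grid_zero (s t : ℝ≥0) (n : ℕ) : grid s t n 0 = s := by simp [grid]

lemma grid_last {s t : ℝ≥0} (hst : s ≤ t) (n : ℕ) : grid s t n (n + 1) = t := by
  have : ((n + 1 : ℕ) : ℝ≥0) * ((t - s) / (n + 1)) = t - s := by
    push_cast
    exact mul_div_cancel₀ _ (by positivity)
  rw [grid, this, add_tsub_cancel_of_le hst]

lemma grid_succ (s t : ℝ≥0) (n k : ℕ) : grid s t n (k + 1) = grid s t n k + (t - s) / (n + 1) := by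
  simp only [grid]; push_cast; ring

lemma le_grid (s t : ℝ≥0) (n k : ℕ) : s ≤ grid s t n k := by simp [grid]

lemma grid_le_succ (s t : ℝ≥0) (n k : ℕ) : grid s t n k ≤ grid s t n (k + 1) := by
  simp [grid_succ]

/-- The event that exactly one claim occurs in `(s, t]`, with size in `C`. -/
def singleClaim (T Y : ℕ → Ω → ℝ) (C : Set ℝ) (s t : ℝ≥0) : Set Ω :=
  (fun ω => ((claimCount T t ω : ℝ) - claimCount T s ω,
    aggregateClaims T Y t ω - aggregateClaims T Y s ω)) ⁻¹' ({1} ×ˢ C)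

/-- The increments of the count and of the aggregate reveal the size of a claim only when it is
alone in the interval: then the aggregate increment is that claim. -/
lemma IsCompoundPoisson.indicator_singleClaim (h : IsCompoundPoisson P 𝓕 lam Q T Y) {C : Set ℝ}
    {s t : ℝ≥0} (hst : s ≤ t) {ω : Ω} (hle : claimCount T t ω ≤ claimCount T s ω + 1) :
    (singleClaim T Y C s t).indicator (1 : Ω → ℝ≥0∞) ω =
      ∑ i ∈ Finset.Ico (claimCount T s ω) (claimCount T t ω), C.indicator 1 (Y i ω) := by
  have hmono := h.claimCount_mono ω hst
  simp only at hmono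
  rcases Nat.lt_or_ge (claimCount T s ω) (claimCount T t ω) with hlt | hge
  · have heq : claimCount T t ω = claimCount T s ω + 1 := by omega
    have hA : aggregateClaims T Y t ω - aggregateClaims T Y s ω = Y (claimCount T s ω) ω := by
      rw [aggregateClaims, aggregateClaims, heq, Finset.sum_range_succ]; ring
    rw [heq, Nat.Ico_succ_singleton, Finset.sum_singleton]
    have hmem : ω ∈ singleClaim T Y C s t ↔ Y (claimCount T s ω) ω ∈ C := by
      change ((claimCount T t ω : ℝ) - claimCount T s ω,
        aggregateClaims T Y t ω - aggregateClaims T Y s ω) ∈ ({1} ×ˢ C : Set (ℝ × ℝ)) ↔ _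
      rw [hA, heq]
      simp
    by_cases hy : Y (claimCount T s ω) ω ∈ C
    · rw [indicator_of_mem hy, indicator_of_mem (hmem.2 hy)]; rfl
    · rw [indicator_of_notMem hy, indicator_of_notMem (mt hmem.1 hy)]
  · have heq : claimCount T t ω = claimCount T s ω := by omega
    simp [heq, singleClaim, indicator]

/-- Holds without a restriction on the number of claims in the interval, and provides the dominating
function in the refinement limit. -/
lemma IsCompoundPoisson.indicator_singleClaim_le (h : IsCompoundPoisson P 𝓕 lam Q T Y) {C : Set ℝ}
    {s t : ℝ≥0} (hst : s ≤ t) (ω : Ω) :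
    (singleClaim T Y C s t).indicator (1 : Ω → ℝ≥0∞) ω ≤
      ∑ _i ∈ Finset.Ico (claimCount T s ω) (claimCount T t ω), 1 := by
  rcases Nat.lt_or_ge (claimCount T s ω) (claimCount T t ω) with hlt | hge
  · refine (indicator_le_self' (fun _ _ => zero_le) ω).trans ?_
    rw [Finset.sum_const, Nat.card_Ico, nsmul_eq_mul, mul_one]
    rw [Pi.one_apply]
    exact_mod_cast (by omega : 1 ≤ claimCount T t ω - claimCount T s ω)
  · rw [h.indicator_singleClaim hst (by omega)]
    simp [Finset.Ico_eq_empty_of_le hge]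

lemma sum_grid_Ico {α : Type*} [AddCommMonoid α] (f : ℕ → α) {N : ℕ → ℕ} (hN : Monotone N) (n : ℕ) :
    ∑ k ∈ Finset.range n, ∑ i ∈ Finset.Ico (N k) (N (k + 1)), f i =
      ∑ i ∈ Finset.Ico (N 0) (N n), f i := by
  induction n with
  | zero => simp
  | succ n ih =>
    rw [Finset.sum_range_succ, ih,
      Finset.sum_Ico_consecutive _ (hN (Nat.zero_le n)) (hN (Nat.le_succ n))]

lemma grid_monotone (s t : ℝ≥0) (n : ℕ) : Monotone (grid s t n) :=
  monotone_nat_of_le_succ fun k => grid_le_succ s t n k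

/-- Once the mesh is below the finitely many relevant gaps between epochs, no grid cell contains two
claims. -/
lemma IsCompoundPoisson.eventually_sum_singleClaim (h : IsCompoundPoisson P 𝓕 lam Q T Y)
    (C : Set ℝ) {s t : ℝ≥0} (hst : s ≤ t) (ω : Ω) : ∀ᶠ n : ℕ in atTop,
    ∑ k ∈ Finset.range (n + 1), (singleClaim T Y C (grid s t n k) (grid s t n (k + 1))).indicator
      (1 : Ω → ℝ≥0∞) ω =
    ∑ i ∈ Finset.Ico (claimCount T s ω) (claimCount T t ω), C.indicator 1 (Y i ω) := by
  have hmesh : Tendsto (fun n : ℕ => ((t : ℝ) - s) / ((n : ℝ) + 1)) atTop (𝓝 0) := by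
    simpa [div_eq_mul_inv] using (tendsto_one_div_add_atTop_nhds_zero_nat (𝕜 := ℝ)).const_mul
      ((t : ℝ) - s)
  have hev : ∀ᶠ n : ℕ in atTop, ∀ j ∈ Finset.range (claimCount T t ω + 1),
      ((t : ℝ) - s) / ((n : ℝ) + 1) < T (j + 1) ω - T j ω :=
    (Filter.eventually_all_finset _).2 fun j _ => hmesh.eventually
      (gt_mem_nhds (sub_pos.2 (h.epoch_strictMono ω (Nat.lt_succ_self j))))
  filter_upwards [hev] with n hn
  have hone : ∀ k ∈ Finset.range (n + 1),
      claimCount T (grid s t n (k + 1)) ω ≤ claimCount T (grid s t n k) ω + 1 := by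
    intro k hk
    by_contra hcon
    push Not at hcon
    set i := claimCount T (grid s t n k) ω
    have h1 : T (i + 1 + 1) ω ≤ grid s t n (k + 1) := (h.epoch_le_iff _ _ _).2 hcon
    have h2 : (grid s t n k : ℝ) < T (i + 1) ω := (h.lt_epoch_iff _ _ _).2 le_rfl
    have h3 : grid s t n (k + 1) ≤ t := by
      refine (grid_monotone s t n (b := n + 1) ?_).trans (grid_last hst n).le
      simpa using hk
    have h4 := hn (i + 1) (Finset.mem_range.2 (by
      have := (h.epoch_le_iff (i + 1) t ω).1 (h1.trans (NNReal.coe_le_coe.2 h3)); omega))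
    rw [grid_succ] at h1
    push_cast [NNReal.coe_sub hst] at h1
    linarith
  rw [Finset.sum_congr rfl fun k hk => h.indicator_singleClaim (C := C) (grid_le_succ s t n k)
    (hone k hk), sum_grid_Ico (fun i => C.indicator 1 (Y i ω))
    (N := fun k => claimCount T (grid s t n k) ω)
    ((h.claimCount_mono ω).comp (grid_monotone s t n)), grid_zero, grid_last hst]

lemma IsCompoundPoisson.tsum_indicator_eq (h : IsCompoundPoisson P 𝓕 lam Q T Y)
    (C : Set ℝ) (s t : ℝ≥0) (ω : Ω) :
    ∑ i ∈ Finset.Ico (claimCount T s ω) (claimCount T t ω), C.indicator (1 : ℝ → ℝ≥0∞) (Y i ω) =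
    ∑' i, {ω | ((s : ℝ) < T (i + 1) ω ∧ T (i + 1) ω ≤ t) ∧ Y i ω ∈ C}.indicator 1 ω := by
  rw [tsum_eq_sum (s := Finset.Ico (claimCount T s ω) (claimCount T t ω))]
  · refine Finset.sum_congr rfl fun i hi => ?_
    rw [Finset.mem_Ico] at hi
    have hmem : ω ∈ {ω | ((s : ℝ) < T (i + 1) ω ∧ T (i + 1) ω ≤ t) ∧ Y i ω ∈ C} ↔ Y i ω ∈ C := by
      rw [mem_ofPred_eq, h.lt_epoch_iff, h.epoch_le_iff, and_iff_right hi]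
    by_cases hy : Y i ω ∈ C
    · rw [indicator_of_mem hy, indicator_of_mem (hmem.2 hy)]; rfl
    · rw [indicator_of_notMem hy, indicator_of_notMem (mt hmem.1 hy)]
  · intro i hi
    rw [Finset.mem_Ico] at hi
    rw [indicator_of_notMem]
    simp only [mem_ofPred_eq, h.lt_epoch_iff, h.epoch_le_iff]
    tauto

lemma IsCompoundPoisson.measurableSet_epoch_claim (h : IsCompoundPoisson P 𝓕 lam Q T Y)
    {C : Set ℝ} (hC : MeasurableSet C) (s t : ℝ≥0) (i : ℕ) :
    MeasurableSet {ω | ((s : ℝ) < T (i + 1) ω ∧ T (i + 1) ω ≤ t) ∧ Y i ω ∈ C} :=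
  (h.measurable_epoch (i + 1) measurableSet_Ioc).inter (h.measurable_claim i hC)

lemma IsCompoundPoisson.measurable_count_pair (h : IsCompoundPoisson P 𝓕 lam Q T Y) (s t : ℝ≥0) :
    Measurable fun ω => ((claimCount T t ω : ℝ) - claimCount T s ω,
      aggregateClaims T Y t ω - aggregateClaims T Y s ω) := by
  have hn : ∀ t, Measurable fun ω => (claimCount T t ω : ℝ) := fun t =>
    measurable_from_top.comp (h.adapted_count.measurable (i := t))
  have ha : ∀ t, Measurable (aggregateClaims T Y t) := fun t => h.adapted_claims.measurable
  exact ((hn t).sub (hn s)).prodMk ((ha t).sub (ha s))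

lemma IsCompoundPoisson.measurableSet_singleClaim (h : IsCompoundPoisson P 𝓕 lam Q T Y)
    {C : Set ℝ} (hC : MeasurableSet C) (s t : ℝ≥0) : MeasurableSet (singleClaim T Y C s t) :=
  h.measurable_count_pair s t ((measurableSet_singleton 1).prod hC)

lemma IsCompoundPoisson.measure_inter_singleClaim (h : IsCompoundPoisson P 𝓕 lam Q T Y)
    {C : Set ℝ} (hC : MeasurableSet C) {s t : ℝ≥0} (hst : s ≤ t) {B : Set Ω}
    (hB : MeasurableSet[𝓕 s] B) :
    P (B ∩ singleClaim T Y C s t) = P B * P (singleClaim T Y C s t) :=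
  (Indep_iff _ _ _).1 (h.indep_increments s t hst) B _ hB
    ⟨{1} ×ˢ C, (measurableSet_singleton 1).prod hC, rfl⟩

variable [IsProbabilityMeasure P]

/-- Claims after the time `s` are independent of the events at `s`. -/
lemma IsCompoundPoisson.tsum_measure_inter (h : IsCompoundPoisson P 𝓕 lam Q T Y) (hlam : 0 < lam)
    {C : Set ℝ} (hC : MeasurableSet C) {s t : ℝ≥0} (hst : s ≤ t) {B : Set Ω}
    (hB : MeasurableSet[𝓕 s] B) :
    ∑' i, P (B ∩ {ω | ((s : ℝ) < T (i + 1) ω ∧ T (i + 1) ω ≤ t) ∧ Y i ω ∈ C}) =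
      P B * (ENNReal.ofReal lam * (ENNReal.ofReal (t - s) * Q C)) := by
  -- The independence assumption concerns one increment pair at a time, so the claims with size in
  -- `C` are counted through grid cells holding a single claim. This count is dominated by the
  -- integrable N(t) and converges to the true one.
  set S : ℕ → Ω → ℝ≥0∞ := fun n ω => ∑ k ∈ Finset.range (n + 1),
    (singleClaim T Y C (grid s t n k) (grid s t n (k + 1))).indicator 1 ω with hS
  set S' : Ω → ℝ≥0∞ := fun ω =>
    ∑' i, {ω | ((s : ℝ) < T (i + 1) ω ∧ T (i + 1) ω ≤ t) ∧ Y i ω ∈ C}.indicator 1 ω with hS'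
  have hB' : MeasurableSet B := 𝓕.le s _ hB
  have hmeasN : Measurable fun ω => (claimCount T t ω : ℝ≥0∞) :=
    measurable_from_top.comp (h.adapted_count.measurable (i := t))
  have hSm : ∀ n, Measurable (S n) := fun n => Finset.measurable_sum _ fun k _ =>
    measurable_one.indicator (h.measurableSet_singleClaim hC _ _)
  have hbound : ∀ n ω, S n ω ≤ claimCount T t ω := fun n ω => by
    refine (Finset.sum_le_sum fun k _ =>
      h.indicator_singleClaim_le (C := C) (grid_le_succ s t n k) ω).trans ?_
    rw [sum_grid_Ico (fun _ => (1 : ℝ≥0∞)) (N := fun k => claimCount T (grid s t n k) ω)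
      ((h.claimCount_mono ω).comp (grid_monotone s t n)), grid_last hst, Finset.sum_const,
      Nat.card_Ico, nsmul_eq_mul, mul_one]
    exact_mod_cast Nat.sub_le _ _
  have hlim : ∀ ω, Tendsto (fun n => S n ω) atTop (𝓝 (S' ω)) := fun ω => by
    refine tendsto_const_nhds.congr' ?_
    filter_upwards [h.eventually_sum_singleClaim C hst ω] with n hn
    rw [hS', hS]
    simp only
    rw [hn, h.tsum_indicator_eq]
  have hfin : ∫⁻ ω, claimCount T t ω ∂P ≠ ⊤ := by
    have h1 : ∀ ω, (claimCount T t ω : ℝ≥0∞) = ∑' i,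
        {ω | (((0 : ℝ≥0) : ℝ) < T (i + 1) ω ∧ T (i + 1) ω ≤ t) ∧ Y i ω ∈ univ}.indicator 1 ω :=
      fun ω => by
        rw [← h.tsum_indicator_eq, h.claimCount_zero]; simp
    simp_rw [h1]
    rw [lintegral_tsum fun i => (measurable_one.indicator
      (h.measurableSet_epoch_claim MeasurableSet.univ _ _ i)).aemeasurable]
    simp_rw [lintegral_indicator_one (h.measurableSet_epoch_claim MeasurableSet.univ _ _ _)]
    rw [h.tsum_measure_epoch_claim hlam _ _ MeasurableSet.univ, ← h.law_claim 0]
    have := Measure.isProbabilityMeasure_map (μ := P) (h.measurable_claim 0).aemeasurable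
    rw [measure_univ]
    simp [ENNReal.mul_eq_top]
  have hconv : ∀ μ : Measure Ω, μ ≤ P →
      Tendsto (fun n => ∫⁻ ω, S n ω ∂μ) atTop (𝓝 (∫⁻ ω, S' ω ∂μ)) := fun μ hμ =>
    tendsto_lintegral_of_dominated_convergence _ hSm
      (fun n => Eventually.of_forall (hbound n)) (ne_top_of_le_ne_top hfin (lintegral_mono' hμ le_rfl))
      (Eventually.of_forall hlim)
  -- Every cell starts no earlier than `s`, so `B` is an event at its left end and factors out of
  -- each term.
  have hterm : ∀ n, ∫⁻ ω, S n ω ∂(P.restrict B) = P B * ∫⁻ ω, S n ω ∂P := fun n => by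
    rw [hS]
    simp only
    rw [lintegral_finsetSum _ fun k _ =>
        measurable_one.indicator (h.measurableSet_singleClaim hC _ _),
      lintegral_finsetSum _ fun k _ =>
        measurable_one.indicator (h.measurableSet_singleClaim hC _ _), Finset.mul_sum]
    refine Finset.sum_congr rfl fun k _ => ?_
    rw [lintegral_indicator_one (h.measurableSet_singleClaim hC _ _),
      lintegral_indicator_one (h.measurableSet_singleClaim hC _ _),
      Measure.restrict_apply (h.measurableSet_singleClaim hC _ _), inter_comm,
      h.measure_inter_singleClaim hC (grid_le_succ s t n k) (𝓕.mono (le_grid s t n k) _ hB)]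
  have heq : ∫⁻ ω, S' ω ∂(P.restrict B) = P B * ∫⁻ ω, S' ω ∂P := by
    refine tendsto_nhds_unique (hconv _ Measure.restrict_le_self) ?_
    simp_rw [hterm]
    exact ENNReal.Tendsto.const_mul (hconv P le_rfl) (Or.inr (measure_ne_top P B))
  have hval : ∀ μ : Measure Ω, ∫⁻ ω, S' ω ∂μ =
      ∑' i, μ {ω | ((s : ℝ) < T (i + 1) ω ∧ T (i + 1) ω ≤ t) ∧ Y i ω ∈ C} := fun μ => by
    rw [lintegral_tsum fun i => (measurable_one.indicator
      (h.measurableSet_epoch_claim hC _ _ i)).aemeasurable]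
    simp_rw [lintegral_indicator_one (h.measurableSet_epoch_claim hC _ _ _)]
  rw [hval, hval, h.tsum_measure_epoch_claim hlam _ _ hC] at heq
  rw [← heq]
  refine tsum_congr fun i => ?_
  rw [Measure.restrict_apply (h.measurableSet_epoch_claim hC _ _ i), inter_comm]

end Compensation

/-! ### The random measure of the claims and its compensator -/

section CompensationFormula

variable {Ω : Type*} [MeasurableSpace Ω] {P : Measure Ω}
  {𝓕 : Filtration ℝ≥0 (inferInstance : MeasurableSpace Ω)} {lam : ℝ} {Q : Measure ℝ}
  {T Y : ℕ → Ω → ℝ}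

/-- The Lebesgue measure on the time axis. -/
def timeMeasure : Measure ℝ≥0 := (volume.restrict (Ioi (0 : ℝ))).map Real.toNNReal

instance : SFinite timeMeasure := by unfold timeMeasure; infer_instance

lemma timeMeasure_Ioc (s t : ℝ≥0) : timeMeasure (Ioc s t) = ENNReal.ofReal (t - s) := by
  rw [timeMeasure, Measure.map_apply measurable_real_toNNReal measurableSet_Ioc,
    Measure.restrict_apply (measurable_real_toNNReal measurableSet_Ioc)]
  have : Real.toNNReal ⁻¹' Ioc s t ∩ Ioi 0 = Ioc (s : ℝ) t := by
    ext x
    simp only [mem_inter_iff, mem_preimage, mem_Ioc, mem_Ioi]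
    constructor
    · rintro ⟨⟨h1, h2⟩, h3⟩
      exact ⟨by rwa [← Real.lt_toNNReal_iff_coe_lt], by
        rwa [← Real.toNNReal_le_iff_le_coe]⟩
    · rintro ⟨h1, h2⟩
      exact ⟨⟨by rwa [Real.lt_toNNReal_iff_coe_lt], by
        rwa [Real.toNNReal_le_iff_le_coe]⟩, lt_of_le_of_lt s.2 h1⟩
  rw [this, Real.volume_Ioc]

lemma timeMeasure_zero : timeMeasure {0} = 0 := by
  rw [timeMeasure, Measure.map_apply measurable_real_toNNReal (measurableSet_singleton 0),
    Measure.restrict_apply (measurable_real_toNNReal (measurableSet_singleton 0))]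
  have : Real.toNNReal ⁻¹' {0} ∩ Ioi 0 = ∅ := by
    ext x; simp
  rw [this, measure_empty]

lemma lintegral_timeMeasure {f : ℝ≥0 → ℝ≥0∞} (hf : Measurable f) :
    ∫⁻ s, f s ∂timeMeasure = ∫⁻ s in Ioi (0 : ℝ), f s.toNNReal :=
  lintegral_map hf measurable_real_toNNReal

/-- The measure which counts the claims: a claim of size `y` at the time `s` in the scenario `ω`
contributes a unit mass at `((s, ω), y)`. -/
def claimMeasure (P : Measure Ω) (T Y : ℕ → Ω → ℝ) : Measure ((ℝ≥0 × Ω) × ℝ) :=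
  Measure.sum fun i => P.map fun ω => (((T (i + 1) ω).toNNReal, ω), Y i ω)

lemma IsCompoundPoisson.measurable_mark (h : IsCompoundPoisson P 𝓕 lam Q T Y) (i : ℕ) :
    Measurable fun ω => (((T (i + 1) ω).toNNReal, ω), Y i ω) :=
  ((h.measurable_epoch (i + 1)).real_toNNReal.prodMk measurable_id).prodMk (h.measurable_claim i)

lemma IsCompoundPoisson.lintegral_claimMeasure (h : IsCompoundPoisson P 𝓕 lam Q T Y)
    {F : (ℝ≥0 × Ω) × ℝ → ℝ≥0∞} (hF : Measurable F) :
    ∫⁻ p, F p ∂(claimMeasure P T Y) = ∑' i, ∫⁻ ω, F (((T (i + 1) ω).toNNReal, ω), Y i ω) ∂P := by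
  rw [claimMeasure, lintegral_sum_measure]
  exact tsum_congr fun i => lintegral_map hF (h.measurable_mark i)

lemma predictable_le : 𝓕.predictable ≤ (inferInstance : MeasurableSpace (ℝ≥0 × Ω)) :=
  measurableSpace_le_predictable_of_measurableSet
    (fun _ hA => (measurableSet_singleton _).prod (𝓕.le _ _ hA))
    fun i _ hA => measurableSet_Ioi.prod (𝓕.le i _ hA)

/-- The generating rectangles of the predictable σ-algebra. -/
def predictableRectangles (𝓕 : Filtration ℝ≥0 (inferInstance : MeasurableSpace Ω)) :
    Set (Set (ℝ≥0 × Ω)) :=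
  {s | ∃ A, MeasurableSet[𝓕 ⊥] A ∧ s = {⊥} ×ˢ A} ∪
    {s | ∃ i A, MeasurableSet[𝓕 i] A ∧ s = Set.Ioi i ×ˢ A}

lemma isPiSystem_predictableRectangles : IsPiSystem (predictableRectangles 𝓕) := by
  have hempty : ∅ ∈ predictableRectangles 𝓕 := Or.inl ⟨∅, @MeasurableSet.empty _ (𝓕 ⊥), by simp⟩
  have hbot : ∀ i : ℝ≥0, ({⊥} : Set ℝ≥0) ∩ Ioi i = ∅ := fun i => by
    ext x
    simp only [mem_inter_iff, mem_singleton_iff, mem_Ioi, mem_empty_iff_false, iff_false, not_and,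
      not_lt]
    rintro rfl; exact bot_le
  rintro _ (⟨A, hA, rfl⟩ | ⟨i, A, hA, rfl⟩) _ (⟨B, hB, rfl⟩ | ⟨j, B, hB, rfl⟩) -
  · exact Or.inl ⟨A ∩ B, hA.inter hB, by rw [prod_inter_prod, inter_self]⟩
  · rwa [prod_inter_prod, hbot, empty_prod]
  · rwa [prod_inter_prod, inter_comm, hbot, empty_prod]
  · exact Or.inr ⟨i ⊔ j, A ∩ B, (𝓕.mono le_sup_left _ hA).inter (𝓕.mono le_sup_right _ hB), by
      rw [prod_inter_prod, Ioi_inter_Ioi]⟩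

lemma isCountablySpanning_predictableRectangles :
    IsCountablySpanning (predictableRectangles 𝓕) := by
  refine ⟨fun n => Nat.casesOn n ({⊥} ×ˢ univ) fun _ => Ioi 0 ×ˢ univ, fun n => ?_, ?_⟩
  · cases n with
    | zero => exact Or.inl ⟨univ, MeasurableSet.univ, rfl⟩
    | succ n => exact Or.inr ⟨0, univ, MeasurableSet.univ, rfl⟩
  · refine eq_univ_of_forall fun ⟨s, ω⟩ => mem_iUnion.2 ?_
    rcases eq_or_lt_of_le (zero_le (a := s)) with h | h
    · exact ⟨0, by simp [← h]⟩
    · exact ⟨1, by simpa using h⟩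

/-- The first claim epoch is positive; this settles the generating rectangles over time 0. -/
lemma IsCompoundPoisson.claimMeasure_zero (h : IsCompoundPoisson P 𝓕 lam Q T Y)
    {B : Set Ω} (hB : MeasurableSet B) {C : Set ℝ} (hC : MeasurableSet C) :
    claimMeasure P T Y (({⊥} ×ˢ B) ×ˢ C) = 0 := by
  have hm : MeasurableSet ((({⊥} : Set ℝ≥0) ×ˢ B) ×ˢ C) :=
    ((measurableSet_singleton _).prod hB).prod hC
  rw [claimMeasure, Measure.sum_apply _ hm, ENNReal.tsum_eq_zero]
  intro i
  rw [Measure.map_apply (h.measurable_mark i) hm]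
  convert measure_empty (μ := P)
  ext ω
  have : 0 < T (i + 1) ω := (h.epoch_zero ω).symm.trans_lt (h.epoch_strictMono ω (Nat.succ_pos i))
  simp [not_le.2 this]

variable [IsProbabilityMeasure P]

lemma IsCompoundPoisson.isProbabilityMeasure (h : IsCompoundPoisson P 𝓕 lam Q T Y) :
    IsProbabilityMeasure Q :=
  h.law_claim 0 ▸ Measure.isProbabilityMeasure_map (h.measurable_claim 0).aemeasurable

lemma IsCompoundPoisson.claimMeasure_Ioc (h : IsCompoundPoisson P 𝓕 lam Q T Y) (hlam : 0 < lam)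
    (s t : ℝ≥0) {B : Set Ω} (hB : MeasurableSet[𝓕 s] B) {C : Set ℝ} (hC : MeasurableSet C) :
    claimMeasure P T Y ((Ioc s t ×ˢ B) ×ˢ C) =
      (ENNReal.ofReal lam • ((timeMeasure.prod P).prod Q)) ((Ioc s t ×ˢ B) ×ˢ C) := by
  have := h.isProbabilityMeasure
  rcases lt_or_ge t s with hts | hst
  · simp [Ioc_eq_empty_of_le hts.le]
  have hm : MeasurableSet ((Ioc s t ×ˢ B) ×ˢ C) := (measurableSet_Ioc.prod (𝓕.le s _ hB)).prod hC
  rw [claimMeasure, Measure.sum_apply _ hm, Measure.smul_apply, Measure.prod_prod,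
    Measure.prod_prod, timeMeasure_Ioc, smul_eq_mul]
  have h1 : ∀ i, P.map (fun ω => (((T (i + 1) ω).toNNReal, ω), Y i ω)) ((Ioc s t ×ˢ B) ×ˢ C) =
      P (B ∩ {ω | ((s : ℝ) < T (i + 1) ω ∧ T (i + 1) ω ≤ t) ∧ Y i ω ∈ C}) := fun i => by
    rw [Measure.map_apply (h.measurable_mark i) hm]
    congr 1
    ext ω
    simp only [mem_preimage, mem_prod, mem_Ioc, mem_inter_iff, mem_ofPred_eq,
      Real.lt_toNNReal_iff_coe_lt, Real.toNNReal_le_iff_le_coe]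
    tauto
  simp_rw [h1]
  rw [h.tsum_measure_inter hlam hC hst hB]
  ring

/-- The claims and their compensator agree on the predictable σ-algebra. -/
lemma IsCompoundPoisson.claimMeasure_trim (h : IsCompoundPoisson P 𝓕 lam Q T Y) (hlam : 0 < lam)
    (hm : 𝓕.predictable.prod (inferInstance : MeasurableSpace ℝ) ≤
      (inferInstance : MeasurableSpace ((ℝ≥0 × Ω) × ℝ))) :
    (claimMeasure P T Y).trim hm =
      (ENNReal.ofReal lam • ((timeMeasure.prod P).prod Q)).trim hm := by
  have := h.isProbabilityMeasure
  set μ := claimMeasure P T Y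
  set ν := ENNReal.ofReal lam • ((timeMeasure.prod P).prod Q) with hν
  -- Truncation in time makes both measures finite, as uniqueness on a π-system requires, and cuts a
  -- generator over (i, ∞) down to one over (i, n], where the two measures were compared. The
  -- truncations then exhaust the space.
  set D : ℕ → Set ((ℝ≥0 × Ω) × ℝ) := fun n => (Iic (n : ℝ≥0) ×ˢ univ) ×ˢ univ with hD
  have hDm : ∀ n, MeasurableSet (D n) := fun n =>
    (measurableSet_Iic.prod MeasurableSet.univ).prod MeasurableSet.univ
  have hDm' : ∀ n, MeasurableSet[𝓕.predictable.prod inferInstance] (D n) := fun n => by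
    have h1 : MeasurableSet[𝓕.predictable] (Ioi (n : ℝ≥0) ×ˢ (univ : Set Ω)) :=
      measurableSet_predictable_Ioi_prod MeasurableSet.univ
    have h2 : Iic (n : ℝ≥0) ×ˢ (univ : Set Ω) = (Ioi (n : ℝ≥0) ×ˢ (univ : Set Ω))ᶜ := by
      ext p; simp
    rw [hD]
    simp only
    rw [h2]
    exact MeasurableSet.prod h1.compl MeasurableSet.univ
  have hrect : ∀ n, ∀ A ∈ image2 (· ×ˢ ·) (predictableRectangles 𝓕) {C : Set ℝ | MeasurableSet C},
      μ (A ∩ D n) = ν (A ∩ D n) := by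
    rintro n _ ⟨_, ⟨B, hB, rfl⟩ | ⟨i, B, hB, rfl⟩, C, hC, rfl⟩
    · have h0 : μ ((({⊥} : Set ℝ≥0) ×ˢ B) ×ˢ C) = 0 := h.claimMeasure_zero (𝓕.le _ _ hB) hC
      have h1 : ν ((({⊥} : Set ℝ≥0) ×ˢ B) ×ˢ C) = 0 := by
        have : timeMeasure {⊥} = 0 := timeMeasure_zero
        rw [hν, Measure.smul_apply, Measure.prod_prod, Measure.prod_prod, this]; simp
      rw [measure_mono_null inter_subset_left h0, measure_mono_null inter_subset_left h1]
    · have : (Ioi i ×ˢ B) ×ˢ C ∩ D n = (Ioc i n ×ˢ B) ×ˢ C := by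
        rw [hD]
        simp only
        rw [prod_inter_prod, prod_inter_prod, Ioi_inter_Iic, inter_univ, inter_univ]
      rw [this]
      exact h.claimMeasure_Ioc hlam i n hB hC
  have hgen : 𝓕.predictable.prod (inferInstance : MeasurableSpace ℝ) = MeasurableSpace.generateFrom
      (image2 (· ×ˢ ·) (predictableRectangles 𝓕) {C : Set ℝ | MeasurableSet C}) :=
    (@generateFrom_eq_prod _ _ 𝓕.predictable _ _ _ rfl MeasurableSpace.generateFrom_measurableSet
      isCountablySpanning_predictableRectangles isCountablySpanning_measurableSet).symm
  have hpi : IsPiSystem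
      (image2 (· ×ˢ ·) (predictableRectangles 𝓕) {C : Set ℝ | MeasurableSet C}) :=
    isPiSystem_predictableRectangles.prod MeasurableSpace.isPiSystem_measurableSet
  have hu : (univ : Set ℝ) ∈ {C : Set ℝ | MeasurableSet C} := by simp
  have huniv : ∀ n, μ (D n) = ν (D n) := fun n => by
    have hU : D n = (({⊥} ×ˢ univ) ×ˢ univ) ∩ D n ∪ ((Ioi 0 ×ˢ univ) ×ˢ univ) ∩ D n := by
      ext ⟨⟨s, ω⟩, y⟩
      rcases eq_or_lt_of_le (zero_le (a := s)) with h | h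
      · simp [hD, ← h]
      · simp [hD, h]
    have hdisj : Disjoint (((({⊥} : Set ℝ≥0) ×ˢ (univ : Set Ω)) ×ˢ (univ : Set ℝ)) ∩ D n)
        (((Ioi 0 ×ˢ univ) ×ˢ univ) ∩ D n) := by
      refine Disjoint.mono inter_subset_left inter_subset_left (disjoint_left.2 ?_)
      rintro ⟨⟨s, ω⟩, y⟩ ⟨⟨h1, -⟩, -⟩ ⟨⟨h2, -⟩, -⟩
      exact absurd h1 (ne_of_gt h2)
    have hm2 : MeasurableSet ((((Ioi (0 : ℝ≥0)) ×ˢ (univ : Set Ω)) ×ˢ (univ : Set ℝ)) ∩ D n) :=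
      ((measurableSet_Ioi.prod MeasurableSet.univ).prod MeasurableSet.univ).inter (hDm n)
    rw [hU, measure_union hdisj hm2, measure_union hdisj hm2,
      hrect n _ ⟨_, Or.inl ⟨univ, MeasurableSet.univ, rfl⟩, univ, hu, rfl⟩,
      hrect n _ ⟨_, Or.inr ⟨0, univ, MeasurableSet.univ, rfl⟩, univ, hu, rfl⟩]
  have hνfin : ∀ n, ν (D n) < ⊤ := fun n => by
    have h1 : timeMeasure (Iic (n : ℝ≥0)) < ⊤ := by
      have h2 : Iic (n : ℝ≥0) ⊆ {0} ∪ Ioc 0 (n : ℝ≥0) := fun x hx => by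
        rcases eq_or_lt_of_le (zero_le (a := x)) with h | h
        · exact Or.inl h.symm
        · exact Or.inr ⟨h, hx⟩
      refine (measure_mono h2).trans_lt ((measure_union_le _ _).trans_lt ?_)
      rw [timeMeasure_zero, timeMeasure_Ioc, zero_add]
      exact ENNReal.ofReal_lt_top
    rw [hν, hD, Measure.smul_apply, Measure.prod_prod, Measure.prod_prod, measure_univ,
      measure_univ, mul_one, mul_one, smul_eq_mul]
    exact ENNReal.mul_lt_top ENNReal.ofReal_lt_top h1
  have hkey : ∀ n, (μ.restrict (D n)).trim hm = (ν.restrict (D n)).trim hm := fun n => by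
    have hfin : @IsFiniteMeasure _ (𝓕.predictable.prod inferInstance)
        ((μ.restrict (D n)).trim hm) := by
      refine @IsFiniteMeasure.mk _ (_) _ ?_
      rw [trim_measurableSet_eq hm MeasurableSet.univ, Measure.restrict_apply_univ, huniv]
      exact hνfin n
    refine @ext_of_generate_finite _ (𝓕.predictable.prod inferInstance) _ _ _ hgen hpi hfin ?_ ?_
    · intro A hA
      have hAm : MeasurableSet[𝓕.predictable.prod inferInstance] A := by
        rw [hgen]; exact MeasurableSpace.measurableSet_generateFrom hA
      rw [trim_measurableSet_eq hm hAm, trim_measurableSet_eq hm hAm,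
        Measure.restrict_apply (hm _ hAm), Measure.restrict_apply (hm _ hAm)]
      exact hrect n A hA
    · rw [trim_measurableSet_eq hm MeasurableSet.univ, trim_measurableSet_eq hm MeasurableSet.univ,
        Measure.restrict_apply_univ, Measure.restrict_apply_univ, huniv]
  refine @Measure.ext _ (_) _ _ fun A hA => ?_
  rw [trim_measurableSet_eq hm hA, trim_measurableSet_eq hm hA]
  have hmono : Monotone fun n => A ∩ D n := fun a b hab =>
    inter_subset_inter_right _ (prod_mono (prod_mono (Iic_subset_Iic.2 (by exact_mod_cast hab))
      le_rfl) le_rfl)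
  have hcup : A = ⋃ n, A ∩ D n := by
    rw [← inter_iUnion, inter_eq_left.2]
    intro p _
    obtain ⟨n, hn⟩ := exists_nat_ge p.1.1
    exact mem_iUnion.2 ⟨n, ⟨⟨hn, mem_univ _⟩, mem_univ _⟩⟩
  rw [hcup, hmono.measure_iUnion, hmono.measure_iUnion]
  refine iSup_congr fun n => ?_
  have h3 := congrArg (fun ρ => @DFunLike.coe _ _ _ (@Measure.instFunLike _ (_)) ρ A) (hkey n)
  rw [trim_measurableSet_eq hm hA, trim_measurableSet_eq hm hA,
    Measure.restrict_apply (hm _ hA), Measure.restrict_apply (hm _ hA)] at h3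
  exact h3

/-- The compensation formula for the claims. -/
theorem IsCompoundPoisson.tsum_lintegral_claims (h : IsCompoundPoisson P 𝓕 lam Q T Y)
    (hlam : 0 < lam) {F : (ℝ≥0 × Ω) × ℝ → ℝ≥0∞}
    (hF : Measurable[𝓕.predictable.prod inferInstance] F) :
    ∑' i, ∫⁻ ω, F (((T (i + 1) ω).toNNReal, ω), Y i ω) ∂P =
      ENNReal.ofReal lam *
        ∫⁻ ω, ∫⁻ s in Ioi (0 : ℝ), (∫⁻ y, F ((s.toNNReal, ω), y) ∂Q) ∂volume ∂P := by
  have := h.isProbabilityMeasure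
  have hm : 𝓕.predictable.prod (inferInstance : MeasurableSpace ℝ) ≤
      (inferInstance : MeasurableSpace ((ℝ≥0 × Ω) × ℝ)) :=
    sup_le_sup (MeasurableSpace.comap_mono predictable_le) le_rfl
  have hF' : Measurable F := hF.mono hm le_rfl
  rw [← h.lintegral_claimMeasure hF', ← lintegral_trim hm hF, h.claimMeasure_trim hlam hm,
    lintegral_trim hm hF, lintegral_smul_measure, lintegral_prod _ hF'.aemeasurable,
    lintegral_prod_symm _ hF'.lintegral_prod_right'.aemeasurable, smul_eq_mul]
  congr 1
  refine lintegral_congr fun ω => ?_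
  exact lintegral_timeMeasure (hF'.lintegral_prod_right'.comp (measurable_id.prodMk measurable_const))

end CompensationFormula

/-! ### Verification between two claims -/

section Interval

variable {g : ℝ → ℝ} {lam δ u₀ : ℝ} {Q : Measure ℝ} {W w : ℝ → ℝ}

/-- The left side is affine in p, so the ends p = 0 and p = u₀ suffice; there the inequality says
that `w z` is below each argument of the minimum. -/
lemma IsHJBSolution.hamiltonian_le (hW : IsHJBSolution g lam δ u₀ Q W w) (hu₀ : 0 < u₀) {z p : ℝ}
    (hz : 0 ≤ z) (hg : u₀ < g z) (hp : p ∈ Icc 0 u₀) :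
    (g z - p) * w z + p ≤ (lam + δ) * W z - lam * claimMean Q W z := by
  set R := (lam + δ) * W z - lam * claimMean Q W z
  have h1 : w z ≤ R / g z := (hW.equation z hz).trans_le (min_le_left _ _)
  have h2 : w z ≤ (R - u₀) / (g z - u₀) := (hW.equation z hz).trans_le (min_le_right _ _)
  rw [le_div_iff₀ (by linarith)] at h1 h2
  nlinarith [mul_nonneg hp.1 (sub_nonneg.2 h2), mul_nonneg (sub_nonneg.2 hp.2) (sub_nonneg.2 h1)]

/-- Which argument of the minimum is smaller depends only on the sign of R - g, and so does whether
the slope exceeds 1. The prescribed p therefore selects the branch that attains the minimum. -/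
lemma IsHJBSolution.hamiltonian_eq (hW : IsHJBSolution g lam δ u₀ Q W w) (hu₀ : 0 < u₀) {z p : ℝ}
    (hz : 0 ≤ z) (hg : u₀ < g z) (hp : (1 < w z → p = 0) ∧ (w z ≤ 1 → p = u₀)) :
    (g z - p) * w z + p = (lam + δ) * W z - lam * claimMean Q W z := by
  have heq := hW.equation z hz
  set R := (lam + δ) * W z - lam * claimMean Q W z
  have hg0 : 0 < g z := by linarith
  have hg1 : 0 < g z - u₀ := by linarith
  rcases lt_or_ge 1 (w z) with h | h
  · rw [hp.1 h]
    have hlt : 1 < (R - u₀) / (g z - u₀) := h.trans_le (heq.trans_le (min_le_right _ _))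
    rw [lt_div_iff₀ hg1] at hlt
    have : R / g z ≤ (R - u₀) / (g z - u₀) := by
      rw [div_le_div_iff₀ hg0 hg1]; nlinarith
    rw [min_eq_left this] at heq
    rw [heq, sub_zero, add_zero, mul_div_cancel₀ _ hg0.ne']
  · rw [hp.2 h]
    have : (R - u₀) / (g z - u₀) ≤ R / g z := by
      rw [heq, min_le_iff] at h
      have hR : R ≤ g z := by
        rcases h with h | h
        · rwa [div_le_one hg0] at h
        · rw [div_le_one hg1] at h; linarith
      rw [div_le_div_iff₀ hg1 hg0]; nlinarith
    rw [min_eq_right this] at heq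
    rw [heq, mul_div_cancel₀ _ hg1.ne']
    ring

lemma countable_atoms (Q : Measure ℝ) [IsProbabilityMeasure Q] : {z : ℝ | Q {z} ≠ 0}.Countable := by
  have := Measure.countable_meas_level_set_pos (μ := Q) (g := fun z : ℝ => z) measurable_id
  refine this.mono fun z hz => ?_
  exact pos_iff_ne_zero.2 hz

/-- The value process between two claims: an upper bound for every dividend rate, which is attained
by the feedback rule. -/
lemma IsHJBSolution.interval [IsProbabilityMeasure Q] (hW : IsHJBSolution g lam δ u₀ Q W w)
    (hlam : 0 < lam) (hu₀ : 0 < u₀) (hgc : ContinuousOn g (Ici 0)) (hgu : ∀ x, 0 ≤ x → u₀ < g x)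
    {a b : ℝ} (hab : a < b) {L u : ℝ → ℝ} (hum : Measurable u) (hu : ∀ s, u s ∈ Icc 0 u₀)
    (hL0 : ∀ s ∈ Icc a b, 0 ≤ L s)
    (hint : IntervalIntegrable (fun s => g (L s) - u s) volume a b)
    (hL : ∀ t ∈ Icc a b, L t = L a + ∫ s in a..t, (g (L s) - u s)) :
    (ENNReal.ofReal (Real.exp (-δ * b) * W (L b)) +
        ∫⁻ s in Ioc a b, ENNReal.ofReal (Real.exp (-δ * s) * (lam * claimMean Q W (L s) + u s)) ≤
      ENNReal.ofReal (Real.exp (-δ * a) * W (L a)) +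
        ∫⁻ s in Ioc a b, ENNReal.ofReal (Real.exp (-δ * s) * (lam * W (L s)))) ∧
    ((∀ s ∈ Ioo a b, (1 < w (L s) → u s = 0) ∧ (w (L s) ≤ 1 → u s = u₀)) →
      ENNReal.ofReal (Real.exp (-δ * b) * W (L b)) +
        ∫⁻ s in Ioc a b, ENNReal.ofReal (Real.exp (-δ * s) * (lam * claimMean Q W (L s) + u s)) =
      ENNReal.ofReal (Real.exp (-δ * a) * W (L a)) +
        ∫⁻ s in Ioc a b, ENNReal.ofReal (Real.exp (-δ * s) * (lam * W (L s)))) := by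
  have huIcc : uIcc a b = Icc a b := uIcc_of_le hab.le
  have haI : a ∈ Icc a b := ⟨le_rfl, hab.le⟩
  have hLc : ContinuousOn L (Icc a b) := by
    have h1 := intervalIntegral.continuousOn_primitive_interval' hint (left_mem_uIcc)
    rw [huIcc] at h1
    exact (continuousOn_const.add h1).congr hL
  have hsub : ∀ s ∈ Icc a b, ∀ t ∈ Icc a b,
      IntervalIntegrable (fun s => g (L s) - u s) volume s t := fun s hs t ht =>
    hint.mono_set (uIcc_subset_uIcc (huIcc ▸ hs) (huIcc ▸ ht))
  have hdiff : ∀ s ∈ Icc a b, ∀ t ∈ Icc a b, L t - L s = ∫ r in s..t, (g (L r) - u r) := by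
    intro s hs t ht
    rw [hL t ht, hL s hs, add_sub_add_left_eq_sub, intervalIntegral.integral_interval_sub_left
      (hsub a haI t ht) (hsub a haI s hs)]
  -- Income exceeds u₀ and hence every admissible rate, so the path increases between claims.
  have hmono : StrictMonoOn L (Icc a b) := by
    intro s hs t ht hst
    rw [← sub_pos, hdiff s hs t ht]
    refine intervalIntegral.intervalIntegral_pos_of_pos_on (hsub s hs t ht) (fun r hr => ?_) hst
    have hr' : r ∈ Icc a b := ⟨hs.1.trans hr.1.le, hr.2.le.trans ht.2⟩
    linarith [(hu r).2, hgu (L r) (hL0 r hr')]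
  set R := L b with hR
  have hmaps : MapsTo L (Icc a b) (Icc 0 R) := fun s hs =>
    ⟨hL0 s hs, hmono.monotoneOn hs ⟨hab.le, le_rfl⟩ hs.2⟩
  have hR0 : 0 ≤ R := hL0 b ⟨hab.le, le_rfl⟩
  obtain ⟨Cg, hCg⟩ := (isCompact_Icc (a := (0 : ℝ)) (b := R)).exists_bound_of_continuousOn
    (hgc.mono Icc_subset_Ici_self)
  have hLlip : LipschitzOnWith (Real.toNNReal (Cg + u₀)) L (Icc a b) := by
    have hC0 : 0 ≤ Cg + u₀ :=
      add_nonneg ((norm_nonneg _).trans (hCg 0 ⟨le_rfl, hR0⟩)) hu₀.le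
    refine LipschitzOnWith.of_dist_le_mul fun s hs t ht => ?_
    rw [Real.coe_toNNReal _ hC0, dist_comm, Real.dist_eq, hdiff s hs t ht, dist_comm, Real.dist_eq,
      ← Real.norm_eq_abs]
    refine intervalIntegral.norm_integral_le_of_norm_le_const fun r hr => ?_
    have hr' : r ∈ Icc a b := by
      have := uIcc_subset_uIcc (huIcc ▸ hs) (huIcc ▸ ht) (uIoc_subset_uIcc hr)
      rwa [huIcc] at this
    refine (norm_sub_le _ _).trans (add_le_add (hCg _ (hmaps hr')) ?_)
    rw [Real.norm_of_nonneg (hu r).1]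
    exact (hu r).2
  obtain ⟨CW, hCW⟩ := hW.lipschitz R hR0
  -- `W` need not be differentiable at the atoms of `Q`; Lipschitz continuity still gives the
  -- fundamental theorem for the composite.
  have hAC1 : AbsolutelyContinuousOnInterval (fun s => W (L s)) a b :=
    LipschitzOnWith.absolutelyContinuousOnInterval (huIcc ▸ hCW.comp hLlip hmaps)
  have hAC2 : AbsolutelyContinuousOnInterval (fun s => Real.exp (-δ * s)) a b :=
    ContDiffOn.absolutelyContinuousOnInterval (by fun_prop)
  have hAC := hAC2.fun_mul hAC1
  have hFTC := hAC.integral_deriv_eq_sub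
  have hLm : AEMeasurable L (volume.restrict (Ioc a b)) :=
    (hLc.mono Ioc_subset_Icc_self).aemeasurable measurableSet_Ioc
  have hMm : Measurable (claimMean Q W) := measurable_claimMean hW.measurable
  have hM0 : ∀ z, 0 ≤ claimMean Q W z := claimMean_nonneg hW.nonneg
  have hMB : ∀ z, claimMean Q W z ≤ u₀ / δ := claimMean_le hW.measurable hW.nonneg hW.le_bound
  have hbdd : ∀ φ : ℝ → ℝ, ∀ C, AEMeasurable φ (volume.restrict (Ioc a b)) →
      (∀ s, ‖φ s‖ ≤ C) → IntervalIntegrable (fun s => Real.exp (-δ * s) * φ s) volume a b := by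
    intro φ C hφ hC
    have h1 : IntervalIntegrable φ volume a b := by
      rw [intervalIntegrable_iff_integrableOn_Ioc_of_le hab.le]
      exact Integrable.of_bound hφ.aestronglyMeasurable C (Eventually.of_forall hC)
    exact h1.continuousOn_mul (Continuous.continuousOn (by fun_prop))
  have hi1 : IntervalIntegrable
      (fun s => Real.exp (-δ * s) * (lam * claimMean Q W (L s) + u s)) volume a b := by
    refine hbdd (fun s => lam * claimMean Q W (L s) + u s) (lam * (u₀ / δ) + u₀)
      (((hMm.comp_aemeasurable hLm).const_mul lam).add hum.aemeasurable) fun s => ?_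
    rw [Real.norm_of_nonneg (add_nonneg (mul_nonneg hlam.le (hM0 _)) (hu s).1)]
    exact add_le_add (mul_le_mul_of_nonneg_left (hMB _) hlam.le) (hu s).2
  have hi2 : IntervalIntegrable (fun s => Real.exp (-δ * s) * (lam * W (L s))) volume a b := by
    refine hbdd (fun s => lam * W (L s)) (lam * (u₀ / δ))
      ((hW.measurable.comp_aemeasurable hLm).const_mul lam) fun s => ?_
    rw [Real.norm_of_nonneg (mul_nonneg hlam.le (hW.nonneg _))]
    exact mul_le_mul_of_nonneg_left (hW.le_bound _) hlam.le
  have hderiv : ∀ᵐ s, s ∈ Ioo a b → deriv (fun s => Real.exp (-δ * s) * W (L s)) s =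
      Real.exp (-δ * s) * (w (L s) * (g (L s) - u s) - δ * W (L s)) := by
    -- An injective path meets the countably many atoms of `Q` at countably many times, so the chain
    -- rule holds almost everywhere.
    have hcount : {s | s ∈ Icc a b ∧ Q {L s} ≠ 0}.Countable :=
      MapsTo.countable_of_injOn (f := L) (t := {z | Q {z} ≠ 0}) (fun s hs => hs.2)
        (hmono.injOn.mono fun s hs => hs.1) (countable_atoms Q)
    filter_upwards [hint.ae_hasDerivAt_integral, hcount.ae_notMem volume] with s hs1 hs2 hs
    have hsI : s ∈ Icc a b := Ioo_subset_Icc_self hs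
    have hQ : Q {L s} = 0 := by
      by_contra hcon
      exact hs2 ⟨hsI, hcon⟩
    have hLpos : 0 < L s := (hL0 a haI).trans_lt (hmono haI hsI hs.1)
    have hLd : HasDerivAt L (g (L s) - u s) s := by
      refine ((hs1 (huIcc ▸ hsI) a left_mem_uIcc).const_add (L a)).congr_of_eventuallyEq ?_
      filter_upwards [Icc_mem_nhds hs.1 hs.2] with r hr using hL r hr
    have h3 := (hW.hasDerivAt (L s) hLpos hQ).comp s hLd
    have h4 : HasDerivAt (fun s => Real.exp (-δ * s)) (Real.exp (-δ * s) * (-δ * 1)) s :=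
      ((hasDerivAt_id s).const_mul (-δ)).exp
    have h5 := (h4.mul h3).deriv
    refine h5.trans ?_
    simp only [Function.comp_apply]
    ring
  have hae : ∀ᵐ s : ℝ, s ≠ a ∧ s ≠ b := by
    have h₁ : ∀ᵐ s : ℝ, s ≠ a := by simp [ae_iff]
    have h₂ : ∀ᵐ s : ℝ, s ≠ b := by simp [ae_iff]
    exact h₁.and h₂
  have hdint := hAC.intervalIntegrable_deriv
  have hint2 := hi2.sub hi1
  set I1 := ∫ s in a..b, Real.exp (-δ * s) * (lam * claimMean Q W (L s) + u s)
  set I2 := ∫ s in a..b, Real.exp (-δ * s) * (lam * W (L s))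
  have hI12 : ∫ s in a..b, (Real.exp (-δ * s) * (lam * W (L s)) -
      Real.exp (-δ * s) * (lam * claimMean Q W (L s) + u s)) = I2 - I1 :=
    intervalIntegral.integral_sub hi2 hi1
  have he0 : ∀ s, 0 ≤ Real.exp (-δ * s) := fun s => (Real.exp_pos _).le
  have hn1 : ∀ s, 0 ≤ Real.exp (-δ * s) * (lam * claimMean Q W (L s) + u s) := fun s =>
    mul_nonneg (he0 s) (add_nonneg (mul_nonneg hlam.le (hM0 _)) (hu s).1)
  have hn2 : ∀ s, 0 ≤ Real.exp (-δ * s) * (lam * W (L s)) := fun s =>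
    mul_nonneg (he0 s) (mul_nonneg hlam.le (hW.nonneg _))
  have hnI1 : 0 ≤ I1 := intervalIntegral.integral_nonneg hab.le fun s _ => hn1 s
  have hnI2 : 0 ≤ I2 := intervalIntegral.integral_nonneg hab.le fun s _ => hn2 s
  have hL1 : ∫⁻ s in Ioc a b, ENNReal.ofReal
      (Real.exp (-δ * s) * (lam * claimMean Q W (L s) + u s)) = ENNReal.ofReal I1 := by
    rw [← ofReal_integral_eq_lintegral_ofReal
      ((intervalIntegrable_iff_integrableOn_Ioc_of_le hab.le).1 hi1) (Eventually.of_forall hn1),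
      ← intervalIntegral.integral_of_le hab.le]
  have hL2 : ∫⁻ s in Ioc a b, ENNReal.ofReal (Real.exp (-δ * s) * (lam * W (L s))) =
      ENNReal.ofReal I2 := by
    rw [← ofReal_integral_eq_lintegral_ofReal
      ((intervalIntegrable_iff_integrableOn_Ioc_of_le hab.le).1 hi2) (Eventually.of_forall hn2),
      ← intervalIntegral.integral_of_le hab.le]
  have hWb : 0 ≤ Real.exp (-δ * b) * W R := mul_nonneg (he0 b) (hW.nonneg _)
  have hWa : 0 ≤ Real.exp (-δ * a) * W (L a) := mul_nonneg (he0 a) (hW.nonneg _)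
  rw [hL1, hL2, ← ENNReal.ofReal_add hWb hnI1, ← ENNReal.ofReal_add hWa hnI2]
  constructor
  · refine ENNReal.ofReal_le_ofReal ?_
    have hle : ∫ s in a..b, deriv (fun s => Real.exp (-δ * s) * W (L s)) s ≤ I2 - I1 := by
      rw [← hI12]
      refine intervalIntegral.integral_mono_ae_restrict hab.le hdint hint2 ?_
      refine (ae_restrict_iff' measurableSet_Icc).2 ?_
      filter_upwards [hderiv, hae] with s hs hs' hsI
      have hsI' : s ∈ Ioo a b := ⟨lt_of_le_of_ne hsI.1 hs'.1.symm, lt_of_le_of_ne hsI.2 hs'.2⟩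
      rw [hs hsI', ← mul_sub]
      refine mul_le_mul_of_nonneg_left ?_ (he0 s)
      have := hW.hamiltonian_le hu₀ (hL0 s hsI) (hgu _ (hL0 s hsI)) (hu s)
      linarith
    rw [hFTC] at hle
    linarith
  · intro hfb
    congr 1
    have heq : ∫ s in a..b, deriv (fun s => Real.exp (-δ * s) * W (L s)) s = I2 - I1 := by
      rw [← hI12]
      refine intervalIntegral.integral_congr_ae ?_
      filter_upwards [hderiv, hae] with s hs hs' hsI
      rw [uIoc_of_le hab.le] at hsI
      have hsI' : s ∈ Ioo a b := ⟨hsI.1, lt_of_le_of_ne hsI.2 hs'.2⟩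
      have hsI2 : s ∈ Icc a b := Ioo_subset_Icc_self hsI'
      rw [hs hsI', ← mul_sub]
      have := hW.hamiltonian_eq hu₀ (hL0 s hsI2) (hgu _ (hL0 s hsI2)) (hfb s hsI')
      linear_combination (Real.exp (-δ * s)) * this
    rw [hFTC] at heq
    linarith

end Interval

/-! ### The paths of a surplus process -/

section PathProperties

variable {Ω : Type*} {T Y : ℕ → Ω → ℝ} {g : ℝ → ℝ} {u₀ x : ℝ} {u X : ℝ≥0 → Ω → ℝ}

lemma nonneg_of_lt_ruinTime {ω : Ω} {t : ℝ≥0} (ht : (t : ℝ≥0∞) < ruinTime X ω) : 0 ≤ X t ω := by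
  by_contra hcon
  exact absurd ht (not_lt.2 (sInf_le ⟨t, not_le.1 hcon, rfl⟩))

/-- The properties of the path of a surplus process in a scenario outside an exceptional set. -/
structure IsSurplusPath (T Y : ℕ → Ω → ℝ) (g : ℝ → ℝ) (u₀ x : ℝ) (u X : ℝ≥0 → Ω → ℝ)
    (ω : Ω) : Prop where
  equation : ∀ t : ℝ≥0, (t : ℝ≥0∞) ≤ ruinTime X ω →
    IntervalIntegrable (fun s : ℝ => g (X s.toNNReal ω)) volume 0 t ∧
    X t ω = x + (∫ s in (0 : ℝ)..t, g (X s.toNNReal ω)) - aggregateClaims T Y t ω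
      - ∫ s in (0 : ℝ)..t, u s.toNNReal ω
  neg_at_ruin : ∀ t : ℝ≥0, ruinTime X ω = t → X t ω < 0
  measurable_rate : Measurable fun s : ℝ => u s.toNNReal ω
  rate_mem : ∀ t, u t ω ∈ Icc 0 u₀

lemma IsSurplusPath.intervalIntegrable_rate {ω : Ω} (hp : IsSurplusPath T Y g u₀ x u X ω)
    (a b : ℝ) : IntervalIntegrable (fun s : ℝ => u s.toNNReal ω) volume a b := by
  refine (intervalIntegrable_const (c := u₀)).mono_fun hp.measurable_rate.aestronglyMeasurable
    (Eventually.of_forall fun s => ?_)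
  have h1 := hp.rate_mem s.toNNReal
  simp only
  rw [Real.norm_of_nonneg h1.1]
  exact h1.2.trans (le_abs_self _)

end PathProperties

section Paths

variable {Ω : Type*} [MeasurableSpace Ω] {P : Measure Ω}
  {𝓕 : Filtration ℝ≥0 (inferInstance : MeasurableSpace Ω)} {lam : ℝ} {Q : Measure ℝ}
  {T Y : ℕ → Ω → ℝ} {g : ℝ → ℝ} {u₀ x : ℝ} {u X : ℝ≥0 → Ω → ℝ}

lemma IsAdmissible.ae_isSurplusPath (h : IsAdmissible P 𝓕 g T Y u₀ x u X) :
    ∀ᵐ ω ∂P, IsSurplusPath T Y g u₀ x u X ω := by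
  filter_upwards [h.2.equation, h.2.neg_at_ruin] with ω h1 h2
  refine ⟨h1, h2, ?_, fun t => h.1.mem_Icc t ω⟩
  exact (IsProgressive.measurable_uncurry h.1.progressive).comp
    (measurable_real_toNNReal.prodMk measurable_const)

lemma IsSurplusPath.initial (h : IsCompoundPoisson P 𝓕 lam Q T Y) {ω : Ω}
    (hp : IsSurplusPath T Y g u₀ x u X ω) : X 0 ω = x := by
  have := (hp.equation 0 (by simp)).2
  simpa [aggregateClaims, h.claimCount_zero] using this

lemma IsSurplusPath.ruinTime_pos (h : IsCompoundPoisson P 𝓕 lam Q T Y) {ω : Ω} (hx : 0 ≤ x)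
    (hp : IsSurplusPath T Y g u₀ x u X ω) : 0 < ruinTime X ω := by
  rw [pos_iff_ne_zero]
  intro hcon
  have := hp.neg_at_ruin 0 (by simpa using hcon)
  rw [hp.initial h] at this
  exact absurd this (not_lt.2 hx)

lemma coe_toNNReal_lt {t : ℝ} (ht : 0 ≤ t) {s : ℝ≥0} : t.toNNReal < s ↔ t < s := by
  rw [← NNReal.coe_lt_coe, Real.coe_toNNReal t ht]

/-- Between two claims before ruin the path is that of a continuous solution of the equation
without claims, and ruin does not occur before the second claim. -/
lemma IsSurplusPath.segment (h : IsCompoundPoisson P 𝓕 lam Q T Y) {ω : Ω}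
    (hgu : ∀ x, 0 ≤ x → u₀ < g x) (hp : IsSurplusPath T Y g u₀ x u X ω) {i : ℕ}
    (hi : ((T i ω).toNNReal : ℝ≥0∞) < ruinTime X ω) :
    ((T (i + 1) ω).toNNReal : ℝ≥0∞) ≤ ruinTime X ω ∧ ∃ L : ℝ → ℝ,
      L (T i ω) = X (T i ω).toNNReal ω ∧
      (∀ s ∈ Icc (T i ω) (T (i + 1) ω), 0 ≤ L s) ∧
      IntervalIntegrable (fun s : ℝ => g (L s) - u s.toNNReal ω) volume (T i ω) (T (i + 1) ω) ∧
      (∀ t ∈ Icc (T i ω) (T (i + 1) ω),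
        L t = L (T i ω) + ∫ s in (T i ω)..t, (g (L s) - u s.toNNReal ω)) ∧
      (∀ t ∈ Ico (T i ω) (T (i + 1) ω), X t.toNNReal ω = L t) ∧
      X (T (i + 1) ω).toNNReal ω = L (T (i + 1) ω) - Y i ω ∧
      ∀ s ∈ Ioc (T i ω) (T (i + 1) ω), leftLimit X (s.toNNReal, ω) = L s := by
  set a := T i ω with ha
  set b := T (i + 1) ω with hb
  have ha0 : 0 ≤ a := h.epoch_nonneg i ω
  have hb0 : 0 ≤ b := h.epoch_nonneg (i + 1) ω
  have hab : a < b := h.epoch_strictMono ω (Nat.lt_succ_self i)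
  have hXa : 0 ≤ X a.toNNReal ω := nonneg_of_lt_ruinTime hi
  have hAa : aggregateClaims T Y a.toNNReal ω = ∑ j ∈ Finset.range i, Y j ω :=
    h.aggregateClaims_eq (by rw [Real.coe_toNNReal a ha0]) (by rwa [Real.coe_toNNReal a ha0])
  have hEa := hp.equation a.toNNReal hi.le
  rw [Real.coe_toNNReal a ha0] at hEa
  have hpos : ∀ s : ℝ≥0, (s : ℝ≥0∞) < ruinTime X ω → 0 ≤ g (X s ω) - u s ω := fun s hs => by
    linarith [hgu _ (nonneg_of_lt_ruinTime hs), (hp.rate_mem s).2]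
  have hincr : ∀ t, a ≤ t → (t.toNNReal : ℝ≥0∞) ≤ ruinTime X ω →
      IntervalIntegrable (fun s : ℝ => g (X s.toNNReal ω) - u s.toNNReal ω) volume a t ∧
      X t.toNNReal ω = X a.toNNReal ω + (∫ s in a..t, (g (X s.toNNReal ω) - u s.toNNReal ω)) -
        (aggregateClaims T Y t.toNNReal ω - ∑ j ∈ Finset.range i, Y j ω) := by
    intro t hat ht
    have ht0 : 0 ≤ t := ha0.trans hat
    have hEt := hp.equation t.toNNReal ht
    rw [Real.coe_toNNReal t ht0] at hEt
    have hgi : IntervalIntegrable (fun s : ℝ => g (X s.toNNReal ω)) volume a t :=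
      hEa.1.symm.trans hEt.1
    refine ⟨hgi.sub (hp.intervalIntegrable_rate a t), ?_⟩
    rw [intervalIntegral.integral_sub hgi (hp.intervalIntegrable_rate a t), hEt.2, hEa.2, hAa,
      ← intervalIntegral.integral_interval_sub_left hEt.1 hEa.1,
      ← intervalIntegral.integral_interval_sub_left (hp.intervalIntegrable_rate 0 t)
        (hp.intervalIntegrable_rate 0 a)]
    ring
  have hnonneg : ∀ t, a ≤ t → (t.toNNReal : ℝ≥0∞) ≤ ruinTime X ω →
      0 ≤ ∫ s in a..t, (g (X s.toNNReal ω) - u s.toNNReal ω) := by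
    intro t hat ht
    rw [intervalIntegral.integral_of_le hat, integral_Ioc_eq_integral_Ioo]
    refine setIntegral_nonneg measurableSet_Ioo fun s hs => hpos _ (lt_of_lt_of_le ?_ ht)
    exact_mod_cast (Real.toNNReal_lt_toNNReal_iff (ha0.trans_lt (hs.1.trans hs.2))).2 hs.2
  -- Without a claim the surplus cannot fall below its nonnegative value at `a`, whereas it would
  -- have to be negative at an earlier ruin time.
  have hbτ : (b.toNNReal : ℝ≥0∞) ≤ ruinTime X ω := by
    by_contra hcon
    rw [not_le] at hcon
    obtain ⟨t, ht⟩ : ∃ t : ℝ≥0, (t : ℝ≥0∞) = ruinTime X ω :=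
      ⟨_, ENNReal.coe_toNNReal (ne_top_of_lt hcon)⟩
    rw [← ht, ENNReal.coe_lt_coe] at hcon hi
    have hat : a < t := (coe_toNNReal_lt ha0).1 hi
    have htb : (t : ℝ) < b := Real.lt_toNNReal_iff_coe_lt.1 hcon
    have htt : (t : ℝ).toNNReal = t := Real.toNNReal_coe
    have h1 := (hincr t hat.le (by rw [htt, ht])).2
    have h2 := hnonneg t hat.le (by rw [htt, ht])
    have h3 := hp.neg_at_ruin t ht.symm
    rw [htt, h.aggregateClaims_eq (i := i) hat.le htb, sub_self, sub_zero] at h1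
    linarith
  refine ⟨hbτ, ?_⟩
  have hlt : ∀ t ∈ Ico a b, (t.toNNReal : ℝ≥0∞) < ruinTime X ω := fun t ht => by
    refine lt_of_lt_of_le ?_ hbτ
    exact_mod_cast (Real.toNNReal_lt_toNNReal_iff (ha0.trans_lt hab)).2 ht.2
  -- The claim-free continuation agrees with `X` before `b`, but is still continuous at `b`, where
  -- `X` jumps by the claim.
  set L : ℝ → ℝ := fun t =>
    X a.toNNReal ω + ∫ s in a..t, (g (X s.toNNReal ω) - u s.toNNReal ω) with hLdef
  have hXL : ∀ t ∈ Ico a b, X t.toNNReal ω = L t := fun t ht => by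
    have ht0 : 0 ≤ t := ha0.trans ht.1
    rw [(hincr t ht.1 (hlt t ht).le).2, h.aggregateClaims_eq (i := i), sub_self, sub_zero]
    · rw [Real.coe_toNNReal t ht0]; exact ht.1
    · rw [Real.coe_toNNReal t ht0]; exact ht.2
  have hbint := (hincr b hab.le hbτ).1
  have hLa : L a = X a.toNNReal ω := by simp [hLdef]
  have hLcont : ContinuousOn L (Icc a b) := by
    have h1 := intervalIntegral.continuousOn_primitive_interval' hbint left_mem_uIcc
    rw [uIcc_of_le hab.le] at h1
    exact continuousOn_const.add h1
  have hcongr : ∀ t ∈ Icc a b, ∀ s ∈ uIoo a t,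
      g (X s.toNNReal ω) - u s.toNNReal ω = g (L s) - u s.toNNReal ω := fun t ht s hs => by
    rw [uIoo_of_le ht.1] at hs
    rw [hXL s ⟨hs.1.le, hs.2.trans_le ht.2⟩]
  refine ⟨L, hLa, fun s hs => ?_, ?_, fun t ht => ?_, hXL, ?_, fun s hs => ?_⟩
  · exact add_nonneg hXa (hnonneg s hs.1
      (le_trans (by exact_mod_cast Real.toNNReal_le_toNNReal hs.2) hbτ))
  · exact hbint.congr_uIoo fun s hs => hcongr b ⟨hab.le, le_rfl⟩ s hs
  · rw [hLa, hLdef]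
    simp only
    congr 1
    exact intervalIntegral.integral_congr_uIoo fun s hs => hcongr t ht s hs
  · rw [(hincr b hab.le hbτ).2, h.aggregateClaims_eq (i := i + 1), Finset.sum_range_succ]
    · simp only [hLdef]; ring
    · rw [Real.coe_toNNReal b hb0]
    · rw [Real.coe_toNNReal b hb0]; exact h.epoch_strictMono ω (Nat.lt_succ_self (i + 1))
  · have hs0 : 0 < s := ha0.trans_lt hs.1
    -- The left grid points eventually lie strictly between `a` and `s`, where `X` equals the
    -- continuous `L`.
    refine Tendsto.limsup_eq ?_
    have h1 : Tendsto (fun n => (leftGrid n s.toNNReal : ℝ)) atTop (𝓝 s) := by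
      have := (NNReal.continuous_coe.tendsto _).comp (tendsto_leftGrid s.toNNReal)
      rwa [Real.coe_toNNReal s hs0.le] at this
    have h2 : ∀ᶠ n in atTop, (leftGrid n s.toNNReal : ℝ) ∈ Ioo a s := by
      filter_upwards [h1.eventually (lt_mem_nhds hs.1)] with n hn
      refine ⟨hn, ?_⟩
      exact Real.lt_toNNReal_iff_coe_lt.1 (leftGrid_lt n (Real.toNNReal_pos.2 hs0))
    have h3 : Tendsto (fun n => L (leftGrid n s.toNNReal)) atTop (𝓝 (L s)) :=
      (hLcont s ⟨hs.1.le, hs.2⟩).tendsto.comp (tendsto_nhdsWithin_iff.2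
        ⟨h1, h2.mono fun n hn => ⟨hn.1.le, hn.2.le.trans hs.2⟩⟩)
    refine h3.congr' ?_
    filter_upwards [h2] with n hn
    have := hXL (leftGrid n s.toNNReal) ⟨hn.1.le, hn.2.trans_le hs.2⟩
    rw [Real.toNNReal_coe] at this
    exact this.symm

/-- The times, in a given scenario, up to and including ruin, detected from the past. -/
def aliveSet (T Y : ℕ → Ω → ℝ) (X : ℝ≥0 → Ω → ℝ) : Set (ℝ≥0 × Ω) :=
  {p | ∀ i, T (i + 1) p.2 < p.1 → 0 ≤ leftLimit X ((T (i + 1) p.2).toNNReal, p.2) - Y i p.2}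

/-- Ruin happens only at a claim epoch, and the value there is the left limit minus the claim. The
strict inequality in `aliveSet` keeps the ruin time itself in the set, which allows it to be
predictable. -/
lemma IsSurplusPath.mem_aliveSet_iff (h : IsCompoundPoisson P 𝓕 lam Q T Y) {ω : Ω}
    (hgu : ∀ x, 0 ≤ x → u₀ < g x) (hx : 0 ≤ x) (hp : IsSurplusPath T Y g u₀ x u X ω) (s : ℝ≥0) :
    (s, ω) ∈ aliveSet T Y X ↔ (s : ℝ≥0∞) ≤ ruinTime X ω := by
  have hinc : ∀ i, T i ω < T (i + 1) ω := fun i => h.epoch_strictMono ω (Nat.lt_succ_self i)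
  have hlt : ∀ i, (T i ω).toNNReal < (T (i + 1) ω).toNNReal := fun i =>
    (Real.toNNReal_lt_toNNReal_iff ((h.epoch_nonneg i ω).trans_lt (hinc i))).2 (hinc i)
  constructor
  · intro hs
    by_contra hcon
    rw [not_le] at hcon
    obtain ⟨t, ht⟩ : ∃ t : ℝ≥0, (t : ℝ≥0∞) = ruinTime X ω :=
      ⟨_, ENNReal.coe_toNNReal (ne_top_of_lt hcon)⟩
    have hpos := hp.ruinTime_pos h hx
    -- The first epoch not before the ruin time is the ruin time: ruin cannot precede the next
    -- claim.
    have hex : ∃ n, (t : ℝ) ≤ T n ω := ((h.epoch_tendsto ω).eventually_ge_atTop (t : ℝ)).exists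
    classical
    rcases hn : Nat.find hex with _ | i
    · have h1 := Nat.find_spec hex
      rw [hn, h.epoch_zero] at h1
      rw [← ht] at hpos
      exact absurd h1 (not_le.2 (by exact_mod_cast hpos))
    · have h1 := Nat.find_spec hex
      rw [hn] at h1
      have h2 := Nat.find_min hex (m := i) (by omega)
      rw [not_le] at h2
      have h3 : ((T i ω).toNNReal : ℝ≥0∞) < ruinTime X ω := by
        rw [← ht]; exact_mod_cast (coe_toNNReal_lt (h.epoch_nonneg i ω)).2 h2
      obtain ⟨h4, L, -, -, -, -, -, h5, h6⟩ := hp.segment h hgu h3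
      have h7 : (T (i + 1) ω).toNNReal = t := by
        refine le_antisymm ?_ (NNReal.le_toNNReal_of_coe_le h1)
        rw [← ht] at h4; exact_mod_cast h4
      have h8 := hp.neg_at_ruin (T (i + 1) ω).toNNReal (ht.symm.trans (by rw [h7]))
      have h9 := hs i (by
        rw [← ht] at hcon
        have : (t : ℝ) < s := by exact_mod_cast hcon
        rw [← h7, Real.coe_toNNReal _ (h.epoch_nonneg _ ω)] at this
        exact this)
      simp only at h9
      rw [h6 _ ⟨hinc i, le_rfl⟩] at h9
      rw [h5] at h8
      linarith
  · intro hs i hi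
    simp only at hi ⊢
    have h1 : ((T (i + 1) ω).toNNReal : ℝ≥0∞) < ruinTime X ω := by
      refine lt_of_lt_of_le ?_ hs
      exact_mod_cast (coe_toNNReal_lt (h.epoch_nonneg (i + 1) ω)).2 hi
    obtain ⟨-, L, -, -, -, -, -, h5, h6⟩ := hp.segment h hgu
      (lt_trans (by exact_mod_cast hlt i) h1)
    rw [h6 _ ⟨hinc i, le_rfl⟩, ← h5]
    exact nonneg_of_lt_ruinTime h1

end Paths

/-! ### Epochs and claim sizes as seen by the filtration -/

section Observed

variable {Ω : Type*} [MeasurableSpace Ω] {P : Measure Ω}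
  {𝓕 : Filtration ℝ≥0 (inferInstance : MeasurableSpace Ω)} {lam : ℝ} {Q : Measure ℝ}
  {T Y : ℕ → Ω → ℝ} {X : ℝ≥0 → Ω → ℝ}

lemma IsCompoundPoisson.measurableSet_lt_claimCount (h : IsCompoundPoisson P 𝓕 lam Q T Y) (i : ℕ)
    (t : ℝ≥0) : MeasurableSet[𝓕 t] {ω | i < claimCount T t ω} :=
  (h.adapted_count t) (measurableSet_Ioi (a := i))

/-- The claim epochs are stopping times. -/
lemma IsCompoundPoisson.measurable_epoch_min (h : IsCompoundPoisson P 𝓕 lam Q T Y) (i : ℕ)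
    (t : ℝ≥0) : Measurable[𝓕 t] fun ω => min (T i ω).toNNReal t := by
  refine measurable_of_Iic fun c => ?_
  rcases le_or_gt t c with htc | hct
  · have : (fun ω => min (T i ω).toNNReal t) ⁻¹' Iic c = univ :=
      eq_univ_of_forall fun ω => (min_le_right _ _).trans htc
    rw [this]
    exact MeasurableSet.univ
  · cases i with
    | zero =>
      have : (fun ω => min (T 0 ω).toNNReal t) ⁻¹' Iic c = univ := by
        refine eq_univ_of_forall fun ω => ?_
        simp [h.epoch_zero]
      rw [this]
      exact MeasurableSet.univ
    | succ i =>
      have : (fun ω => min (T (i + 1) ω).toNNReal t) ⁻¹' Iic c = {ω | i < claimCount T c ω} := by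
        ext ω
        simp only [mem_preimage, mem_Iic, min_le_iff, not_le.2 hct, or_false, mem_ofPred_eq,
          Real.toNNReal_le_iff_le_coe]
        exact h.epoch_le_iff i c ω
      rw [this]
      exact 𝓕.mono hct.le _ (h.measurableSet_lt_claimCount i c)

/-- The size of a claim which has occurred before the time `t`, as observed at that time. -/
def observedClaim (T Y : ℕ → Ω → ℝ) (t : ℝ≥0) (i : ℕ) (ω : Ω) : ℝ :=
  aggregateClaims T Y (min (T (i + 1) ω).toNNReal t) ω -
    aggregateClaims T Y (min (T i ω).toNNReal t) ω

/-- Adaptedness is given for the aggregate, not for single claims. The aggregate is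
right-continuous, hence progressive, and may be sampled at the stopped epochs. -/
lemma IsCompoundPoisson.measurable_observedClaim (h : IsCompoundPoisson P 𝓕 lam Q T Y) (t : ℝ≥0)
    (i : ℕ) : Measurable[𝓕 t] (observedClaim T Y t i) := by
  have hp : IsProgressive 𝓕 (aggregateClaims T Y) :=
    isProgressive_of_rightContinuous h.adapted_claims h.aggregateClaims_rightContinuous
  exact (IsProgressive.measurable_sample hp (h.measurable_epoch_min (i + 1) t)
    fun ω => min_le_right _ _).sub
    (IsProgressive.measurable_sample hp (h.measurable_epoch_min i t) fun ω => min_le_right _ _)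

lemma IsCompoundPoisson.aggregateClaims_epoch (h : IsCompoundPoisson P 𝓕 lam Q T Y) (i : ℕ)
    (ω : Ω) : aggregateClaims T Y (T i ω).toNNReal ω = ∑ j ∈ Finset.range i, Y j ω := by
  refine h.aggregateClaims_eq ?_ ?_ <;> rw [Real.coe_toNNReal _ (h.epoch_nonneg i ω)]
  exact h.epoch_strictMono ω (Nat.lt_succ_self i)

lemma IsCompoundPoisson.observedClaim_eq (h : IsCompoundPoisson P 𝓕 lam Q T Y) {t : ℝ≥0}
    {i : ℕ} {ω : Ω} (hi : T (i + 1) ω ≤ t) : observedClaim T Y t i ω = Y i ω := by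
  have h1 : (T (i + 1) ω).toNNReal ≤ t := Real.toNNReal_le_iff_le_coe.2 hi
  have h2 : (T i ω).toNNReal ≤ t := Real.toNNReal_le_iff_le_coe.2
    ((h.epoch_strictMono ω (Nat.lt_succ_self i)).le.trans hi)
  rw [observedClaim, min_eq_left h1, min_eq_left h2, h.aggregateClaims_epoch,
    h.aggregateClaims_epoch, Finset.sum_range_succ]
  ring

/-- A rational q between a ruinous epoch and the present time writes the complement as a countable
union of predictable rectangles (q, ∞) × (event known at q). -/
lemma IsCompoundPoisson.measurableSet_aliveSet (h : IsCompoundPoisson P 𝓕 lam Q T Y)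
    (hX : Adapted 𝓕 X) : MeasurableSet[𝓕.predictable] (aliveSet T Y X) := by
  have hev : ∀ (i : ℕ) (q : ℝ≥0), MeasurableSet[𝓕 q] {ω | T (i + 1) ω ≤ q ∧
      leftLimit X ((T (i + 1) ω).toNNReal, ω) - Y i ω < 0} := by
    intro i q
    have h1 := measurable_predictable_sample (measurable_leftLimit hX)
      (h.measurable_epoch_min (i + 1) q) fun ω => min_le_right _ _
    have h2 := (h1.sub (h.measurable_observedClaim q i)) (measurableSet_Iio (a := 0))
    have h3 := (h.measurableSet_lt_claimCount i q).inter h2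
    have h4 : {ω | T (i + 1) ω ≤ q ∧ leftLimit X ((T (i + 1) ω).toNNReal, ω) - Y i ω < 0} =
        {ω | i < claimCount T q ω} ∩ (fun ω => leftLimit X (min (T (i + 1) ω).toNNReal q, ω) -
          observedClaim T Y q i ω) ⁻¹' Iio 0 := by
      ext ω
      simp only [mem_ofPred_eq, mem_inter_iff, mem_preimage, mem_Iio, ← h.epoch_le_iff i q ω]
      refine and_congr_right fun hle => ?_
      rw [h.observedClaim_eq hle, min_eq_left (Real.toNNReal_le_iff_le_coe.2 hle)]
    rw [h4]
    exact h3
  have hcompl : aliveSet T Y X = (⋃ (i : ℕ) (q : ℚ), Ioi (q : ℝ).toNNReal ×ˢ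
      {ω | T (i + 1) ω ≤ (q : ℝ).toNNReal ∧
        leftLimit X ((T (i + 1) ω).toNNReal, ω) - Y i ω < 0})ᶜ := by
    ext ⟨s, ω⟩
    simp only [aliveSet, mem_ofPred_eq, mem_compl_iff, mem_iUnion, mem_prod, mem_Ioi, not_exists,
      not_and, not_lt]
    constructor
    · intro hs i q hq hT
      refine hs i (hT.trans_lt ?_)
      exact_mod_cast hq
    · intro hs i hi
      obtain ⟨q, hq1, hq2⟩ := exists_rat_btwn hi
      have hq0 : (0 : ℝ) ≤ q := (h.epoch_nonneg _ ω).trans hq1.le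
      exact hs i q ((coe_toNNReal_lt hq0).2 hq2) (by rw [Real.coe_toNNReal _ hq0]; exact hq1.le)
  rw [hcompl]
  exact (MeasurableSet.iUnion fun i => MeasurableSet.iUnion fun q =>
    measurableSet_predictable_Ioi_prod (hev i _)).compl

end Observed

/-! ### Verification along a surplus process -/

section Verification

variable {Ω : Type*} [MeasurableSpace Ω] {P : Measure Ω}
  {𝓕 : Filtration ℝ≥0 (inferInstance : MeasurableSpace Ω)} {lam δ : ℝ} {Q : Measure ℝ}
  {T Y : ℕ → Ω → ℝ} {g W w : ℝ → ℝ} {u₀ x : ℝ} {u X : ℝ≥0 → Ω → ℝ}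

/-- The discounted values of a process up to ruin. -/
def discounted (δ : ℝ) (T Y : ℕ → Ω → ℝ) (X : ℝ≥0 → Ω → ℝ) (f : ℝ≥0 × Ω → ℝ) (p : ℝ≥0 × Ω) :
    ℝ≥0∞ :=
  (aliveSet T Y X).indicator (fun p => ENNReal.ofReal (Real.exp (-δ * p.1) * f p)) p

/-- The value before the next claim, immediately after the `i`-th epoch. -/
def valueAfter (δ : ℝ) (T Y : ℕ → Ω → ℝ) (X : ℝ≥0 → Ω → ℝ) (W : ℝ → ℝ) (x : ℝ) (ω : Ω) : ℕ → ℝ≥0∞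
  | 0 => ENNReal.ofReal (W x)
  | i + 1 => discounted δ T Y X (fun p => W (leftLimit X p - Y i ω)) ((T (i + 1) ω).toNNReal, ω)

lemma IsSurplusPath.valueAfter_eq (h : IsCompoundPoisson P 𝓕 lam Q T Y) {ω : Ω}
    (hgu : ∀ x, 0 ≤ x → u₀ < g x) (hx : 0 ≤ x) (hp : IsSurplusPath T Y g u₀ x u X ω) (i : ℕ)
    (hi : ((T i ω).toNNReal : ℝ≥0∞) ≤ ruinTime X ω) :
    valueAfter δ T Y X W x ω i =
      ENNReal.ofReal (Real.exp (-δ * T i ω) * W (X (T i ω).toNNReal ω)) := by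
  cases i with
  | zero => simp [valueAfter, h.epoch_zero, hp.initial h]
  | succ i =>
    have h0 : T i ω < T (i + 1) ω := h.epoch_strictMono ω (Nat.lt_succ_self i)
    have h1 : ((T i ω).toNNReal : ℝ≥0∞) < ruinTime X ω := by
      refine lt_of_lt_of_le ?_ hi
      exact_mod_cast (Real.toNNReal_lt_toNNReal_iff ((h.epoch_nonneg i ω).trans_lt h0)).2 h0
    obtain ⟨-, L, -, -, -, -, -, h5, h6⟩ := hp.segment h hgu h1
    rw [valueAfter, discounted, indicator_of_mem ((hp.mem_aliveSet_iff h hgu hx _).2 hi),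
      h6 _ ⟨h0, le_rfl⟩, ← h5, Real.coe_toNNReal _ (h.epoch_nonneg _ ω)]

/-- Before ruin this is `IsHJBSolution.interval` along the segment. If ruin occurs at `T i`, the
remaining value vanishes because `W` is zero at negative surplus; after ruin every term is zero. -/
lemma IsSurplusPath.interval [IsProbabilityMeasure Q] (h : IsCompoundPoisson P 𝓕 lam Q T Y) {ω : Ω}
    (hW : IsHJBSolution g lam δ u₀ Q W w) (hlam : 0 < lam) (hu₀ : 0 < u₀)
    (hgc : ContinuousOn g (Ici 0)) (hgu : ∀ x, 0 ≤ x → u₀ < g x) (hx : 0 ≤ x)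
    (hp : IsSurplusPath T Y g u₀ x u X ω) (i : ℕ) :
    (discounted δ T Y X (fun p => W (leftLimit X p)) ((T (i + 1) ω).toNNReal, ω) +
        ∫⁻ s in Ioc (T i ω) (T (i + 1) ω), discounted δ T Y X
          (fun p => lam * claimMean Q W (leftLimit X p) + u p.1 p.2) (s.toNNReal, ω) ≤
      valueAfter δ T Y X W x ω i + ∫⁻ s in Ioc (T i ω) (T (i + 1) ω),
        discounted δ T Y X (fun p => lam * W (leftLimit X p)) (s.toNNReal, ω)) ∧
    ((∀ t : ℝ≥0, (t : ℝ≥0∞) < ruinTime X ω →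
        (1 < w (X t ω) → u t ω = 0) ∧ (w (X t ω) ≤ 1 → u t ω = u₀)) →
      discounted δ T Y X (fun p => W (leftLimit X p)) ((T (i + 1) ω).toNNReal, ω) +
        ∫⁻ s in Ioc (T i ω) (T (i + 1) ω), discounted δ T Y X
          (fun p => lam * claimMean Q W (leftLimit X p) + u p.1 p.2) (s.toNNReal, ω) =
      valueAfter δ T Y X W x ω i + ∫⁻ s in Ioc (T i ω) (T (i + 1) ω),
        discounted δ T Y X (fun p => lam * W (leftLimit X p)) (s.toNNReal, ω)) := by
  have ha0 := h.epoch_nonneg i ω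
  have hab : T i ω < T (i + 1) ω := h.epoch_strictMono ω (Nat.lt_succ_self i)
  have hmem := hp.mem_aliveSet_iff h hgu hx
  rcases lt_or_ge ((T i ω).toNNReal : ℝ≥0∞) (ruinTime X ω) with hi | hi
  · obtain ⟨h1, L, h2, h3, h4, h5, h6, h7, h8⟩ := hp.segment h hgu hi
    have key := hW.interval hlam hu₀ hgc hgu hab hp.measurable_rate (fun s => hp.rate_mem _) h3 h4 h5
    have hD : ∀ f : ℝ≥0 × Ω → ℝ, ∀ s ∈ Ioc (T i ω) (T (i + 1) ω),
        discounted δ T Y X f (s.toNNReal, ω) =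
          ENNReal.ofReal (Real.exp (-δ * s) * f (s.toNNReal, ω)) := fun f s hs => by
      rw [discounted, indicator_of_mem, Real.coe_toNNReal _ (ha0.trans hs.1.le)]
      exact (hmem _).2 (le_trans (by exact_mod_cast Real.toNNReal_le_toNNReal hs.2) h1)
    rw [hp.valueAfter_eq h hgu hx i hi.le, hD _ _ ⟨hab, le_rfl⟩, h8 _ ⟨hab, le_rfl⟩, ← h2,
      setLIntegral_congr_fun measurableSet_Ioc fun s hs =>
        (hD (fun p => lam * claimMean Q W (leftLimit X p) + u p.1 p.2) s hs).trans
          (by simp only; rw [h8 s hs]),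
      setLIntegral_congr_fun measurableSet_Ioc fun s hs =>
        (hD (fun p => lam * W (leftLimit X p)) s hs).trans (by rw [h8 s hs])]
    refine ⟨key.1, fun hf => key.2 fun s hs => ?_⟩
    rw [← h6 s ⟨hs.1.le, hs.2⟩]
    refine hf _ (lt_of_lt_of_le ?_ h1)
    exact_mod_cast (Real.toNNReal_lt_toNNReal_iff (ha0.trans_lt hab)).2 hs.2
  · have hD : ∀ f : ℝ≥0 × Ω → ℝ, ∀ s ∈ Ioc (T i ω) (T (i + 1) ω),
        discounted δ T Y X f (s.toNNReal, ω) = 0 := fun f s hs => by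
      refine indicator_of_notMem (fun hcon => ?_) _
      refine absurd ((hmem _).1 hcon) (not_le.2 (hi.trans_lt ?_))
      exact_mod_cast (Real.toNNReal_lt_toNNReal_iff (ha0.trans_lt hs.1)).2 hs.1
    have hval : valueAfter δ T Y X W x ω i = 0 := by
      rcases eq_or_lt_of_le hi with heq | hlt
      · rw [hp.valueAfter_eq h hgu hx i heq.ge, hW.eq_zero_of_neg _ (hp.neg_at_ruin _ heq)]
        simp
      · cases i with
        | zero => exact absurd hlt (by simp [h.epoch_zero])
        | succ i =>
          rw [valueAfter, discounted,
            indicator_of_notMem fun hcon => absurd ((hmem _).1 hcon) (not_le.2 hlt)]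
    rw [hval, hD _ _ ⟨hab, le_rfl⟩, setLIntegral_congr_fun measurableSet_Ioc (hD _),
      setLIntegral_congr_fun measurableSet_Ioc (hD _)]
    simp

lemma IsCompoundPoisson.lintegral_Ioi_eq_tsum (h : IsCompoundPoisson P 𝓕 lam Q T Y) (ω : Ω)
    (f : ℝ → ℝ≥0∞) :
    ∫⁻ s in Ioi 0, f s = ∑' i, ∫⁻ s in Ioc (T i ω) (T (i + 1) ω), f s := by
  have hdisj := (h.epoch_strictMono ω).monotone.pairwise_disjoint_on_Ioc_succ
  simp only [Nat.succ_eq_succ] at hdisj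
  rw [← lintegral_iUnion (s := fun i => Ioc (T i ω) (T (i + 1) ω)) (fun i => measurableSet_Ioc)
    hdisj]
  congr 2
  ext s
  simp only [mem_Ioi, mem_iUnion, mem_Ioc]
  constructor
  · intro hs
    have hex : ∃ n, s ≤ T n ω := ((h.epoch_tendsto ω).eventually_ge_atTop s).exists
    classical
    rcases hn : Nat.find hex with _ | i
    · have h1 := Nat.find_spec hex
      rw [hn, h.epoch_zero] at h1
      exact absurd h1 (not_le.2 hs)
    · have h1 := Nat.find_spec hex
      rw [hn] at h1
      exact ⟨i, not_le.1 (Nat.find_min hex (m := i) (by omega)), h1⟩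
  · rintro ⟨i, hi, -⟩
    exact (h.epoch_nonneg i ω).trans_lt hi

/-- The interval estimates are added in `ℝ≥0∞`. The values just before and just after the claims
stay on opposite sides; they are compensated only in expectation. -/
lemma IsSurplusPath.value [IsProbabilityMeasure Q] (h : IsCompoundPoisson P 𝓕 lam Q T Y) {ω : Ω}
    (hW : IsHJBSolution g lam δ u₀ Q W w) (hlam : 0 < lam) (hu₀ : 0 < u₀)
    (hgc : ContinuousOn g (Ici 0)) (hgu : ∀ x, 0 ≤ x → u₀ < g x) (hx : 0 ≤ x)
    (hp : IsSurplusPath T Y g u₀ x u X ω) :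
    ((∑' i, discounted δ T Y X (fun p => W (leftLimit X p)) ((T (i + 1) ω).toNNReal, ω)) +
        ∫⁻ s in Ioi (0 : ℝ), discounted δ T Y X
          (fun p => lam * claimMean Q W (leftLimit X p) + u p.1 p.2) (s.toNNReal, ω) ≤
      (ENNReal.ofReal (W x) + ∑' i, discounted δ T Y X (fun p => W (leftLimit X p - Y i ω))
        ((T (i + 1) ω).toNNReal, ω)) +
      ∫⁻ s in Ioi (0 : ℝ), discounted δ T Y X (fun p => lam * W (leftLimit X p)) (s.toNNReal, ω)) ∧
    ((∀ t : ℝ≥0, (t : ℝ≥0∞) < ruinTime X ω →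
        (1 < w (X t ω) → u t ω = 0) ∧ (w (X t ω) ≤ 1 → u t ω = u₀)) →
      (∑' i, discounted δ T Y X (fun p => W (leftLimit X p)) ((T (i + 1) ω).toNNReal, ω)) +
        ∫⁻ s in Ioi (0 : ℝ), discounted δ T Y X
          (fun p => lam * claimMean Q W (leftLimit X p) + u p.1 p.2) (s.toNNReal, ω) =
      (ENNReal.ofReal (W x) + ∑' i, discounted δ T Y X (fun p => W (leftLimit X p - Y i ω))
        ((T (i + 1) ω).toNNReal, ω)) +
      ∫⁻ s in Ioi (0 : ℝ), discounted δ T Y X (fun p => lam * W (leftLimit X p))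
        (s.toNNReal, ω)) := by
  have hval : ∑' i, valueAfter δ T Y X W x ω i = ENNReal.ofReal (W x) +
      ∑' i, discounted δ T Y X (fun p => W (leftLimit X p - Y i ω)) ((T (i + 1) ω).toNNReal, ω) :=
    tsum_eq_zero_add' ENNReal.summable
  rw [h.lintegral_Ioi_eq_tsum ω, h.lintegral_Ioi_eq_tsum ω, ← hval, ← ENNReal.tsum_add,
    ← ENNReal.tsum_add]
  exact ⟨ENNReal.tsum_le_tsum fun i => (hp.interval h hW hlam hu₀ hgc hgu hx i).1,
    fun hf => tsum_congr fun i => (hp.interval h hW hlam hu₀ hgc hgu hx i).2 hf⟩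

/-- The expected total discounted value of a process up to ruin. -/
def expectedDiscounted (P : Measure Ω) (δ : ℝ) (T Y : ℕ → Ω → ℝ) (X : ℝ≥0 → Ω → ℝ)
    (f : ℝ≥0 × Ω → ℝ) : ℝ≥0∞ :=
  ∫⁻ ω, (∫⁻ s in Ioi (0 : ℝ), discounted δ T Y X f (s.toNNReal, ω)) ∂P

lemma measurable_predictable_fst : Measurable[𝓕.predictable] (Prod.fst : ℝ≥0 × Ω → ℝ≥0) := by
  refine measurable_of_Ioi fun c => ?_
  have : (Prod.fst : ℝ≥0 × Ω → ℝ≥0) ⁻¹' Ioi c = Ioi c ×ˢ (univ : Set Ω) := by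
    ext p; simp
  rw [this]
  exact measurableSet_predictable_Ioi_prod MeasurableSet.univ

lemma IsCompoundPoisson.measurable_discounted (h : IsCompoundPoisson P 𝓕 lam Q T Y)
    (hX : Adapted 𝓕 X) {f : ℝ≥0 × Ω → ℝ} (hf : Measurable f) :
    Measurable (discounted δ T Y X f) := by
  refine Measurable.indicator ?_ (predictable_le _ (h.measurableSet_aliveSet hX))
  fun_prop

lemma IsCompoundPoisson.measurable_discounted_path (h : IsCompoundPoisson P 𝓕 lam Q T Y)
    (hX : Adapted 𝓕 X) {f : ℝ≥0 × Ω → ℝ} (hf : Measurable f) :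
    Measurable fun q : Ω × ℝ => discounted δ T Y X f (q.2.toNNReal, q.1) :=
  (h.measurable_discounted hX hf).comp
    ((measurable_real_toNNReal.comp measurable_snd).prodMk measurable_fst)

lemma IsCompoundPoisson.expectedDiscounted_add (h : IsCompoundPoisson P 𝓕 lam Q T Y)
    [IsProbabilityMeasure P]
    (hX : Adapted 𝓕 X) {f k : ℝ≥0 × Ω → ℝ} (hf : Measurable f)
    (hf0 : ∀ p, 0 ≤ f p) (hk0 : ∀ p, 0 ≤ k p) :
    expectedDiscounted P δ T Y X (fun p => f p + k p) =
      expectedDiscounted P δ T Y X f + expectedDiscounted P δ T Y X k := by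
  have hm := h.measurable_discounted_path (δ := δ) hX hf
  have hadd : ∀ p, discounted δ T Y X (fun p => f p + k p) p =
      discounted δ T Y X f p + discounted δ T Y X k p := fun p => by
    by_cases hp : p ∈ aliveSet T Y X
    · simp only [discounted, indicator_of_mem hp, mul_add]
      exact ENNReal.ofReal_add (mul_nonneg (Real.exp_pos _).le (hf0 p))
        (mul_nonneg (Real.exp_pos _).le (hk0 p))
    · simp [discounted, indicator_of_notMem hp]
  simp only [expectedDiscounted, hadd]
  rw [← lintegral_add_left hm.lintegral_prod_right']
  refine lintegral_congr fun ω => ?_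
  exact lintegral_add_left (hm.comp measurable_prodMk_left) _

lemma expectedDiscounted_const_mul {c : ℝ} (hc : 0 ≤ c) (f : ℝ≥0 × Ω → ℝ) :
    expectedDiscounted P δ T Y X (fun p => c * f p) =
      ENNReal.ofReal c * expectedDiscounted P δ T Y X f := by
  have hmul : ∀ p, discounted δ T Y X (fun p => c * f p) p =
      ENNReal.ofReal c * discounted δ T Y X f p := fun p => by
    by_cases hp : p ∈ aliveSet T Y X
    · simp only [discounted, indicator_of_mem hp]
      rw [← ENNReal.ofReal_mul hc]
      congr 1; ring
    · simp [discounted, indicator_of_notMem hp]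
  simp only [expectedDiscounted, hmul]
  simp_rw [lintegral_const_mul' _ _ ENNReal.ofReal_ne_top]

/-- Discounting makes bounded rewards finite, which justifies the final cancellation. -/
lemma expectedDiscounted_ne_top [IsProbabilityMeasure P] (hδ : 0 < δ) {f : ℝ≥0 × Ω → ℝ} {C : ℝ}
    (hf : ∀ p, f p ≤ C) : expectedDiscounted P δ T Y X f ≠ ∞ := by
  have hbound : ∀ ω, ∫⁻ s in Ioi (0 : ℝ), discounted δ T Y X f (s.toNNReal, ω) ≤
      ∫⁻ s in Ioi (0 : ℝ), ENNReal.ofReal (Real.exp (-δ * s) * |C|) := fun ω => by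
    refine setLIntegral_mono' measurableSet_Ioi fun s hs => ?_
    refine (indicator_le_self _ _ _).trans ?_
    rw [Real.coe_toNNReal _ (le_of_lt hs)]
    exact ENNReal.ofReal_le_ofReal (mul_le_mul_of_nonneg_left ((hf _).trans (le_abs_self C))
      (Real.exp_pos _).le)
  refine ne_top_of_le_ne_top ?_ (lintegral_mono hbound)
  rw [lintegral_const, measure_univ, mul_one]
  have := ((exp_neg_integrableOn_Ioi 0 hδ).mul_const |C|).lintegral_lt_top
  exact this.ne

/-- Left limit and survival are predictable, so the compensation formula applies; the integrand
ignores the claim size. -/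
lemma IsCompoundPoisson.compensation_value [IsProbabilityMeasure P]
    (h : IsCompoundPoisson P 𝓕 lam Q T Y) (hlam : 0 < lam) (hX : Adapted 𝓕 X) (hW : Measurable W) :
    ∫⁻ ω, ∑' i, discounted δ T Y X (fun p => W (leftLimit X p)) ((T (i + 1) ω).toNNReal, ω) ∂P =
      expectedDiscounted P δ T Y X (fun p => lam * W (leftLimit X p)) := by
  have := h.isProbabilityMeasure
  have hL := measurable_leftLimit hX
  have hmp : Measurable[𝓕.predictable] (discounted δ T Y X fun p => W (leftLimit X p)) := by
    refine Measurable.indicator ?_ (h.measurableSet_aliveSet hX)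
    refine ENNReal.measurable_ofReal.comp (Measurable.mul ?_ (hW.comp hL))
    exact Real.measurable_exp.comp
      ((measurable_coe_nnreal_real.comp measurable_predictable_fst).const_mul _)
  have key := h.tsum_lintegral_claims hlam
    (F := fun q => discounted δ T Y X (fun p => W (leftLimit X p)) q.1) (hmp.comp measurable_fst)
  simp only [lintegral_const, measure_univ, mul_one] at key
  rw [expectedDiscounted_const_mul hlam.le, expectedDiscounted, ← key, lintegral_tsum]
  intro i
  exact ((hmp.mono predictable_le le_rfl).comp
    ((h.measurable_epoch (i + 1)).real_toNNReal.prodMk measurable_id)).aemeasurable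

/-- Here the predictable integrand does depend on the claim size, and averaging over `Q` produces
`claimMean`. -/
lemma IsCompoundPoisson.compensation_claim [IsProbabilityMeasure P]
    (h : IsCompoundPoisson P 𝓕 lam Q T Y) (hlam : 0 < lam) (hX : Adapted 𝓕 X) (hW : Measurable W)
    (hW0 : ∀ z, 0 ≤ W z) {C : ℝ} (hWC : ∀ z, W z ≤ C) :
    ∫⁻ ω, ∑' i, discounted δ T Y X (fun p => W (leftLimit X p - Y i ω))
        ((T (i + 1) ω).toNNReal, ω) ∂P =
      expectedDiscounted P δ T Y X (fun p => lam * claimMean Q W (leftLimit X p)) := by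
  have := h.isProbabilityMeasure
  have hL := measurable_leftLimit hX
  have hmp : Measurable[𝓕.predictable.prod inferInstance] fun q : (ℝ≥0 × Ω) × ℝ =>
      discounted δ T Y X (fun p => W (leftLimit X p - q.2)) q.1 := by
    have : (fun q : (ℝ≥0 × Ω) × ℝ => discounted δ T Y X (fun p => W (leftLimit X p - q.2)) q.1) =
        (Prod.fst ⁻¹' aliveSet T Y X).indicator fun q => ENNReal.ofReal
          (Real.exp (-δ * q.1.1) * W (leftLimit X q.1 - q.2)) := rfl
    rw [this]
    refine Measurable.indicator ?_ (measurable_fst (h.measurableSet_aliveSet hX))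
    refine ENNReal.measurable_ofReal.comp (Measurable.mul ?_
      (hW.comp ((hL.comp measurable_fst).sub measurable_snd)))
    exact Real.measurable_exp.comp ((measurable_coe_nnreal_real.comp
      (measurable_predictable_fst.comp measurable_fst)).const_mul _)
  have key := h.tsum_lintegral_claims hlam hmp
  rw [expectedDiscounted_const_mul hlam.le, expectedDiscounted]
  have hclaim : ∀ p, ∫⁻ y, discounted δ T Y X (fun p => W (leftLimit X p - y)) p ∂Q =
      discounted δ T Y X (fun p => claimMean Q W (leftLimit X p)) p := fun p => by
    by_cases hp : p ∈ aliveSet T Y X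
    · simp only [discounted, indicator_of_mem hp, claimMean]
      rw [← integral_const_mul, ofReal_integral_eq_lintegral_ofReal]
      · refine Integrable.const_mul ?_ _
        refine Integrable.of_bound (hW.comp (measurable_const.sub measurable_id)).aestronglyMeasurable
          C (Eventually.of_forall fun y => ?_)
        rw [Real.norm_of_nonneg (hW0 _)]
        exact hWC _
      · exact Eventually.of_forall fun y => mul_nonneg (Real.exp_pos _).le (hW0 _)
    · simp [discounted, indicator_of_notMem hp]
  simp only [hclaim] at key
  rw [← key, lintegral_tsum]
  intro i
  have hm : Measurable fun q : (ℝ≥0 × Ω) × ℝ =>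
      discounted δ T Y X (fun p => W (leftLimit X p - q.2)) q.1 :=
    hmp.mono (sup_le_sup (MeasurableSpace.comap_mono predictable_le) le_rfl) le_rfl
  exact (hm.comp (((h.measurable_epoch (i + 1)).real_toNNReal.prodMk measurable_id).prodMk
    (h.measurable_claim i))).aemeasurable

end Verification

/-! ### Present values and the verification inequality -/

section PresentValue

variable {Ω : Type*} [MeasurableSpace Ω] {P : Measure Ω}
  {𝓕 : Filtration ℝ≥0 (inferInstance : MeasurableSpace Ω)} {lam δ : ℝ} {Q : Measure ℝ}
  {T Y : ℕ → Ω → ℝ} {g W w : ℝ → ℝ} {u₀ x : ℝ} {u X : ℝ≥0 → Ω → ℝ}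

lemma IsSurplusPath.integral_eq (h : IsCompoundPoisson P 𝓕 lam Q T Y) {ω : Ω}
    (hgu : ∀ x, 0 ≤ x → u₀ < g x) (hx : 0 ≤ x) (hp : IsSurplusPath T Y g u₀ x u X ω) :
    ∫ t in {t : ℝ | 0 ≤ t ∧ ENNReal.ofReal t < ruinTime X ω},
        Real.exp (-δ * t) * u t.toNNReal ω =
      (∫⁻ s in Ioi (0 : ℝ), discounted δ T Y X (fun p => u p.1 p.2) (s.toNNReal, ω)).toReal := by
  have hm : Measurable fun t : ℝ => Real.exp (-δ * t) * u t.toNNReal ω :=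
    (Real.measurable_exp.comp (measurable_id.const_mul (-δ))).mul hp.measurable_rate
  rw [integral_eq_lintegral_of_nonneg_ae
    (Eventually.of_forall fun t => mul_nonneg (Real.exp_pos _).le (hp.rate_mem _).1)
    hm.aestronglyMeasurable]
  congr 1
  set A : Set ℝ := {s | ENNReal.ofReal s ≤ ruinTime X ω} with hA
  have hAm : MeasurableSet A := measurableSet_le ENNReal.measurable_ofReal measurable_const
  have h1 : ∀ s ∈ Ioi (0 : ℝ), discounted δ T Y X (fun p => u p.1 p.2) (s.toNNReal, ω) =
      A.indicator (fun s => ENNReal.ofReal (Real.exp (-δ * s) * u s.toNNReal ω)) s := fun s hs => by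
    have hmem := hp.mem_aliveSet_iff h hgu hx s.toNNReal
    by_cases hsA : s ∈ A
    · rw [indicator_of_mem hsA, discounted, indicator_of_mem (hmem.2 hsA),
        Real.coe_toNNReal _ (le_of_lt hs)]
    · rw [indicator_of_notMem hsA, discounted, indicator_of_notMem fun hcon => hsA (hmem.1 hcon)]
  rw [setLIntegral_congr_fun measurableSet_Ioi h1, setLIntegral_indicator hAm]
  refine setLIntegral_congr ?_
  -- The two time sets differ only at 0 and at a finite ruin time. For an infinite ruin time
  -- `toReal` gives 0, which is harmless.
  have hnull : volume ({0, (ruinTime X ω).toReal} : Set ℝ) = 0 :=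
    (Set.toFinite _).measure_zero _
  filter_upwards [measure_eq_zero_iff_ae_notMem.1 hnull] with t ht
  simp only [mem_insert_iff, mem_singleton_iff, not_or] at ht
  have : (0 ≤ t ∧ ENNReal.ofReal t < ruinTime X ω) ↔ (ENNReal.ofReal t ≤ ruinTime X ω ∧ 0 < t) := by
    constructor
    · rintro ⟨h2, h3⟩
      exact ⟨h3.le, lt_of_le_of_ne h2 (Ne.symm ht.1)⟩
    · rintro ⟨h2, h3⟩
      refine ⟨h3.le, lt_of_le_of_ne h2 fun heq => ht.2 ?_⟩
      rw [← heq, ENNReal.toReal_ofReal h3.le]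
  exact propext this

lemma IsAdmissible.expectedPresentValue_eq [IsProbabilityMeasure P]
    (h : IsCompoundPoisson P 𝓕 lam Q T Y) (hδ : 0 < δ)
    (hgu : ∀ x, 0 ≤ x → u₀ < g x) (hx : 0 ≤ x) (ha : IsAdmissible P 𝓕 g T Y u₀ x u X) :
    expectedPresentValue P δ u X =
      (expectedDiscounted P δ T Y X fun p => u p.1 p.2).toReal := by
  have hm := (h.measurable_discounted_path (δ := δ) ha.2.adapted
    (IsProgressive.measurable_uncurry ha.1.progressive)).lintegral_prod_right'
    (ν := volume.restrict (Ioi 0))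
  rw [expectedDiscounted, expectedPresentValue, ← integral_toReal hm.aemeasurable
    (ae_lt_top hm (expectedDiscounted_ne_top hδ fun p => (ha.1.mem_Icc p.1 p.2).2))]
  refine integral_congr_ae ?_
  filter_upwards [ha.ae_isSurplusPath] with ω hp
  exact hp.integral_eq h hgu hx

/-- Verification: a solution of the Hamilton-Jacobi-Bellman equation dominates the present value of
every dividend rate, and is attained by the feedback rule. -/
lemma IsAdmissible.expectedPresentValue_le [IsProbabilityMeasure P]
    (h : IsCompoundPoisson P 𝓕 lam Q T Y)
    (hW : IsHJBSolution g lam δ u₀ Q W w) (hlam : 0 < lam) (hδ : 0 < δ) (hu₀ : 0 < u₀)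
    (hgc : ContinuousOn g (Ici 0)) (hgu : ∀ x, 0 ≤ x → u₀ < g x) (hx : 0 ≤ x)
    (ha : IsAdmissible P 𝓕 g T Y u₀ x u X) :
    expectedPresentValue P δ u X ≤ W x ∧
    ((∀ᵐ ω ∂P, ∀ t : ℝ≥0, (t : ℝ≥0∞) < ruinTime X ω →
        (1 < w (X t ω) → u t ω = 0) ∧ (w (X t ω) ≤ 1 → u t ω = u₀)) →
      expectedPresentValue P δ u X = W x) := by
  have := h.isProbabilityMeasure
  have hX := ha.2.adapted
  have hL : Measurable (leftLimit X) := (measurable_leftLimit hX).mono predictable_le le_rfl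
  have hum := IsProgressive.measurable_uncurry ha.1.progressive
  have hM := measurable_claimMean (Q := Q) hW.measurable
  have hM0 : ∀ z, 0 ≤ claimMean Q W z := fun z => claimMean_nonneg hW.nonneg z
  have hMC : ∀ z, claimMean Q W z ≤ u₀ / δ := fun z =>
    claimMean_le hW.measurable hW.nonneg hW.le_bound z
  set A := expectedDiscounted P δ T Y X fun p => lam * W (leftLimit X p) with hA
  set B := expectedDiscounted P δ T Y X fun p => lam * claimMean Q W (leftLimit X p) with hB
  set Z := expectedDiscounted P δ T Y X fun p => u p.1 p.2 with hZ
  have hAtop : A ≠ ∞ := expectedDiscounted_ne_top hδ fun p =>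
    mul_le_mul_of_nonneg_left (hW.le_bound _) hlam.le
  have hBtop : B ≠ ∞ := expectedDiscounted_ne_top hδ fun p =>
    mul_le_mul_of_nonneg_left (hMC _) hlam.le
  have hBZ : expectedDiscounted P δ T Y X
      (fun p => lam * claimMean Q W (leftLimit X p) + u p.1 p.2) = B + Z := h.expectedDiscounted_add hX ((hM.comp hL).const_mul lam)
        (fun p => mul_nonneg hlam.le (hM0 _)) fun p => (ha.1.mem_Icc p.1 p.2).1
  have h1 := h.compensation_value (δ := δ) hlam hX hW.measurable
  have h2 := h.compensation_claim (δ := δ) hlam hX hW.measurable hW.nonneg hW.le_bound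
  have hm1 : Measurable fun ω => ∫⁻ s in Ioi (0 : ℝ), discounted δ T Y X
      (fun p => lam * claimMean Q W (leftLimit X p) + u p.1 p.2) (s.toNNReal, ω) :=
    (h.measurable_discounted_path hX (((hM.comp hL).const_mul lam).add hum)).lintegral_prod_right'
  have hm2 : Measurable fun ω => ∫⁻ s in Ioi (0 : ℝ), discounted δ T Y X
      (fun p => lam * W (leftLimit X p)) (s.toNNReal, ω) :=
    (h.measurable_discounted_path hX ((hW.measurable.comp hL).const_mul lam)).lintegral_prod_right'
  have hl : ∫⁻ ω, ((∑' i, discounted δ T Y X (fun p => W (leftLimit X p))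
        ((T (i + 1) ω).toNNReal, ω)) +
        ∫⁻ s in Ioi (0 : ℝ), discounted δ T Y X
          (fun p => lam * claimMean Q W (leftLimit X p) + u p.1 p.2) (s.toNNReal, ω)) ∂P =
      A + (B + Z) := by
    rw [lintegral_add_right _ hm1, h1, ← hBZ]
    rfl
  have hr : ∫⁻ ω, ((ENNReal.ofReal (W x) + ∑' i, discounted δ T Y X
          (fun p => W (leftLimit X p - Y i ω)) ((T (i + 1) ω).toNNReal, ω)) +
      ∫⁻ s in Ioi (0 : ℝ), discounted δ T Y X (fun p => lam * W (leftLimit X p)) (s.toNNReal, ω)) ∂P =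
      A + (B + ENNReal.ofReal (W x)) := by
    rw [lintegral_add_right _ hm2, lintegral_add_left measurable_const, h2, lintegral_const,
      measure_univ, mul_one]
    change ENNReal.ofReal (W x) + B + A = _
    ring
  rw [ha.expectedPresentValue_eq h hδ hgu hx]
  constructor
  · refine ENNReal.toReal_le_of_le_ofReal (hW.nonneg x) ?_
    -- After compensation both sides carry the same finite terms `A` and `B`, so only the dividends
    -- and the initial value remain.
    have hle : A + (B + Z) ≤ A + (B + ENNReal.ofReal (W x)) := by
      rw [← hl, ← hr]
      refine lintegral_mono_ae ?_
      filter_upwards [ha.ae_isSurplusPath] with ω hp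
      exact (hp.value h hW hlam hu₀ hgc hgu hx).1
    exact (ENNReal.add_le_add_iff_left hBtop).1 ((ENNReal.add_le_add_iff_left hAtop).1 hle)
  · intro hf
    have heq : A + (B + Z) = A + (B + ENNReal.ofReal (W x)) := by
      rw [← hl, ← hr]
      refine lintegral_congr_ae ?_
      filter_upwards [ha.ae_isSurplusPath, hf] with ω hp hfω
      exact (hp.value h hW hlam hu₀ hgc hgu hx).2 hfω
    have : Z = ENNReal.ofReal (W x) :=
      (ENNReal.add_right_inj hBtop).1 ((ENNReal.add_right_inj hAtop).1 heq)
    exact (congrArg ENNReal.toReal this).trans (ENNReal.toReal_ofReal (hW.nonneg x))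

end PresentValue

/-! ### The flow of a discontinuous autonomous equation -/

section Flow

/-- The time in which a solution of the autonomous equation with the velocity `r` travels from `0`
to `z`. -/
def travelTime (r : ℝ → ℝ) (z : ℝ) : ℝ := ∫ y in (0 : ℝ)..z, (r y)⁻¹

variable {r : ℝ → ℝ}

lemma travelTime_sub (hint : ∀ a b, IntervalIntegrable (fun y => (r y)⁻¹) volume a b) (a b : ℝ) :
    travelTime r b - travelTime r a = ∫ y in a..b, (r y)⁻¹ :=
  intervalIntegral.integral_interval_sub_left (hint 0 b) (hint 0 a)

lemma strictMono_travelTime (hpos : ∀ z, 0 < r z)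
    (hint : ∀ a b, IntervalIntegrable (fun y => (r y)⁻¹) volume a b) :
    StrictMono (travelTime r) := fun a b hab => by
  rw [← sub_pos, travelTime_sub hint]
  exact intervalIntegral.intervalIntegral_pos_of_pos_on (hint a b)
    (fun y _ => inv_pos.2 (hpos y)) hab

lemma continuous_travelTime (hint : ∀ a b, IntervalIntegrable (fun y => (r y)⁻¹) volume a b) :
    Continuous (travelTime r) :=
  intervalIntegral.continuous_primitive hint 0

/-- A change of variables that needs no derivative: the travel time sends dy/r to Lebesgue measure,
as is checked on half-open intervals. -/
lemma map_travelTime (hpos : ∀ z, 0 < r z)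
    (hint : ∀ a b, IntervalIntegrable (fun y => (r y)⁻¹) volume a b)
    (E : ℝ ≃o ℝ) (hE : ∀ z, E.symm z = travelTime r z) :
    (volume.withDensity fun y => ENNReal.ofReal (r y)⁻¹).map (travelTime r) = volume := by
  symm
  refine Measure.ext_of_Ioc _ _ fun a b hab => ?_
  have hpre : travelTime r ⁻¹' Ioc a b = Ioc (E a) (E b) := by
    ext z
    simp only [mem_preimage, mem_Ioc, ← hE]
    rw [OrderIso.symm_apply_le, OrderIso.lt_symm_apply]
  have hEab : E a ≤ E b := E.monotone hab.le
  rw [Measure.map_apply (continuous_travelTime hint).measurable measurableSet_Ioc, hpre,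
    withDensity_apply _ measurableSet_Ioc, ← ofReal_integral_eq_lintegral_ofReal
      ((intervalIntegrable_iff_integrableOn_Ioc_of_le hEab).1 (hint _ _))
      (Eventually.of_forall fun y => (inv_pos.2 (hpos y)).le),
    ← intervalIntegral.integral_of_le hEab, ← travelTime_sub hint, ← hE, ← hE]
  simp

/-- Passing from time to position multiplies the velocity by its reciprocal, leaving the length of
the interval travelled. -/
lemma lintegral_velocity (hr : Measurable r) (hpos : ∀ z, 0 < r z)
    (hint : ∀ a b, IntervalIntegrable (fun y => (r y)⁻¹) volume a b)
    (E : ℝ ≃o ℝ) (hE : ∀ z, E.symm z = travelTime r z) (a b : ℝ) :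
    ∫⁻ s in Ioc a b, ENNReal.ofReal (r (E s)) = ENNReal.ofReal (E b - E a) := by
  have hpre : travelTime r ⁻¹' Ioc a b = Ioc (E a) (E b) := by
    ext z
    simp only [mem_preimage, mem_Ioc, ← hE]
    rw [OrderIso.symm_apply_le, OrderIso.lt_symm_apply]
  have hm : Measurable fun s => ENNReal.ofReal (r (E s)) :=
    ENNReal.measurable_ofReal.comp (hr.comp E.continuous.measurable)
  have hk : Measurable fun y => ENNReal.ofReal (r y)⁻¹ := hr.inv.ennreal_ofReal
  have hm' : Measurable fun y => ENNReal.ofReal (r (E (travelTime r y))) :=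
    hm.comp (continuous_travelTime hint).measurable
  rw [← map_travelTime hpos hint E hE, setLIntegral_map measurableSet_Ioc hm
    (continuous_travelTime hint).measurable, hpre, restrict_withDensity measurableSet_Ioc,
    lintegral_withDensity_eq_lintegral_mul _ hk hm']
  have hone : ∀ y, ((fun y => ENNReal.ofReal (r y)⁻¹) *
      fun y => ENNReal.ofReal (r (E (travelTime r y)))) y = 1 := fun y => by
    rw [Pi.mul_apply, ← hE, OrderIso.apply_symm_apply,
      ← ENNReal.ofReal_mul (inv_pos.2 (hpos y)).le, inv_mul_cancel₀ (hpos y).ne', ENNReal.ofReal_one]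
  rw [lintegral_congr hone]
  simp

/-- The global flow of an autonomous equation with positive, possibly discontinuous, velocity. -/
lemma exists_flow (hr : Measurable r) (hpos : ∀ z, 0 < r z)
    (hint : ∀ a b, IntervalIntegrable (fun y => (r y)⁻¹) volume a b)
    (htop : Tendsto (travelTime r) atTop atTop) (hbot : Tendsto (travelTime r) atBot atBot) :
    ∃ φ : ℝ → ℝ → ℝ, Continuous (fun p : ℝ × ℝ => φ p.1 p.2) ∧ (∀ z, φ 0 z = z) ∧
      (∀ z, Monotone fun t => φ t z) ∧
      ∀ z t, 0 ≤ t → IntervalIntegrable (fun s => r (φ s z)) volume 0 t ∧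
        ∫ s in (0 : ℝ)..t, r (φ s z) = φ t z - z := by
  have hmono := strictMono_travelTime hpos hint
  have hcont := continuous_travelTime hint
  -- Travel time conjugates the flow to translation: φ t z = F⁻¹(t + F z).
  set F := hmono.orderIsoOfSurjective _ (hcont.surjective htop hbot) with hF
  have hFe : ∀ z, F z = travelTime r z := fun z => rfl
  refine ⟨fun t z => F.symm (t + F z), ?_, fun z => by simp, fun z s t hst => ?_, fun z t ht => ?_⟩
  · exact F.symm.continuous.comp (continuous_fst.add (F.continuous.comp continuous_snd))
  · exact F.symm.monotone (by simpa using hst)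
  · have key := lintegral_velocity hr hpos hint F.symm hFe (F z) (t + F z)
    have hle : F z ≤ t + F z := by linarith
    have hm : Measurable fun s => r (F.symm s) := hr.comp F.symm.continuous.measurable
    have hi : IntervalIntegrable (fun s => r (F.symm s)) volume (F z) (t + F z) := by
      rw [intervalIntegrable_iff_integrableOn_Ioc_of_le hle]
      refine ⟨hm.aestronglyMeasurable, ?_⟩
      rw [hasFiniteIntegral_iff_ofReal (Eventually.of_forall fun s => (hpos _).le), key]
      exact ENNReal.ofReal_lt_top
    constructor
    · have := hi.comp_add_right (F z)
      simpa using this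
    · rw [intervalIntegral.integral_comp_add_right (fun s => r (F.symm s)), zero_add,
        intervalIntegral.integral_of_le hle, integral_eq_lintegral_of_nonneg_ae
        (Eventually.of_forall fun s => (hpos _).le) hm.aestronglyMeasurable, key,
        ENNReal.toReal_ofReal]
      · simp
      · exact sub_nonneg.2 (F.symm.monotone hle)

end Flow

/-! ### The flow of the surplus under a stationary rate -/

section Feedback

variable {g : ℝ → ℝ} {u₀ : ℝ}

/-- The velocity of the surplus under a stationary rate has a global flow. -/
lemma exists_feedback_flow {K : ℝ≥0} (hg : LipschitzOnWith K g (Ici 0)) (hu₀ : 0 < u₀)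
    (hgu : ∀ x, 0 ≤ x → u₀ < g x) {v : ℝ → ℝ} (hv : Measurable v) (hvu : ∀ z, v z ∈ Icc 0 u₀) :
    ∃ φ : ℝ → ℝ → ℝ, Continuous (fun p : ℝ × ℝ => φ p.1 p.2) ∧ (∀ z, φ 0 z = z) ∧
      (∀ z, Monotone fun t => φ t z) ∧
      ∀ z t, 0 ≤ t →
        IntervalIntegrable (fun s => g (max (φ s z) 0) - v (max (φ s z) 0)) volume 0 t ∧
        ∫ s in (0 : ℝ)..t, (g (max (φ s z) 0) - v (max (φ s z) 0)) = φ t z - z := by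
  have hgc : Continuous fun z => g (max z 0) :=
    hg.continuousOn.comp_continuous (continuous_id.max continuous_const) fun z =>
      mem_Ici.2 (le_max_right _ _)
  have hmax : Measurable fun z : ℝ => max z 0 := measurable_id.max measurable_const
  -- Below 0 the velocity is frozen at its value at 0, since `g` is controlled only on [0, ∞).
  set r : ℝ → ℝ := fun z => g (max z 0) - v (max z 0) with hr
  have hrm : Measurable r := hgc.measurable.sub (hv.comp hmax)
  have hlow : ∀ z, 0 < g (max z 0) - u₀ := fun z => sub_pos.2 (hgu _ (le_max_right _ _))
  have hrlow : ∀ z, g (max z 0) - u₀ ≤ r z := fun z => sub_le_sub_left (hvu _).2 _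
  have hpos : ∀ z, 0 < r z := fun z => (hlow z).trans_le (hrlow z)
  have hint : ∀ a b, IntervalIntegrable (fun y => (r y)⁻¹) volume a b := fun a b => by
    have hc : Continuous fun z => (g (max z 0) - u₀)⁻¹ :=
      (hgc.sub continuous_const).inv₀ fun z => (hlow z).ne'
    refine (hc.intervalIntegrable a b).mono_fun hrm.inv.aestronglyMeasurable
      (Eventually.of_forall fun z => ?_)
    simp only
    rw [Real.norm_of_nonneg (inv_pos.2 (hpos z)).le, Real.norm_of_nonneg (inv_pos.2 (hlow z)).le]
    exact inv_anti₀ (hlow z) (hrlow z)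
  have hg0 : 0 < g 0 := hu₀.trans (hgu 0 le_rfl)
  -- Adding 1 keeps the constant positive when K = 0. The linear growth bound makes the travel time
  -- to infinity dominate a diverging logarithm.
  set C : ℝ := K + 1 with hC
  have hC0 : 0 < C := by positivity
  have hup : ∀ z, 0 ≤ z → r z ≤ g 0 + C * z := fun z hz => by
    have h1 := hg.dist_le_mul z hz 0 (mem_Ici.2 le_rfl)
    rw [Real.dist_eq, Real.dist_eq, sub_zero, abs_of_nonneg hz] at h1
    have h2 := (abs_le.1 h1).2
    have h3 := (hvu (max z 0)).1
    simp only [hr]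
    rw [max_eq_left hz] at h3 ⊢
    nlinarith
  refine exists_flow hrm hpos hint ?_ ?_
  · have hlog : Tendsto (fun z => C⁻¹ * (Real.log (g 0 + C * z) - Real.log (g 0))) atTop atTop := by
      refine Tendsto.const_mul_atTop (inv_pos.2 hC0) (tendsto_atTop_add_const_right _ _ ?_)
      exact Real.tendsto_log_atTop.comp
        (tendsto_atTop_add_const_left _ _ (tendsto_id.const_mul_atTop hC0))
    refine tendsto_atTop_mono' _ ?_ hlog
    filter_upwards [eventually_ge_atTop 0] with z hz
    have hposl : ∀ y ∈ uIcc 0 z, 0 < g 0 + C * y := fun y hy => by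
      rw [uIcc_of_le hz] at hy
      have := mul_nonneg hC0.le hy.1
      linarith
    have hd : ∀ y ∈ uIcc 0 z,
        HasDerivAt (fun y => C⁻¹ * (Real.log (g 0 + C * y) - Real.log (g 0))) (g 0 + C * y)⁻¹ y := by
      intro y hy
      have h1 : HasDerivAt (fun y => g 0 + C * y) C y := by
        simpa using ((hasDerivAt_id y).const_mul C).const_add (g 0)
      have h2 := ((h1.log (hposl y hy).ne').sub_const (Real.log (g 0))).const_mul C⁻¹
      rwa [div_eq_mul_inv, inv_mul_cancel_left₀ hC0.ne'] at h2
    have hci : IntervalIntegrable (fun y => (g 0 + C * y)⁻¹) volume 0 z := by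
      refine ContinuousOn.intervalIntegrable (ContinuousOn.inv₀ (by fun_prop) fun y hy =>
        (hposl y hy).ne')
    have hI := intervalIntegral.integral_eq_sub_of_hasDerivAt hd hci
    simp only [mul_zero, add_zero, sub_self, sub_zero] at hI
    rw [← hI]
    refine intervalIntegral.integral_mono_on hz hci (hint 0 z) fun y hy => ?_
    exact inv_anti₀ (hpos y) (hup y hy.1)
  · have hlin : Tendsto (fun z => (r 0)⁻¹ * z) atBot atBot :=
      tendsto_id.const_mul_atBot (inv_pos.2 (hpos 0))
    refine hlin.congr' ?_
    filter_upwards [eventually_le_atBot 0] with z hz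
    have : travelTime r z = ∫ y in (0 : ℝ)..z, (r 0)⁻¹ :=
      intervalIntegral.integral_congr fun y hy => by
        rw [uIcc_of_ge hz] at hy
        simp only [hr, max_eq_right hy.2, max_self]
    rw [this, intervalIntegral.integral_const, smul_eq_mul, sub_zero, mul_comm]

end Feedback

/-! ### The surplus under a stationary rate -/

section FlowStates

/-- The states at the epochs `τ i` of a system which follows the flow `φ` and jumps down by `y i`
at the epoch `τ (i + 1)`. -/
def flowState (φ : ℝ → ℝ → ℝ) (x : ℝ) (τ y : ℕ → ℝ) : ℕ → ℝ
  | 0 => x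
  | i + 1 => φ (τ (i + 1) - τ i) (flowState φ x τ y i) - y i

/-- Permits replacing the epochs and claims by their versions observed at a given time. -/
lemma flowState_congr (φ : ℝ → ℝ → ℝ) (x : ℝ) {τ τ' y y' : ℕ → ℝ} {n : ℕ}
    (hτ : ∀ i ≤ n, τ i = τ' i) (hy : ∀ i < n, y i = y' i) :
    flowState φ x τ y n = flowState φ x τ' y' n := by
  induction n with
  | zero => rfl
  | succ n ih =>
    rw [flowState, flowState, ih (fun i hi => hτ i (by omega)) (fun i hi => hy i (by omega)),
      hτ _ le_rfl, hτ n (by omega), hy n (by omega)]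

/-- The process which follows the flow `φ` between the claims. -/
def flowSurplus {Ω : Type*} (φ : ℝ → ℝ → ℝ) (T Y : ℕ → Ω → ℝ) (x : ℝ) (t : ℝ≥0) (ω : Ω) : ℝ :=
  φ (t - T (claimCount T t ω) ω)
    (flowState φ x (fun i => T i ω) (fun i => Y i ω) (claimCount T t ω))

end FlowStates

section FlowSurplus

variable {Ω : Type*} [MeasurableSpace Ω] {P : Measure Ω}
  {𝓕 : Filtration ℝ≥0 (inferInstance : MeasurableSpace Ω)} {lam : ℝ} {Q : Measure ℝ}
  {T Y : ℕ → Ω → ℝ} {φ : ℝ → ℝ → ℝ} {R : ℝ → ℝ} {x : ℝ}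

lemma IsCompoundPoisson.flowSurplus_eq (h : IsCompoundPoisson P 𝓕 lam Q T Y) {i : ℕ} {t : ℝ≥0}
    {ω : Ω} (h1 : T i ω ≤ t) (h2 : (t : ℝ) < T (i + 1) ω) :
    flowSurplus φ T Y x t ω =
      φ (t - T i ω) (flowState φ x (fun i => T i ω) (fun i => Y i ω) i) := by
  rw [flowSurplus, h.claimCount_eq h1 h2]

lemma IsCompoundPoisson.flowSurplus_rightContinuous (h : IsCompoundPoisson P 𝓕 lam Q T Y)
    (hφ : Continuous fun p : ℝ × ℝ => φ p.1 p.2) (ω : Ω) (t : ℝ≥0) :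
    ContinuousWithinAt (fun s => flowSurplus φ T Y x s ω) (Ici t) t := by
  have hc : Continuous fun s : ℝ≥0 => φ (s - T (claimCount T t ω) ω)
      (flowState φ x (fun i => T i ω) (fun i => Y i ω) (claimCount T t ω)) :=
    hφ.comp ((NNReal.continuous_coe.sub continuous_const).prodMk continuous_const)
  refine hc.continuousWithinAt.congr_of_eventuallyEq ?_ rfl
  filter_upwards [h.claimCount_eventually_eq t ω] with s hs
  rw [flowSurplus, hs]

/-- The value at `t` involves only epochs and claims up to `t`, which agree with the stopped epochs
and observed claims; the number of claims is a countable index known at `t`. -/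
lemma IsCompoundPoisson.adapted_flowSurplus (h : IsCompoundPoisson P 𝓕 lam Q T Y)
    (hφ : Continuous fun p : ℝ × ℝ => φ p.1 p.2) : Adapted 𝓕 (flowSurplus φ T Y x) := by
  intro t
  set τ : ℕ → Ω → ℝ := fun i ω => ((min (T i ω).toNNReal t : ℝ≥0) : ℝ) with hτ
  have hτm : ∀ i, Measurable[𝓕 t] (τ i) := fun i =>
    measurable_coe_nnreal_real.comp (h.measurable_epoch_min i t)
  have hstate : ∀ n, Measurable[𝓕 t] fun ω =>
      flowState φ x (fun i => τ i ω) (fun i => observedClaim T Y t i ω) n := by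
    intro n
    induction n with
    | zero => exact measurable_const
    | succ n ih =>
      exact (hφ.measurable.comp (((hτm (n + 1)).sub (hτm n)).prodMk ih)).sub
        (h.measurable_observedClaim t n)
  have h1 : Measurable[(⊤ : MeasurableSpace ℕ).prod (𝓕 t)] fun q : ℕ × Ω =>
      φ (t - τ q.1 q.2) (flowState φ x (fun i => τ i q.2)
        (fun i => observedClaim T Y t i q.2) q.1) :=
    measurable_from_prod_countable_right fun n =>
      hφ.measurable.comp ((measurable_const.sub (hτm n)).prodMk (hstate n))
  have h2 : Measurable[𝓕 t, (⊤ : MeasurableSpace ℕ).prod (𝓕 t)] fun ω : Ω =>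
      (claimCount T t ω, ω) := Measurable.prodMk (h.adapted_count t) measurable_id
  have h3 := h1.comp h2
  convert h3 using 1
  ext ω
  have hle : ∀ i ≤ claimCount T t ω, T i ω = τ i ω := fun i hi => by
    have h4 : T i ω ≤ t := ((h.epoch_strictMono ω).monotone hi).trans (h.epoch_claimCount_le t ω)
    rw [hτ]
    simp only
    rw [min_eq_left (Real.toNNReal_le_iff_le_coe.2 h4), Real.coe_toNNReal _ (h.epoch_nonneg i ω)]
  simp only [flowSurplus, Function.comp_apply]
  rw [← hle _ le_rfl]
  congr 1
  refine flowState_congr φ x hle fun i hi => (h.observedClaim_eq ?_).symm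
  exact ((h.epoch_strictMono ω).monotone hi).trans (h.epoch_claimCount_le t ω)

lemma IsCompoundPoisson.flowSurplus_segment (h : IsCompoundPoisson P 𝓕 lam Q T Y)
    (hR : ∀ z t, 0 ≤ t → IntervalIntegrable (fun s => R (φ s z)) volume 0 t ∧
      ∫ s in (0 : ℝ)..t, R (φ s z) = φ t z - z) (ω : Ω) (i : ℕ) {t : ℝ}
    (h1 : T i ω ≤ t) (h2 : t ≤ T (i + 1) ω) :
    IntervalIntegrable (fun s : ℝ => R (flowSurplus φ T Y x s.toNNReal ω)) volume (T i ω) t ∧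
      ∫ s in (T i ω)..t, R (flowSurplus φ T Y x s.toNNReal ω) =
        φ (t - T i ω) (flowState φ x (fun i => T i ω) (fun i => Y i ω) i) -
          flowState φ x (fun i => T i ω) (fun i => Y i ω) i := by
  set z := flowState φ x (fun i => T i ω) (fun i => Y i ω) i
  obtain ⟨hi, hI⟩ := hR z (t - T i ω) (sub_nonneg.2 h1)
  have hcongr : ∀ s ∈ uIoo (T i ω) t,
      R (φ (s - T i ω) z) = R (flowSurplus φ T Y x s.toNNReal ω) := fun s hs => by
    rw [uIoo_of_le h1] at hs
    have hs0 : 0 ≤ s := (h.epoch_nonneg i ω).trans hs.1.le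
    rw [h.flowSurplus_eq (i := i)] <;> rw [Real.coe_toNNReal s hs0]
    exacts [hs.1.le, hs.2.trans_le h2]
  have hi' := hi.comp_sub_right (T i ω)
  rw [zero_add, sub_add_cancel] at hi'
  refine ⟨hi'.congr_uIoo hcongr, ?_⟩
  rw [← intervalIntegral.integral_congr_uIoo hcongr,
    intervalIntegral.integral_comp_sub_right (fun s => R (φ s z)), sub_self, hI]

lemma IsCompoundPoisson.flowSurplus_equation (h : IsCompoundPoisson P 𝓕 lam Q T Y)
    (hR : ∀ z t, 0 ≤ t → IntervalIntegrable (fun s => R (φ s z)) volume 0 t ∧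
      ∫ s in (0 : ℝ)..t, R (φ s z) = φ t z - z) (ω : Ω) (t : ℝ≥0) :
    IntervalIntegrable (fun s : ℝ => R (flowSurplus φ T Y x s.toNNReal ω)) volume 0 t ∧
      flowSurplus φ T Y x t ω = x + (∫ s in (0 : ℝ)..t, R (flowSurplus φ T Y x s.toNNReal ω)) -
        aggregateClaims T Y t ω := by
  have hepoch : ∀ i, IntervalIntegrable (fun s : ℝ => R (flowSurplus φ T Y x s.toNNReal ω))
      volume 0 (T i ω) ∧ flowState φ x (fun i => T i ω) (fun i => Y i ω) i =
        x + (∫ s in (0 : ℝ)..T i ω, R (flowSurplus φ T Y x s.toNNReal ω)) -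
          ∑ j ∈ Finset.range i, Y j ω := by
    intro i
    induction i with
    | zero => simp [h.epoch_zero, flowState]
    | succ i ih =>
      obtain ⟨h1, h2⟩ := h.flowSurplus_segment (x := x) hR ω i
        (h.epoch_strictMono ω (Nat.lt_succ_self i)).le le_rfl
      refine ⟨ih.1.trans h1, ?_⟩
      rw [← intervalIntegral.integral_add_adjacent_intervals ih.1 h1, h2, flowState,
        Finset.sum_range_succ]
      linarith [ih.2]
  set i := claimCount T t ω with hi
  have hle := h.epoch_claimCount_le t ω
  have hlt := h.lt_epoch_claimCount t ω
  obtain ⟨h1, h2⟩ := h.flowSurplus_segment (x := x) hR ω i hle hlt.le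
  refine ⟨(hepoch i).1.trans h1, ?_⟩
  rw [← intervalIntegral.integral_add_adjacent_intervals (hepoch i).1 h1, h2,
    h.flowSurplus_eq hle hlt, h.aggregateClaims_eq hle hlt]
  linarith [(hepoch i).2]

/-- The infimum defining ruin is attained: a nonnegative value at `t` stays nonnegative until the
next epoch because the flow is increasing in time, and that epoch is strictly later. -/
lemma IsCompoundPoisson.flowSurplus_neg_at_ruin (h : IsCompoundPoisson P 𝓕 lam Q T Y)
    (hφ : ∀ z, Monotone fun t => φ t z) (ω : Ω) (t : ℝ≥0)
    (ht : ruinTime (flowSurplus φ T Y x) ω = t) : flowSurplus φ T Y x t ω < 0 := by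
  by_contra hcon
  rw [not_lt] at hcon
  have hlt := h.lt_epoch_claimCount t ω
  set i := claimCount T t ω with hi
  have hle := h.epoch_claimCount_le t ω
  have hb : ((T (i + 1) ω).toNNReal : ℝ≥0∞) ≤ ruinTime (flowSurplus φ T Y x) ω := by
    refine le_sInf ?_
    rintro _ ⟨s, hs, rfl⟩
    have hts : t ≤ s := by
      have : ruinTime (flowSurplus φ T Y x) ω ≤ s := sInf_le ⟨s, hs, rfl⟩
      rw [ht] at this
      exact_mod_cast this
    by_contra hlt'
    rw [not_le] at hlt'
    have hs' : (s : ℝ) < T (i + 1) ω := Real.lt_toNNReal_iff_coe_lt.1 (ENNReal.coe_lt_coe.1 hlt')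
    have hts' : (t : ℝ) ≤ s := by exact_mod_cast hts
    have hneg : flowSurplus φ T Y x s ω < 0 := hs
    rw [h.flowSurplus_eq (hle.trans hts') hs'] at hneg
    rw [h.flowSurplus_eq hle hlt] at hcon
    exact absurd (hcon.trans (hφ _ (sub_le_sub_right hts' _))) (not_le.2 hneg)
  rw [ht] at hb
  have : (T (i + 1) ω).toNNReal ≤ t := by exact_mod_cast hb
  exact absurd (Real.toNNReal_le_iff_le_coe.1 this) (not_le.2 hlt)

end FlowSurplus

section FeedbackPolicy

variable {Ω : Type*} [MeasurableSpace Ω] {P : Measure Ω}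
  {𝓕 : Filtration ℝ≥0 (inferInstance : MeasurableSpace Ω)} {lam : ℝ} {Q : Measure ℝ}
  {T Y : ℕ → Ω → ℝ} {g : ℝ → ℝ} {u₀ x : ℝ}

/-- A measurable stationary rate `v` has a surplus process: the rate is `v (X t)` before ruin. -/
lemma IsCompoundPoisson.exists_stationary (h : IsCompoundPoisson P 𝓕 lam Q T Y) {K : ℝ≥0}
    (hg : LipschitzOnWith K g (Ici 0)) (hu₀ : 0 < u₀) (hgu : ∀ x, 0 ≤ x → u₀ < g x)
    {v : ℝ → ℝ} (hv : Measurable v) (hvu : ∀ z, v z ∈ Icc 0 u₀) (x : ℝ) :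
    ∃ u X : ℝ≥0 → Ω → ℝ, IsAdmissible P 𝓕 g T Y u₀ x u X ∧
      ∀ ω, ∀ t : ℝ≥0, (t : ℝ≥0∞) < ruinTime X ω → u t ω = v (X t ω) := by
  obtain ⟨φ, hφc, -, hφm, hφR⟩ := exists_feedback_flow hg hu₀ hgu hv hvu
  set X := flowSurplus φ T Y x with hX
  have hmax : Measurable fun z : ℝ => max z 0 := measurable_id.max measurable_const
  have hXa : Adapted 𝓕 X := h.adapted_flowSurplus hφc
  have hXp : IsProgressive 𝓕 X :=
    isProgressive_of_rightContinuous hXa (h.flowSurplus_rightContinuous hφc)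
  have hrate : IsDividendRate 𝓕 u₀ fun t ω => v (max (X t ω) 0) :=
    -- Evaluating `v` at max(X, 0) matches the frozen velocity of the flow; before ruin the
    -- truncation is inactive.
    ⟨fun t => (hv.comp hmax).comp (hXp t), fun t ω => hvu _⟩
  refine ⟨fun t ω => v (max (X t ω) 0), X, ⟨hrate, hXa, ?_, ?_⟩, fun ω t ht => ?_⟩
  · refine Eventually.of_forall fun ω t ht => ?_
    obtain ⟨h1, h2⟩ := h.flowSurplus_equation (x := x)
      (R := fun z => g (max z 0) - v (max z 0)) hφR ω t
    have hum : Measurable fun s : ℝ => v (max (X s.toNNReal ω) 0) :=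
      (IsProgressive.measurable_uncurry hrate.progressive).comp
        (measurable_real_toNNReal.prodMk measurable_const)
    have hui : IntervalIntegrable (fun s : ℝ => v (max (X s.toNNReal ω) 0)) volume 0 t := by
      refine (intervalIntegrable_const (c := u₀)).mono_fun hum.aestronglyMeasurable
        (Eventually.of_forall fun s => ?_)
      simp only
      rw [Real.norm_of_nonneg (hvu _).1]
      exact (hvu _).2.trans (le_abs_self _)
    have hgi := h1.add hui
    have hcongr : ∀ s ∈ uIoo (0 : ℝ) t,
        (g (max (X s.toNNReal ω) 0) - v (max (X s.toNNReal ω) 0)) + v (max (X s.toNNReal ω) 0) =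
          g (X s.toNNReal ω) := fun s hs => by
      rw [uIoo_of_le (NNReal.coe_nonneg t)] at hs
      have hst : (s.toNNReal : ℝ≥0∞) < ruinTime X ω := by
        refine lt_of_lt_of_le ?_ ht
        exact_mod_cast (coe_toNNReal_lt hs.1.le).2 hs.2
      rw [sub_add_cancel, max_eq_left (nonneg_of_lt_ruinTime hst)]
    refine ⟨hgi.congr_uIoo hcongr, ?_⟩
    have h3 := intervalIntegral.integral_congr_uIoo (μ := volume) hcongr
    have h4 := intervalIntegral.integral_add h1 hui
    rw [← h3, hX, h2]
    linarith
  · exact Eventually.of_forall fun ω t ht => h.flowSurplus_neg_at_ruin hφm ω t ht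
  · simp only
    rw [max_eq_left (nonneg_of_lt_ruinTime ht)]

end FeedbackPolicy

/-! ### The value function -/

section ValueFunction

variable {Ω : Type*} [MeasurableSpace Ω] {P : Measure Ω} [IsProbabilityMeasure P]
  {𝓕 : Filtration ℝ≥0 (inferInstance : MeasurableSpace Ω)} {lam δ : ℝ} {Q : Measure ℝ}
  {T Y : ℕ → Ω → ℝ} {g W w : ℝ → ℝ} {u₀ : ℝ} {K : ℝ≥0}

/-- Applies the construction on the whole line to z ↦ g(max z 0), which is continuous and above u₀
everywhere. -/
lemma exists_isHJBSolution_of_lipschitzOnWith [IsProbabilityMeasure Q]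
    (hg : LipschitzOnWith K g (Ici 0)) (hgu : ∀ x, 0 ≤ x → u₀ < g x)
    (hlam : 0 < lam) (hδ : 0 < δ) (hu₀ : 0 < u₀) :
    ∃ W w : ℝ → ℝ, IsHJBSolution g lam δ u₀ Q W w := by
  have hgc : Continuous fun z => g (max z 0) :=
    hg.continuousOn.comp_continuous (continuous_id.max continuous_const) fun z =>
      mem_Ici.2 (le_max_right _ _)
  obtain ⟨W, w, hW⟩ := exists_isHJBSolution (Q := Q) hgc
    (fun z => hgu _ (le_max_right _ _)) hlam hδ hu₀
  refine ⟨W, w, ⟨hW.measurable, hW.eq_zero_of_neg, hW.nonneg, hW.le_bound, hW.lipschitz,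
    hW.hasDerivWithinAt, hW.hasDerivAt, fun z hz => ?_⟩⟩
  have := hW.equation z hz
  rwa [max_eq_left hz] at this

/-- The equation expresses the slope through measurable functions on [0, ∞); nothing is known about
`w` below 0, hence the truncation. -/
lemma IsHJBSolution.measurable_slope [IsProbabilityMeasure Q]
    (hW : IsHJBSolution g lam δ u₀ Q W w) (hg : ContinuousOn g (Ici 0)) :
    Measurable fun z => w (max z 0) := by
  have hmax : Measurable fun z : ℝ => max z 0 := measurable_id.max measurable_const
  have hgm : Measurable fun z => g (max z 0) :=
    (hg.comp_continuous (continuous_id.max continuous_const) fun z =>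
      mem_Ici.2 (le_max_right _ _)).measurable
  have hWm := hW.measurable.comp hmax
  have hMm := (measurable_claimMean (Q := Q) hW.measurable).comp hmax
  have hR := (hWm.const_mul (lam + δ)).sub (hMm.const_mul lam)
  exact (funext fun z => hW.equation (max z 0) (le_max_right _ _)) ▸
    (hR.div hgm).min ((hR.sub_const u₀).div (hgm.sub_const u₀))

lemma IsHJBSolution.exists_feedback (hW : IsHJBSolution g lam δ u₀ Q W w)
    (h : IsCompoundPoisson P 𝓕 lam Q T Y) (hg : LipschitzOnWith K g (Ici 0)) (hu₀ : 0 < u₀)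
    (hgu : ∀ x, 0 ≤ x → u₀ < g x) (x : ℝ) :
    ∃ u X : ℝ≥0 → Ω → ℝ, IsAdmissible P 𝓕 g T Y u₀ x u X ∧
      ∀ ω, ∀ t : ℝ≥0, (t : ℝ≥0∞) < ruinTime X ω →
        (1 < w (X t ω) → u t ω = 0) ∧ (w (X t ω) ≤ 1 → u t ω = u₀) := by
  have := h.isProbabilityMeasure
  classical
  have hv : Measurable fun z => if 1 < w (max z 0) then 0 else u₀ :=
    Measurable.ite (measurableSet_lt measurable_const (hW.measurable_slope hg.continuousOn))
      measurable_const measurable_const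
  obtain ⟨u, X, ha, hu⟩ := h.exists_stationary hg hu₀ hgu hv (fun z => by
    split_ifs
    exacts [⟨le_rfl, hu₀.le⟩, ⟨hu₀.le, le_rfl⟩]) x
  refine ⟨u, X, ha, fun ω t ht => ?_⟩
  rw [hu ω t ht, max_eq_left (nonneg_of_lt_ruinTime ht)]
  exact ⟨fun h1 => if_pos h1, fun h1 => if_neg (not_lt.2 h1)⟩

/-- The feedback policy attains the bound valid for all policies, so the supremum is a greatest
element. -/
lemma IsHJBSolution.restrictedValue_eq (hW : IsHJBSolution g lam δ u₀ Q W w)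
    (h : IsCompoundPoisson P 𝓕 lam Q T Y) (hlam : 0 < lam) (hδ : 0 < δ) (hu₀ : 0 < u₀)
    (hg : LipschitzOnWith K g (Ici 0)) (hgu : ∀ x, 0 ≤ x → u₀ < g x) {x : ℝ} (hx : 0 ≤ x) :
    restrictedValue P 𝓕 g T Y δ u₀ x = W x := by
  obtain ⟨u, X, ha, hf⟩ := hW.exists_feedback h hg hu₀ hgu x
  refine IsGreatest.csSup_eq ⟨⟨u, X, ha, ?_⟩, ?_⟩
  · exact ((ha.expectedPresentValue_le h hW hlam hδ hu₀ hg.continuousOn hgu hx).2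
      (Eventually.of_forall hf)).symm
  · rintro _ ⟨u', X', ha', rfl⟩
    exact (ha'.expectedPresentValue_le h hW hlam hδ hu₀ hg.continuousOn hgu hx).1

end ValueFunction

end RiskModel

end

/-! ### Regularity of the value function and optimality of the feedback rule -/

theorem theorem3p3 {Ω : Type*} [MeasurableSpace Ω] (P : Measure Ω) [IsProbabilityMeasure P]
    (𝓕 : Filtration ℝ≥0 (inferInstance : MeasurableSpace Ω))
    (lam δ u₀ : ℝ) (hlam : 0 < lam) (hδ : 0 < δ) (hu₀ : 0 < u₀)
    (Q : Measure ℝ) (T Y : ℕ → Ω → ℝ) (hTY : RiskModel.IsCompoundPoisson P 𝓕 lam Q T Y)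
    (g : ℝ → ℝ) (K : ℝ≥0) (hg : LipschitzOnWith K g (Ici 0)) (hgu : ∀ x, 0 ≤ x → u₀ < g x)
    (V : ℝ → ℝ) (hV : V = RiskModel.restrictedValue P 𝓕 g T Y δ u₀) :
    (∀ x, 0 ≤ x → DifferentiableWithinAt ℝ V (Ici x) x) ∧
    (∀ x, 0 < x → Q {x} = 0 → DifferentiableAt ℝ V x) ∧
    ∀ x, 0 ≤ x →
      (∃ u X : ℝ≥0 → Ω → ℝ, RiskModel.IsAdmissible P 𝓕 g T Y u₀ x u X ∧
        RiskModel.FollowsFeedback P u₀ V u X) ∧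
      ∀ u X : ℝ≥0 → Ω → ℝ, RiskModel.IsAdmissible P 𝓕 g T Y u₀ x u X →
        RiskModel.FollowsFeedback P u₀ V u X →
          RiskModel.expectedPresentValue P δ u X = V x ∧
          ∀ u' X' : ℝ≥0 → Ω → ℝ, RiskModel.IsAdmissible P 𝓕 g T Y u₀ x u' X' →
            RiskModel.expectedPresentValue P δ u' X' ≤ RiskModel.expectedPresentValue P δ u X := by
  have := hTY.isProbabilityMeasure
  obtain ⟨W, w, hW⟩ :=
    RiskModel.exists_isHJBSolution_of_lipschitzOnWith (Q := Q) hg hgu hlam hδ hu₀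
  have hVW : ∀ x, 0 ≤ x → V x = W x := fun x hx => by
    rw [hV]
    exact hW.restrictedValue_eq hTY hlam hδ hu₀ hg hgu hx
  have hd : ∀ x, 0 ≤ x → HasDerivWithinAt V (w x) (Ici x) x := fun x hx =>
    (hW.hasDerivWithinAt x hx).congr (fun y hy => hVW y (hx.trans hy)) (hVW x hx)
  -- Uniqueness of the right derivative makes the feedback rule stated with `V` the one stated with
  -- `w` at every surplus before ruin.
  have hrd : ∀ x, 0 ≤ x → RiskModel.rightDeriv V x = w x := fun x hx =>
    (hd x hx).derivWithin (uniqueDiffOn_Ici x x self_mem_Ici)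
  refine ⟨fun x hx => (hd x hx).differentiableWithinAt, fun x hx hQ => ?_, fun x hx => ⟨?_, ?_⟩⟩
  · refine ((hW.hasDerivAt x hx hQ).congr_of_eventuallyEq ?_).differentiableAt
    filter_upwards [lt_mem_nhds hx] with y hy using hVW y hy.le
  · obtain ⟨u, X, ha, hf⟩ := hW.exists_feedback hTY hg hu₀ hgu x
    refine ⟨u, X, ha, Eventually.of_forall fun ω t ht => ?_⟩
    rw [hrd _ (RiskModel.nonneg_of_lt_ruinTime ht)]
    exact hf ω t ht
  · intro u X ha hf
    have hval : RiskModel.expectedPresentValue P δ u X = W x := by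
      refine (ha.expectedPresentValue_le hTY hW hlam hδ hu₀ hg.continuousOn hgu hx).2 ?_
      filter_upwards [hf] with ω hfω t ht
      have := hfω t ht
      rwa [hrd _ (RiskModel.nonneg_of_lt_ruinTime ht)] at this
    refine ⟨hval.trans (hVW x hx).symm, fun u' X' ha' => ?_⟩
    rw [hval]
    exact (ha'.expectedPresentValue_le hTY hW hlam hδ hu₀ hg.continuousOn hgu hx).1
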